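/- **Simplicial sets with complicial identities.** A *set with complicial identities* is a simplicial set $X$ (sets $X_0,X_1,\ldots$ with faces $\partial_i\colon X_m\to X_{m-1}$ for $m>0$, $0\le i\le m$, and degeneracies $\epsilon_i\colon X_m\to X_{m+1}$ for $0\le i\le m$, satisfying the simplicial identities) together with *wedges* $x\wedge_i y\in X_{m+1}$, defined for $0\le i\le m-1$ and $x,y\in X_m$ with $\partial_i x=\partial_{i+1}y$, such that: 1. if $x\wedge_i y$ is defined with $x,y\in X_m$, then $\partial_j(x\wedge_i y)=\partial_jx\wedge_{i-1}\partial_jy$ for $0\le j<i$, $\partial_i(x\wedge_i y)=y$, $\partial_{i+2}(x\wedge_i y)=x$, and $\partial_j(x\wedge_i y)=\partial_{j-1}x\wedge_i\partial_{j-1}y$ for $i+3\le j\le m+1$; 2. if $x\in X_m$ and $0\le i<m$, then $\epsilon_ix=\epsilon_i\partial_{i+1}x\wedge_i x$ and $\epsilon_{i+1}x=x\wedge_i\epsilon_i\partial_ix$; 3. if $A=b\wedge_i(y\wedge_i z)$, then $A=(\partial_{i+2}b\wedge_i y)\wedge_{i+1}\partial_{i+1}A$; 4. if $A=(x\wedge_i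 y)\wedge_{i+1}c$, then $A=\partial_{i+2}A\wedge_i(y\wedge_i\partial_ic)$; 5. $[x\wedge_i\partial_{i+1}(y\wedge_i z)]\wedge_i(y\wedge_i z)=(x\wedge_i y)\wedge_{i+1}[\partial_{i+1}(x\wedge_i y)\wedge_i z]$ whenever either side is defined; 6. if $A=\partial_{i+2}[(x\wedge_{i+1}y)\wedge_{i+1}(y\wedge_i z)]$, then $A\wedge_i(w\wedge_{i+1}\partial_iA)=(\partial_{i+3}A\wedge_i w)\wedge_{i+2}A$ whenever either side is defined; 7. if $i\le j-3$, then $(x\wedge_i y)\wedge_j(z\wedge_i w)=(x\wedge_{j-1}z)\wedge_i(y\wedge_{j-1}w)$ whenever either side is defined. A *morphism* $f\colon X\to Y$ is a sequence of functions $X_m\to Y_m$ commuting with faces, degeneracies and wedges. **Orientals.** Let $\mathbb Z\Delta(n)$ be the free graded abelian group with basis elements $[a_0,\ldots,a_q]$ of degree $q$, one for each sequence of integers $0\le a_0<\cdots<a_q\le n$, with boundary $\partial[a_0,\ldots,a_q]=\sum_{i=0}^q(-1)^i[a_0,\ldots,a_{i-1},a_{i+1},\ldots,a_q]$ for $q>0$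 (and $\partial=0$ in degree $0$), and with the augmentation that sends each $[a_0]$ to $1$ and vanishes on basis elements of positive degree. Let $\mathcal O(m,n)$ be the set of augmentation-preserving chain maps $\mathbb Z\Delta(m)\to\mathbb Z\Delta(n)$ that send every basis element to a (possibly empty) sum of basis elements. On the graded set $\mathcal O(-,n)$, let $\partial_i$ and $\epsilon_i$ be precomposition with the chain maps induced by, respectively, the increasing function $\{0,\ldots,m-1\}\to\{0,\ldots,m\}$ that omits $i$ and the non-decreasing surjection $\{0,\ldots,m+1\}\to\{0,\ldots,m\}$ that takes the value $i$ twice (a basis element on whose vertices the function is not injective is sent to $0$). For $x,y\in\mathcal O(m,n)$, $0\le i\le m-1$ and $\partial_ix=\partial_{i+1}y$, let $x\wedge_i y=\epsilon_{i+1}x-\epsilon_i^2\partial_{i+1}y+\epsilon_iy\in\mathcal O(m+1,n)$. Let $\iota_n\in\mathcal O(n,n)$ be the identity. **Theorem.** For every $n\ge 0$, the graded set $\mathcal O(-,n)$, with these faces, degeneracies and wedges, is the set with complicial identities freely generated by $\iota_n$. That is, $\mathcal O(-,n)$ is a set with complicial identities, and for every set with complicial identities $U$ and every $u\in U_n$ there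 is a unique morphism $f\colon\mathcal O(-,n)\to U$ with $f(\iota_n)=u$. -/

import Mathlib

universe u v

noncomputable section

/-! ### Simplicial sets with wedges, complicial identities -/

/-- A graded set `X 0, X 1, …` with face operations `d i : X (m+1) → X m` for `i ≤ m+1`,
degeneracy operations `s i : X m → X (m+1)` for `i ≤ m`, and partial binary operations
`wedge i`, for `i ≤ m`, where `wedge i x y ∈ X (m+2)` is defined when `x, y ∈ X (m+1)` satisfy
`d i x = d (i+1) y`. No identities are imposed here: they are in `IsComplicial`. -/
structure WedgeData where
  X : ℕ → Type u
  d : {m : ℕ} → (i : ℕ) → (x : X (m + 1)) → (hi : i ≤ m + 1 := by omega) → X m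
  s : {m : ℕ} → (i : ℕ) → (x : X m) → (hi : i ≤ m := by omega) → X (m + 1)
  wedge : {m : ℕ} → (i : ℕ) → (hi : i ≤ m) → (x y : X (m + 1)) →
    d i x = d (i + 1) y → X (m + 2)

namespace WedgeData

/-- `U.IsWedge i x y w`: the wedge of `x` and `y` at place `i` is defined, and is equal to `w`.
It is the graph of the partial operation `wedge i`, so that for partial expressions `E` and `F`,
`∀ w, (E is defined and equal to w) ↔ (F is defined and equal to w)` says that `E = F` holds
whenever either side is defined. -/
def IsWedge (U : WedgeData.{u}) {m : ℕ} (i : ℕ) (x y : U.X (m + 1)) (w : U.X (m + 2))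
    (hi : i ≤ m := by omega) : Prop :=
  ∃ h : U.d i x = U.d (i + 1) y, U.wedge i hi x y h = w

/-- The simplicial identities. -/
structure IsSimplicial (U : WedgeData.{u}) : Prop where
  d_d : ∀ (m i j : ℕ) (_ : i ≤ j) (_ : j ≤ m + 1) (x : U.X (m + 2)),
    U.d i (U.d (j + 1) x) = U.d j (U.d i x)
  d_s_lt : ∀ (m i j : ℕ) (_ : i ≤ j) (_ : j ≤ m) (x : U.X (m + 1)),
    U.d i (U.s (j + 1) x) = U.s j (U.d i x)
  d_s_self : ∀ (m i : ℕ) (_ : i ≤ m) (x : U.X m), U.d i (U.s i x) = x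
  d_s_succ : ∀ (m i : ℕ) (_ : i ≤ m) (x : U.X m), U.d (i + 1) (U.s i x) = x
  d_s_gt : ∀ (m i j : ℕ) (_ : j < i) (_ : i ≤ m + 1) (x : U.X (m + 1)),
    U.d (i + 1) (U.s j x) = U.s j (U.d i x)
  s_s : ∀ (m i j : ℕ) (_ : i ≤ j) (_ : j ≤ m) (x : U.X m),
    U.s i (U.s j x) = U.s (j + 1) (U.s i x)

/-- Sets with complicial identities: the simplicial identities, and the axioms for wedges. -/
structure IsComplicial (U : WedgeData.{u}) : Prop extends IsSimplicial U where
  /-- `d_j (x ∧_{i+1} y) = d_j x ∧_i d_j y` for `j < i + 1` -/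
  d_wedge_lt : ∀ (m i j : ℕ) (_ : j ≤ i) (_ : i ≤ m) (x y : U.X (m + 2)) (w : U.X (m + 3)),
    U.IsWedge (i + 1) x y w → U.IsWedge i (U.d j x) (U.d j y) (U.d j w)
  /-- `d_i (x ∧_i y) = y` -/
  d_wedge_right : ∀ (m i : ℕ) (_ : i ≤ m) (x y : U.X (m + 1)) (w : U.X (m + 2)),
    U.IsWedge i x y w → U.d i w = y
  /-- `d_{i+2} (x ∧_i y) = x` -/
  d_wedge_left : ∀ (m i : ℕ) (_ : i ≤ m) (x y : U.X (m + 1)) (w : U.X (m + 2)),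
    U.IsWedge i x y w → U.d (i + 2) w = x
  /-- `d_{j+1} (x ∧_i y) = d_j x ∧_i d_j y` for `i + 3 ≤ j + 1` -/
  d_wedge_gt : ∀ (m i j : ℕ) (_ : i + 2 ≤ j) (_ : j ≤ m + 2) (x y : U.X (m + 2))
    (w : U.X (m + 3)),
    U.IsWedge i x y w → U.IsWedge i (U.d j x) (U.d j y) (U.d (j + 1) w)
  /-- `s_i x = s_i d_{i+1} x ∧_i x` -/
  s_eq_left : ∀ (m i : ℕ) (_ : i ≤ m) (x : U.X (m + 1)),
    U.IsWedge i (U.s i (U.d (i + 1) x)) x (U.s i x)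
  /-- `s_{i+1} x = x ∧_i s_i d_i x` -/
  s_eq_right : ∀ (m i : ℕ) (_ : i ≤ m) (x : U.X (m + 1)),
    U.IsWedge i x (U.s i (U.d i x)) (U.s (i + 1) x)
  /-- If `A = b ∧_i (y ∧_i z)` then `A = (d_{i+2} b ∧_i y) ∧_{i+1} d_{i+1} A`. -/
  wedge_form_left : ∀ (m i : ℕ) (_ : i ≤ m) (y z : U.X (m + 1)) (b c : U.X (m + 2))
    (A : U.X (m + 3)),
    U.IsWedge i y z c → U.IsWedge i b c A →
      ∃ p, U.IsWedge i (U.d (i + 2) b) y p ∧ U.IsWedge (i + 1) p (U.d (i + 1) A) A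
  /-- If `A = (x ∧_i y) ∧_{i+1} c` then `A = d_{i+2} A ∧_i (y ∧_i d_i c)`. -/
  wedge_form_right : ∀ (m i : ℕ) (_ : i ≤ m) (x y : U.X (m + 1)) (b c : U.X (m + 2))
    (A : U.X (m + 3)),
    U.IsWedge i x y b → U.IsWedge (i + 1) b c A →
      ∃ p, U.IsWedge i y (U.d i c) p ∧ U.IsWedge i (U.d (i + 2) A) p A
  /-- `[x ∧_i d_{i+1} (y ∧_i z)] ∧_i (y ∧_i z) = (x ∧_i y) ∧_{i+1} [d_{i+1} (x ∧_i y) ∧_i z]`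
  whenever either side is defined -/
  wedge_assoc : ∀ (m i : ℕ) (_ : i ≤ m) (x y z : U.X (m + 1)) (w : U.X (m + 3)),
    (∃ p q, U.IsWedge i y z p ∧ U.IsWedge i x (U.d (i + 1) p) q ∧ U.IsWedge i q p w) ↔
      (∃ p q, U.IsWedge i x y p ∧ U.IsWedge i (U.d (i + 1) p) z q ∧ U.IsWedge (i + 1) p q w)
  /-- If `A = d_{i+2} [(x ∧_{i+1} y) ∧_{i+1} (y ∧_i z)]` then
  `A ∧_i (w ∧_{i+1} d_i A) = (d_{i+3} A ∧_i w) ∧_{i+2} A` whenever either side is defined. -/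
  wedge_whisker : ∀ (m i : ℕ) (_ : i ≤ m) (x y z : U.X (m + 2)) (b c : U.X (m + 3))
    (D : U.X (m + 4)),
    U.IsWedge (i + 1) x y b → U.IsWedge i y z c → U.IsWedge (i + 1) b c D →
    ∀ (A : U.X (m + 3)), A = U.d (i + 2) D →
    ∀ (w : U.X (m + 2)) (B : U.X (m + 4)),
      (∃ p, U.IsWedge (i + 1) w (U.d i A) p ∧ U.IsWedge i A p B) ↔
        (∃ p, U.IsWedge i (U.d (i + 3) A) w p ∧ U.IsWedge (i + 2) p A B)
  /-- `(x ∧_i y) ∧_{j+1} (z ∧_i w) = (x ∧_j z) ∧_i (y ∧_j w)` whenever either side is defined,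
  for `i ≤ (j + 1) - 3` -/
  wedge_interchange : ∀ (m i j : ℕ) (_ : i + 2 ≤ j) (_ : j ≤ m) (x y z w : U.X (m + 1))
    (B : U.X (m + 3)),
    (∃ p q, U.IsWedge i x y p ∧ U.IsWedge i z w q ∧ U.IsWedge (j + 1) p q B) ↔
      (∃ p q, U.IsWedge j x z p ∧ U.IsWedge j y w q ∧ U.IsWedge i p q B)

/-- A morphism: a sequence of functions commuting with faces, degeneracies and wedges. -/
@[ext]
structure Hom (U : WedgeData.{u}) (V : WedgeData.{v}) where
  toFun : (m : ℕ) → U.X m → V.X m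
  map_d : ∀ (m i : ℕ) (_ : i ≤ m + 1) (x : U.X (m + 1)),
    toFun m (U.d i x) = V.d i (toFun (m + 1) x)
  map_s : ∀ (m i : ℕ) (_ : i ≤ m) (x : U.X m),
    toFun (m + 1) (U.s i x) = V.s i (toFun m x)
  map_wedge : ∀ (m i : ℕ) (_ : i ≤ m) (x y : U.X (m + 1)) (w : U.X (m + 2)),
    U.IsWedge i x y w → V.IsWedge i (toFun (m + 1) x) (toFun (m + 1) y) (toFun (m + 2) w)

end WedgeData

/-! ### The chain complexes of simplexes and the category of orientals -/

namespace Oriental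

/-- The basis elements `[a₀, …, a_q]`, `0 ≤ a₀ < … < a_q ≤ n`, of the chain complex of the standard
`n`-simplex, as the nonempty finite sets `{a₀, …, a_q}`. The degree is `q`, so that there are
`q + 1` elements. -/
abbrev Simplex (n : ℕ) : Type := {a : Finset ℕ // a.Nonempty ∧ ∀ k ∈ a, k ≤ n}

/-- The chain group `ℤΔ(n)`, the free abelian group on the basis elements of all degrees. -/
abbrev Chain (n : ℕ) : Type := Simplex n →₀ ℤ

/-- The chains that are homogeneous of degree `q`. -/
def degreePart (n q : ℕ) : Submodule ℤ (Chain n) :=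
  Finsupp.supported ℤ ℤ {a : Simplex n | a.1.card = q + 1}

open Classical in
/-- The basis element of `ℤΔ(n)` with vertex set `a`; it is `0` when `a` is not the vertex set of a
basis element, that is, when `a` is empty or has an element that is greater than `n`. -/
def elt (n : ℕ) (a : Finset ℕ) : Chain n :=
  if h : a.Nonempty ∧ ∀ k ∈ a, k ≤ n then Finsupp.single ⟨a, h⟩ 1 else 0

/-- The boundary `∂[a₀, …, a_q] = ∑ i, (-1) ^ i [a₀, …, a_{i-1}, a_{i+1}, …, a_q]`. The exponent of
the sign of the term without the vertex `k` is the number of vertices less than `k`. On basis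
elements of degree `0` the boundary is `0`, because `elt n ∅ = 0`. -/
def boundary (n : ℕ) : Chain n →ₗ[ℤ] Chain n :=
  Finsupp.linearCombination ℤ fun a : Simplex n =>
    ∑ k ∈ a.1, (-1 : ℤ) ^ (a.1.filter (· < k)).card • elt n (a.1.erase k)

/-- The augmentation. -/
def augmentation (n : ℕ) : Chain n →ₗ[ℤ] ℤ :=
  Finsupp.linearCombination ℤ fun a : Simplex n => if a.1.card = 1 then 1 else 0

/-- The abelian group `ℤΔ(m, n)` of chain maps from `ℤΔ(m)` to `ℤΔ(n)`. -/
def chainMaps (m n : ℕ) : Submodule ℤ (Chain m →ₗ[ℤ] Chain n) where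
  carrier := {f | (∀ q, ∀ c ∈ degreePart m q, f c ∈ degreePart n q) ∧
    ∀ c, boundary n (f c) = f (boundary m c)}
  add_mem' := fun hf hg =>
    ⟨fun q c hc => add_mem (hf.1 q c hc) (hg.1 q c hc), fun c => by
      simp [hf.2 c, hg.2 c]⟩
  zero_mem' := ⟨fun q _ _ => zero_mem (degreePart n q), fun c => by simp⟩
  smul_mem' := fun r _ hf =>
    ⟨fun q c hc => (degreePart n q).smul_mem r (hf.1 q c hc), fun c => by
      simp only [LinearMap.smul_apply, map_smul, hf.2 c]⟩

/-- The chain maps in `Or(m, n)`: they preserve the augmentation and send basis elements to sums of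
basis elements. -/
structure IsOr {m n : ℕ} (f : Chain m →ₗ[ℤ] Chain n) : Prop where
  mem_chainMaps : f ∈ chainMaps m n
  augmentation_comp : ∀ c, augmentation n (f c) = augmentation m c
  map_basis : ∀ a : Simplex m, f (Finsupp.single a 1) ∈
    AddSubmonoid.closure (Set.range fun b : Simplex n => (Finsupp.single b 1 : Chain n))

/-- The set `Or(m, n)`. -/
abbrev Or (m n : ℕ) : Type := {f : Chain m →ₗ[ℤ] Chain n // IsOr f}

open Classical in
/-- The homomorphism that a function `φ` on vertices induces on chains:
`[a₀, …, a_q] ↦ [φ a₀, …, φ a_q]` if `φ` is injective on `{a₀, …, a_q}`, and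
`[a₀, …, a_q] ↦ 0` otherwise. -/
def push (m n : ℕ) (φ : ℕ → ℕ) : Chain m →ₗ[ℤ] Chain n :=
  Finsupp.linearCombination ℤ fun a : Simplex m =>
    if Set.InjOn φ (a.1 : Set ℕ) then elt n (a.1.image φ) else 0

/-- The increasing function that omits the value `i`. -/
def skip (i k : ℕ) : ℕ := if k < i then k else k + 1

/-- The non-decreasing surjective function that takes the value `i` at `i` and at `i + 1`. -/
def dup (i k : ℕ) : ℕ := if k ≤ i then k else k - 1

/-- The face operation `d_i : ℤΔ(m+1, n) → ℤΔ(m, n)`. -/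
def face {m n : ℕ} (i : ℕ) (x : Chain (m + 1) →ₗ[ℤ] Chain n) : Chain m →ₗ[ℤ] Chain n :=
  x ∘ₗ push m (m + 1) (skip i)

/-- The degeneracy operation `s_i : ℤΔ(m, n) → ℤΔ(m+1, n)`. -/
def degen {m n : ℕ} (i : ℕ) (x : Chain m →ₗ[ℤ] Chain n) : Chain (m + 1) →ₗ[ℤ] Chain n :=
  x ∘ₗ push (m + 1) m (dup i)

/-- The wedge operation `x ∧_i y = s_{i+1} x - s_i s_i d_{i+1} y + s_i y`. -/
def wedge {m n : ℕ} (i : ℕ) (x y : Chain (m + 1) →ₗ[ℤ] Chain n) :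
    Chain (m + 2) →ₗ[ℤ] Chain n :=
  degen (i + 1) x - degen i (degen i (face (i + 1) y)) + degen i y

/-! The operations preserve the sets `Or(-, n)`. -/

theorem elt_of_simplex {n : ℕ} (a : Simplex n) : elt n a.1 = Finsupp.single a 1 := by
  unfold elt
  rw [dif_pos a.2]

theorem push_single {m n : ℕ} (φ : ℕ → ℕ) (a : Simplex m) [Decidable (Set.InjOn φ (a.1 : Set ℕ))] :
    push m n φ (Finsupp.single a 1) =
      if Set.InjOn φ (a.1 : Set ℕ) then elt n (a.1.image φ) else 0 := by
  unfold push
  rw [Finsupp.linearCombination_single, one_smul]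
  congr

theorem push_elt {m n : ℕ} (φ : ℕ → ℕ) (b : Finset ℕ) (hb : ∀ k ∈ b, k ≤ m)
    [Decidable (Set.InjOn φ (b : Set ℕ))] :
    push m n φ (elt m b) = if Set.InjOn φ (b : Set ℕ) then elt n (b.image φ) else 0 := by
  rcases b.eq_empty_or_nonempty with rfl | hne
  · simp [elt]
  · have := elt_of_simplex (n := m) ⟨b, hne, hb⟩
    rw [this, push_single]

theorem boundary_elt {n : ℕ} (b : Finset ℕ) (hb : ∀ k ∈ b, k ≤ n) :
    boundary n (elt n b) =
      ∑ k ∈ b, (-1 : ℤ) ^ (b.filter (· < k)).card • elt n (b.erase k) := by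
  rcases b.eq_empty_or_nonempty with rfl | hne
  · simp [elt]
  · have := elt_of_simplex (n := n) ⟨b, hne, hb⟩
    rw [this]
    unfold boundary
    rw [Finsupp.linearCombination_single, one_smul]

theorem elt_mem_degreePart {n q : ℕ} (b : Finset ℕ) (hb : b.card = q + 1) :
    elt n b ∈ degreePart n q := by
  unfold elt
  split_ifs with h
  · exact Finsupp.single_mem_supported ℤ 1 hb
  · exact zero_mem _

theorem push_boundary {m n : ℕ} {φ : ℕ → ℕ} (hφ : Monotone φ) (hb : ∀ k ≤ m, φ k ≤ n)
    (a : Simplex m) :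
    boundary n (push m n φ (Finsupp.single a 1)) =
      push m n φ (boundary m (Finsupp.single a 1)) := by
  classical
  obtain ⟨a, hne, ham⟩ := a
  rw [← elt_of_simplex, push_elt φ a ham, boundary_elt a ham, map_sum]
  have himg : ∀ k ∈ a.image φ, k ≤ n := by
    intro k hk
    obtain ⟨l, hl, rfl⟩ := Finset.mem_image.1 hk
    exact hb l (ham l hl)
  have hterm : ∀ k ∈ a, push m n φ ((-1 : ℤ) ^ (a.filter (· < k)).card • elt m (a.erase k)) =
      (-1 : ℤ) ^ (a.filter (· < k)).card •
        (if Set.InjOn φ (a.erase k : Finset ℕ) then elt n ((a.erase k).image φ) else 0) := by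
    intro k _
    rw [map_smul, push_elt φ _ (fun l hl => ham l (Finset.mem_of_mem_erase hl))]
  rw [Finset.sum_congr rfl hterm]
  by_cases hinj : Set.InjOn φ (a : Set ℕ)
  · rw [if_pos hinj, boundary_elt _ himg, Finset.sum_image hinj]
    refine Finset.sum_congr rfl fun k hk => ?_
    have h1 : Set.InjOn φ (a.erase k : Finset ℕ) :=
      hinj.mono (by exact_mod_cast Finset.erase_subset k a)
    have hlt : ∀ l ∈ a, (φ l < φ k ↔ l < k) := by
      intro l hl
      constructor
      · intro h
        exact hφ.reflect_lt h
      · intro h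
        exact lt_of_le_of_ne (hφ h.le) fun e => h.ne (hinj hl hk e)
    have h2 : (a.image φ).filter (· < φ k) = (a.filter (· < k)).image φ := by
      ext t
      simp only [Finset.mem_filter, Finset.mem_image]
      constructor
      · rintro ⟨⟨l, hl, rfl⟩, h⟩
        exact ⟨l, ⟨hl, (hlt l hl).1 h⟩, rfl⟩
      · rintro ⟨l, ⟨hl, h⟩, rfl⟩
        exact ⟨⟨l, hl, rfl⟩, (hlt l hl).2 h⟩
    have h3 : ((a.image φ).filter (· < φ k)).card = (a.filter (· < k)).card := by
      rw [h2]
      exact Finset.card_image_of_injOn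
        (hinj.mono (by exact_mod_cast Finset.filter_subset (· < k) a))
    have h4 : (a.image φ).erase (φ k) = (a.erase k).image φ := by
      ext t
      simp only [Finset.mem_erase, Finset.mem_image]
      constructor
      · rintro ⟨h, l, hl, rfl⟩
        exact ⟨l, ⟨fun e => h (by rw [e]), hl⟩, rfl⟩
      · rintro ⟨l, ⟨h, hl⟩, rfl⟩
        exact ⟨fun e => h (hinj hl hk e), l, hl, rfl⟩
    rw [if_pos h1, h3, h4]
  · rw [if_neg hinj, map_zero]
    obtain ⟨i, hi, j, hj, hij, hφij, hgap⟩ : ∃ i ∈ a, ∃ j ∈ a, i < j ∧ φ i = φ j ∧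
        ∀ l ∈ a, i < l → j ≤ l := by
      obtain ⟨i, hi, j, hj, hij, he⟩ : ∃ i ∈ a, ∃ j ∈ a, i < j ∧ φ i = φ j := by
        simp only [Set.InjOn, not_forall] at hinj
        obtain ⟨i, hi, j, hj, he, hne⟩ := hinj
        rcases lt_or_gt_of_ne hne with h | h
        · exact ⟨i, hi, j, hj, h, he⟩
        · exact ⟨j, hj, i, hi, h, he.symm⟩
      have hs : (a.filter (i < ·)).Nonempty := ⟨j, Finset.mem_filter.2 ⟨hj, hij⟩⟩
      have hmin := Finset.mem_filter.1 (Finset.min'_mem _ hs)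
      refine ⟨i, hi, _, hmin.1, hmin.2, ?_, fun l hl h =>
        Finset.min'_le _ _ (Finset.mem_filter.2 ⟨hl, h⟩)⟩
      refine le_antisymm (hφ hmin.2.le) ?_
      rw [he]
      exact hφ (Finset.min'_le _ _ (Finset.mem_filter.2 ⟨hj, hij⟩))
    have hzero : ∀ k ∈ a, k ≠ i ∧ k ≠ j → (-1 : ℤ) ^ (a.filter (· < k)).card •
        (if Set.InjOn φ (a.erase k : Finset ℕ) then elt n ((a.erase k).image φ) else 0) = 0 := by
      intro k _ hk
      rw [if_neg, smul_zero]
      intro h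
      exact hij.ne (h
        (Finset.mem_coe.2 (Finset.mem_erase.2 ⟨hk.1.symm, hi⟩))
        (Finset.mem_coe.2 (Finset.mem_erase.2 ⟨hk.2.symm, hj⟩)) hφij)
    rw [Finset.sum_eq_add_of_mem i j hi hj hij.ne hzero]
    have himage : (a.erase i).image φ = (a.erase j).image φ := by
      ext t
      simp only [Finset.mem_erase, Finset.mem_image]
      constructor
      · rintro ⟨l, ⟨_, hl⟩, rfl⟩
        by_cases e : l = j
        · exact ⟨i, ⟨hij.ne, hi⟩, by rw [e, hφij]⟩
        · exact ⟨l, ⟨e, hl⟩, rfl⟩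
      · rintro ⟨l, ⟨_, hl⟩, rfl⟩
        by_cases e : l = i
        · exact ⟨j, ⟨hij.ne', hj⟩, by rw [e, hφij]⟩
        · exact ⟨l, ⟨e, hl⟩, rfl⟩
    have hiff : Set.InjOn φ (a.erase i : Finset ℕ) ↔ Set.InjOn φ (a.erase j : Finset ℕ) := by
      rw [← Finset.card_image_iff, ← Finset.card_image_iff, himage, Finset.card_erase_of_mem hi,
        Finset.card_erase_of_mem hj]
    have hcard : (a.filter (· < j)).card = (a.filter (· < i)).card + 1 := by
      have : a.filter (· < j) = insert i (a.filter (· < i)) := by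
        ext l
        simp only [Finset.mem_filter, Finset.mem_insert]
        constructor
        · rintro ⟨hl, h⟩
          rcases lt_trichotomy l i with h1 | h1 | h1
          · exact Or.inr ⟨hl, h1⟩
          · exact Or.inl h1
          · exact absurd (hgap l hl h1) (by omega)
        · rintro (rfl | ⟨hl, h⟩)
          · exact ⟨hi, hij⟩
          · exact ⟨hl, h.trans hij⟩
      rw [this, Finset.card_insert_of_notMem (by simp)]
    rw [hcard, himage]
    simp only [hiff, pow_succ, mul_neg, mul_one, neg_smul]
    exact (add_neg_cancel _).symm

theorem push_mem {m n : ℕ} {φ : ℕ → ℕ} (hφ : Monotone φ) (hb : ∀ k ≤ m, φ k ≤ n) :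
    push m n φ ∈ chainMaps m n := by
  classical
  constructor
  · intro q c hc
    rw [degreePart, Finsupp.supported_eq_span_single] at hc
    induction hc using Submodule.span_induction with
    | mem x hx =>
      obtain ⟨a, ha, rfl⟩ := hx
      change push m n φ (Finsupp.single a 1) ∈ _
      rw [push_single]
      split_ifs with h
      · exact elt_mem_degreePart _ (by rw [Finset.card_image_of_injOn h]; exact ha)
      · exact zero_mem _
    | zero => simp
    | add x y _ _ hx hy => rw [map_add]; exact add_mem hx hy
    | smul r x _ hx => rw [map_smul]; exact Submodule.smul_mem _ _ hx
  · intro c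
    have : boundary n ∘ₗ push m n φ = push m n φ ∘ₗ boundary m := by
      apply Finsupp.lhom_ext'
      intro a
      ext1
      exact push_boundary hφ hb a
    exact LinearMap.congr_fun this c

theorem augmentation_push {m n : ℕ} {φ : ℕ → ℕ} (hb : ∀ k ≤ m, φ k ≤ n)
    (c : Chain m) : augmentation n (push m n φ c) = augmentation m c := by
  classical
  have : augmentation n ∘ₗ push m n φ = augmentation m := by
    apply Finsupp.lhom_ext'
    intro a
    ext1
    change augmentation n (push m n φ (Finsupp.single a 1)) =
      augmentation m (Finsupp.single a 1)
    rw [push_single]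
    have himg : (a.1.image φ).Nonempty ∧ ∀ k ∈ a.1.image φ, k ≤ n := by
      refine ⟨a.2.1.image φ, fun k hk => ?_⟩
      obtain ⟨l, hl, rfl⟩ := Finset.mem_image.1 hk
      exact hb l (a.2.2 l hl)
    split_ifs with h
    · have := elt_of_simplex (n := n) ⟨_, himg⟩
      rw [this, augmentation, augmentation, Finsupp.linearCombination_single,
        Finsupp.linearCombination_single, Finset.card_image_of_injOn h]
    · rw [map_zero, augmentation, Finsupp.linearCombination_single, if_neg, smul_zero]
      intro h1
      obtain ⟨t, ht⟩ := Finset.card_eq_one.1 h1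
      apply h
      rw [ht]
      simp
  exact LinearMap.congr_fun this c

theorem comp_push_isOr {m p n : ℕ} {φ : ℕ → ℕ} (hφ : Monotone φ) (hb : ∀ k ≤ m, φ k ≤ p)
    {f : Chain p →ₗ[ℤ] Chain n} (hf : IsOr f) : IsOr (f ∘ₗ push m p φ) := by
  classical
  refine ⟨⟨fun q c hc => ?_, fun c => ?_⟩, fun c => ?_, fun a => ?_⟩
  · exact hf.mem_chainMaps.1 q _ ((push_mem hφ hb).1 q c hc)
  · change boundary n (f (push m p φ c)) = f (push m p φ (boundary m c))
    rw [hf.mem_chainMaps.2, (push_mem hφ hb).2]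
  · change augmentation n (f (push m p φ c)) = augmentation m c
    rw [hf.augmentation_comp, augmentation_push hb]
  · change f (push m p φ (Finsupp.single a 1)) ∈ _
    rw [push_single]
    unfold elt
    split_ifs
    · exact hf.map_basis _
    · rw [map_zero]; exact zero_mem _
    · rw [map_zero]; exact zero_mem _

theorem skip_monotone (i : ℕ) : Monotone (skip i) := by
  intro a b h
  unfold skip
  split_ifs <;> omega

theorem dup_monotone (i : ℕ) : Monotone (dup i) := by
  intro a b h
  unfold dup
  split_ifs <;> omega

theorem face_isOr {m n : ℕ} (i : ℕ) {x : Chain (m + 1) →ₗ[ℤ] Chain n} (hx : IsOr x) :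
    IsOr (face i x) :=
  comp_push_isOr (skip_monotone i) (fun k hk => by unfold skip; split_ifs <;> omega) hx

theorem dup_le {m i : ℕ} (hi : i ≤ m) : ∀ k ≤ m + 1, dup i k ≤ m := by
  intro k hk
  unfold dup
  split_ifs <;> omega

theorem degen_isOr {m n : ℕ} (i : ℕ) (hi : i ≤ m) {x : Chain m →ₗ[ℤ] Chain n} (hx : IsOr x) :
    IsOr (degen i x) :=
  comp_push_isOr (dup_monotone i) (dup_le hi) hx

theorem push_push {m p n : ℕ} {φ ψ : ℕ → ℕ} (hb : ∀ k ≤ m, φ k ≤ p) (c : Chain m) :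
    push p n ψ (push m p φ c) = push m n (ψ ∘ φ) c := by
  classical
  have : push p n ψ ∘ₗ push m p φ = push m n (ψ ∘ φ) := by
    apply Finsupp.lhom_ext'
    intro a
    ext1
    change push p n ψ (push m p φ (Finsupp.single a 1)) = push m n (ψ ∘ φ) (Finsupp.single a 1)
    have himg : ∀ k ∈ a.1.image φ, k ≤ p := by
      intro k hk
      obtain ⟨l, hl, rfl⟩ := Finset.mem_image.1 hk
      exact hb l (a.2.2 l hl)
    rw [push_single, push_single]
    by_cases h : Set.InjOn φ (a.1 : Set ℕ)
    · rw [if_pos h, push_elt ψ _ himg, Finset.image_image]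
      have hiff : Set.InjOn ψ ((a.1.image φ : Finset ℕ) : Set ℕ) ↔
          Set.InjOn (ψ ∘ φ) (a.1 : Set ℕ) := by
        rw [← Finset.card_image_iff, ← Finset.card_image_iff, Finset.image_image,
          Finset.card_image_of_injOn h]
      simp only [hiff]
    · rw [if_neg h, map_zero, if_neg fun h' => h fun x hx y hy e => h' hx hy (by simp [e])]
  exact LinearMap.congr_fun this c

theorem push_congr {m n : ℕ} {φ ψ : ℕ → ℕ} (a : Simplex m) (h : ∀ k ∈ a.1, φ k = ψ k) :
    push m n φ (Finsupp.single a 1) = push m n ψ (Finsupp.single a 1) := by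
  classical
  rw [push_single, push_single, Finset.image_congr h]
  have : Set.InjOn φ (a.1 : Set ℕ) ↔ Set.InjOn ψ (a.1 : Set ℕ) := Set.EqOn.injOn_iff h
  simp only [this]

theorem wedge_isOr {m n : ℕ} (i : ℕ) (hi : i ≤ m) {x y : Chain (m + 1) →ₗ[ℤ] Chain n}
    (hx : IsOr x) (hy : IsOr y) (h : face i x = face (i + 1) y) : IsOr (wedge i x y) := by
  classical
  have h1 : IsOr (degen (i + 1) x) := degen_isOr (i + 1) (by omega) hx
  have h2 : IsOr (degen i (degen i (face (i + 1) y))) :=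
    degen_isOr i (by omega) (degen_isOr i hi (face_isOr _ hy))
  have h3 : IsOr (degen i y) := degen_isOr i (by omega) hy
  refine ⟨add_mem (sub_mem h1.mem_chainMaps h2.mem_chainMaps) h3.mem_chainMaps, fun c => ?_,
    fun a => ?_⟩
  · simp only [wedge, LinearMap.add_apply, LinearMap.sub_apply, map_add, map_sub,
      h1.augmentation_comp, h2.augmentation_comp, h3.augmentation_comp]
    ring
  · have hd1 : ∀ k ≤ m + 2, dup i k ≤ m + 1 := dup_le (by omega)
    have hd2 : ∀ k ≤ m + 1, dup i k ≤ m := dup_le hi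
    have hdd : ∀ k ≤ m + 2, (dup i ∘ dup i) k ≤ m := fun k hk => hd2 _ (hd1 k hk)
    have hmid : ∀ (j : ℕ) (z : Chain (m + 1) →ₗ[ℤ] Chain n) (c : Chain (m + 2)),
        degen i (degen i (face j z)) c = z (push (m + 2) (m + 1) (skip j ∘ dup i ∘ dup i) c) := by
      intro j z c
      change z (push m (m + 1) (skip j) (push (m + 1) m (dup i) (push (m + 2) (m + 1) (dup i) c)))
        = _
      rw [push_push hd1, push_push hdd]
    have e : wedge i x y (Finsupp.single a 1) = degen (i + 1) x (Finsupp.single a 1) -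
        degen i (degen i (face (i + 1) y)) (Finsupp.single a 1) +
        degen i y (Finsupp.single a 1) := rfl
    rw [e]
    by_cases ha : i ∈ a.1
    · by_cases hb : i + 2 ∈ a.1
      · have : degen i (degen i (face (i + 1) y)) (Finsupp.single a 1) = 0 := by
          rw [hmid, push_single, if_neg, map_zero]
          intro hinj
          have := hinj (Finset.mem_coe.2 ha) (Finset.mem_coe.2 hb) (by simp [dup])
          omega
        rw [this, sub_zero]
        exact add_mem (h1.map_basis a) (h3.map_basis a)
      · have : degen i (degen i (face (i + 1) y)) (Finsupp.single a 1) =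
            degen i y (Finsupp.single a 1) := by
          rw [hmid]
          change _ = y (push _ _ _ _)
          congr 1
          apply push_congr
          intro k hk
          have : k ≠ i + 2 := fun e => hb (e ▸ hk)
          simp only [skip, dup, Function.comp]
          split_ifs <;> omega
        rw [this, sub_add_cancel]
        exact h1.map_basis a
    · have : degen i (degen i (face (i + 1) y)) (Finsupp.single a 1) =
          degen (i + 1) x (Finsupp.single a 1) := by
        rw [← h, hmid]
        change _ = x (push _ _ _ _)
        congr 1
        apply push_congr
        intro k hk
        have : k ≠ i := fun e => ha (e ▸ hk)
        simp only [skip, dup, Function.comp]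
        split_ifs <;> omega
      rw [this, sub_self, zero_add]
      exact h3.map_basis a

/-- The graded set `Or(-, n)` with its faces, degeneracies and wedges. -/
def nerve (n : ℕ) : WedgeData.{0} where
  X m := Or m n
  d i x _ := ⟨face i x.1, face_isOr i x.2⟩
  s i x hi := ⟨degen i x.1, degen_isOr i hi x.2⟩
  wedge i hi x y h :=
    ⟨wedge i x.1 y.1, wedge_isOr i hi x.2 y.2 (congrArg Subtype.val h)⟩

/-- The identity `ι_n` in `Or(n, n)`. -/
def iota (n : ℕ) : (nerve n).X n :=
  ⟨LinearMap.id, ⟨fun _ _ h => h, fun _ => rfl⟩, fun _ => rfl,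
    fun a => AddSubmonoid.subset_closure ⟨a, rfl⟩⟩

end Oriental

end

/-! An element of `Or(m, n)` is recorded by its matrix of nonnegative coefficients. The empty
simplex is included, so that preservation of the augmentation becomes part of the chain condition.
In these terms the wedges at place `i` are exactly the elements that vanish on every simplex
containing `i`, `i + 1` and `i + 2` (`isWedge_iff`): on a simplex with `i` and `i + 2` but without
`i + 1`, the chain condition recovers the value from the faces opposite `i` and `i + 2`. Each wedge
axiom then says that vanishing on some simplexes forces vanishing on others, and this follows by
inserting a missing vertex and applying the chain condition (`IsO.eq_zero_of_insert`).

For freeness, the wedges of the target are treated as thin elements, which exist and are unique for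
given compatible faces opposite `i` and `i + 2`. In positive degrees degeneracies are wedges, so a
morphism amounts to a function on matrices that respects faces, thinness and the degeneracies of
vertices (`exists_hom`). Such a function is built along a filtration. A matrix sends exactly a final
segment `p, …, m` of its vertices to `n` (`exists_cls`); call `m + 1 - p` its rank. Within one rank
the condition `Dep n p f` becomes stronger as `f` decreases; it is empty for `f ≥ p`.

The engine is the filler. If `x` satisfies `Dep n p (f + 1)` with `f < p ≤ m`, then `fill n m f p
x`, of dimension `m + 1`, has `x` as its face opposite `f + 1` and is a `(p - f)`-fold iterated
wedge formed from two simpler elements: its face opposite `f`, which satisfies `Dep n p f`, and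
`coface n m f p x`, whose rank is smaller. So the value at `x` is forced, which gives uniqueness
(`FaceThin.eq_of_eq`). Taking the forced value as a definition works because faces and thinness pass
through iterated wedges by the wedge axioms (`step_face`, `step_thin`). At the bottom of a rank,
where `Dep n p 0` holds, a matrix of rank at least two is degenerate at the last place, and one of
rank one is a join with `n`.

There remain the matrices of rank zero, which form `Or(-, n - 1)`, the vertex `n`, and the joins of
elements of `Or(-, n - 1)` with `n`. By induction on `n` the first get their values from a morphism
to `U` that sends the identity to the last face of `u`, and the joins from a morphism to the
décalage of `U` that sends the identity to `u`. The two fit together by uniqueness for `n - 1`. -/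

noncomputable section

/-! ### Matrices of chain maps -/

namespace Oriental

/-- Matrices indexed by finite sets of vertices: `x a b` is the coefficient of `b` in the image
of `a`. The empty simplex is included, so that the complexes are augmented. -/
abbrev Mat : Type := Finset ℕ → Finset ℕ → ℤ

/-- The sign with which the vertex `v` is removed from the simplex `a`. -/
def sgn (a : Finset ℕ) (v : ℕ) : ℤ := (-1) ^ (a.filter (· < v)).card

/-- The augmented boundary of a chain with coefficients `c` on the vertices less than `N`. -/
def bd (N : ℕ) (c : Finset ℕ → ℤ) (b : Finset ℕ) : ℤ :=
  ∑ v ∈ Finset.range N \ b, sgn b v * c (insert v b)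

/-- The composite of a matrix with the augmented boundary of its source. -/
def alt (x : Mat) (a b : Finset ℕ) : ℤ := ∑ v ∈ a, sgn a v * x (a.erase v) b

/-- The matrices of the elements of `Or(m, n)`. -/
structure IsO (n m : ℕ) (x : Mat) : Prop where
  empty : ∀ b, x ∅ b = if b = ∅ then 1 else 0
  nonneg : ∀ a b, 0 ≤ x a b
  supp_left : ∀ a b, x a b ≠ 0 → a ⊆ Finset.range (m + 1)
  supp_right : ∀ a b, x a b ≠ 0 → b ⊆ Finset.range (n + 1)
  card_eq : ∀ a b, x a b ≠ 0 → b.card = a.card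
  chain : ∀ a, a ⊆ Finset.range (m + 1) → ∀ b, bd (n + 1) (x a) b = alt x a b

/-- Precomposition of a matrix with a function on vertices. -/
def pull (φ : ℕ → ℕ) (x : Mat) : Mat := fun a b =>
  if (a.image φ).card = a.card then x (a.image φ) b else 0

open Classical in
/-- The coefficient of `b` in a chain, and `0` if `b` is not a simplex. -/
def coef (n : ℕ) (b : Finset ℕ) : Chain n →ₗ[ℤ] ℤ :=
  if h : b.Nonempty ∧ ∀ k ∈ b, k ≤ n then Finsupp.lapply (⟨b, h⟩ : Simplex n) else 0

/-- The matrix of a homomorphism. -/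
def val {m n : ℕ} (f : Chain m →ₗ[ℤ] Chain n) : Mat := fun a b =>
  -- The empty simplex goes to itself. This convention makes the chain condition at `b = ∅` express
  -- preservation of the augmentation.
  if a = ∅ then (if b = ∅ then 1 else 0) else coef n b (f (elt m a))

theorem sgn_insert_self {b : Finset ℕ} {v : ℕ} : sgn (insert v b) v = sgn b v := by
  unfold sgn
  rw [Finset.filter_insert, if_neg (lt_irrefl v)]

theorem sgn_erase_self {b : Finset ℕ} {v : ℕ} : sgn (b.erase v) v = sgn b v := by
  unfold sgn
  congr 2
  ext w
  simp only [Finset.mem_filter, Finset.mem_erase]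
  constructor
  · rintro ⟨⟨_, h⟩, h'⟩
    exact ⟨h, h'⟩
  · rintro ⟨h, h'⟩
    exact ⟨⟨by omega, h⟩, h'⟩

theorem sgn_insert_lt {b : Finset ℕ} {u v : ℕ} (h : u < v) (hu : u ∉ b) :
    sgn (insert u b) v = - sgn b v := by
  unfold sgn
  rw [Finset.filter_insert, if_pos h, Finset.card_insert_of_notMem (by simp [hu]), pow_succ]
  ring

theorem sgn_insert_gt {b : Finset ℕ} {u v : ℕ} (h : v ≤ u) :
    sgn (insert u b) v = sgn b v := by
  unfold sgn
  rw [Finset.filter_insert, if_neg (by omega)]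

theorem sgn_mul_self (b : Finset ℕ) (v : ℕ) : sgn b v * sgn b v = 1 := by
  unfold sgn
  rw [← mul_pow]
  simp

theorem sgn_ne_zero (b : Finset ℕ) (v : ℕ) : sgn b v ≠ 0 := by
  unfold sgn
  exact pow_ne_zero _ (by norm_num)

theorem subset_range_iff {b : Finset ℕ} {n : ℕ} :
    b ⊆ Finset.range (n + 1) ↔ ∀ k ∈ b, k ≤ n := by
  constructor
  · intro h k hk
    have := Finset.mem_range.1 (h hk)
    omega
  · intro h k hk
    have := h k hk
    exact Finset.mem_range.2 (by omega)

theorem coef_single {n : ℕ} (b : Finset ℕ) (a : Simplex n) (r : ℤ) :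
    coef n b (Finsupp.single a r) = if a.1 = b then r else 0 := by
  classical
  unfold coef
  split_ifs with h h' h'
  · subst h'
    simp
  · rw [Finsupp.lapply_apply, Finsupp.single_apply, if_neg]
    intro e
    exact h' (congrArg Subtype.val e)
  · subst h'
    exact absurd a.2 h
  · rfl

theorem coef_elt {n : ℕ} (a b : Finset ℕ) :
    coef n b (elt n a) = if a = b ∧ a.Nonempty ∧ ∀ k ∈ a, k ≤ n then 1 else 0 := by
  classical
  unfold elt
  split_ifs with h h' h'
  · rw [coef_single, if_pos h'.1]
  · rw [coef_single, if_neg (fun e => h' ⟨e, h⟩)]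
  · exact absurd h'.2 h
  · simp

theorem coef_apply {n : ℕ} (b : Simplex n) (c : Chain n) : coef n b.1 c = c b := by
  unfold coef
  rw [dif_pos b.2]
  rfl

theorem coef_ne_zero {n : ℕ} {b : Finset ℕ} {c : Chain n} (h : coef n b c ≠ 0) :
    b.Nonempty ∧ ∀ k ∈ b, k ≤ n := by
  by_contra h'
  apply h
  unfold coef
  rw [dif_neg h']
  rfl

/-- A simplex `b` occurs in the boundary of `a` exactly when `a = insert v b` with `v ∉ b`, and the
sign of `v` is the same in both. Nonemptiness matters because `coef n ∅` is zero. -/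
theorem coef_boundary {n : ℕ} (b : Finset ℕ) (hb : b.Nonempty) (c : Chain n) :
    coef n b (boundary n c) = bd (n + 1) (fun b => coef n b c) b := by
  classical
  have key : ∀ a : Simplex n, coef n b (boundary n (Finsupp.single a 1)) =
      bd (n + 1) (fun b => coef n b (Finsupp.single a 1)) b := by
    intro a
    rw [← elt_of_simplex, boundary_elt a.1 a.2.2, map_sum]
    simp only [map_smul, coef_elt, smul_eq_mul, bd]
    by_cases hex : ∃ v, v ∉ b ∧ a.1 = insert v b
    · obtain ⟨v, hv, hav⟩ := hex
      have hvn : v ≤ n := a.2.2 v (by rw [hav]; simp)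
      rw [Finset.sum_eq_single v, Finset.sum_eq_single v]
      · rw [hav, Finset.erase_insert hv, if_pos, if_pos]
        · congr 1
          exact sgn_insert_self
        · exact ⟨rfl, by simp, fun k hk => a.2.2 k (by rw [hav]; exact hk)⟩
        · exact ⟨rfl, hb, fun k hk => a.2.2 k (by rw [hav]; exact Finset.mem_insert_of_mem hk)⟩
      · intro u hu huv
        rw [if_neg, mul_zero]
        rintro ⟨e, -⟩
        rw [hav] at e
        have : u ∈ insert v b := by rw [e]; simp
        rcases Finset.mem_insert.1 this with h | h
        · exact huv h
        · exact (Finset.mem_sdiff.1 hu).2 h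
      · intro h
        exact absurd (Finset.mem_sdiff.2 ⟨Finset.mem_range.2 (by omega), hv⟩) h
      · intro u hu huv
        rw [if_neg, mul_zero]
        rintro ⟨e, -⟩
        have : v ∈ a.1.erase u := by
          rw [Finset.mem_erase]
          exact ⟨huv.symm, by rw [hav]; simp⟩
        rw [e] at this
        exact hv this
      · intro h
        exact absurd (by rw [hav]; simp) h
    · push Not at hex
      rw [Finset.sum_eq_zero, Finset.sum_eq_zero]
      · intro v hv
        rw [if_neg, mul_zero]
        rintro ⟨e, -⟩
        exact hex v (Finset.mem_sdiff.1 hv).2 e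
      · intro v hv
        rw [if_neg, mul_zero]
        rintro ⟨e, -⟩
        exact hex v (by rw [← e]; simp) (by rw [← e, Finset.insert_erase hv])
  induction c using Finsupp.induction_linear with
  | zero => simp [bd]
  | add f g hf hg =>
    rw [map_add, map_add, hf, hg]
    simp only [bd, map_add, mul_add, Finset.sum_add_distrib]
  | single a r =>
    have e : (Finsupp.single a r : Chain n) = r • Finsupp.single a 1 := by simp
    rw [e, map_smul, map_smul, key]
    simp only [bd, map_smul, smul_eq_mul, Finset.mul_sum]
    exact Finset.sum_congr rfl fun _ _ => by ring

/-- This is the case of `coef_boundary` missing at `b = ∅`: there `bd` sums the coefficients of the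
vertices. -/
theorem augmentation_eq {n : ℕ} (c : Chain n) :
    augmentation n c = bd (n + 1) (fun b => coef n b c) ∅ := by
  classical
  induction c using Finsupp.induction_linear with
  | zero => simp [bd]
  | add f g hf hg =>
    rw [map_add, hf, hg]
    simp only [bd, map_add, mul_add, Finset.sum_add_distrib]
  | single a r =>
    unfold augmentation
    rw [Finsupp.linearCombination_single]
    simp only [bd, coef_single, sgn, Finset.filter_empty, Finset.card_empty, pow_zero, one_mul,
      Finset.sdiff_empty, smul_eq_mul, insert_empty_eq]
    split_ifs with h
    · obtain ⟨v, hv⟩ := Finset.card_eq_one.1 h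
      rw [Finset.sum_eq_single v]
      · rw [if_pos hv, mul_one]
      · intro u _ huv
        rw [if_neg]
        rw [hv]
        intro e
        exact huv (Finset.singleton_injective e).symm
      · intro h'
        exact absurd (Finset.mem_range.2 (Nat.lt_succ_of_le (a.2.2 v (by rw [hv]; simp)))) h'
    · rw [mul_zero, Finset.sum_eq_zero]
      intro v _
      rw [if_neg]
      intro e
      exact h (by rw [e]; simp)

theorem coef_closure_nonneg {n : ℕ} {c : Chain n}
    (hc : c ∈ AddSubmonoid.closure
      (Set.range fun b : Simplex n => (Finsupp.single b 1 : Chain n))) (b : Finset ℕ) :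
    0 ≤ coef n b c := by
  induction hc using AddSubmonoid.closure_induction with
  | mem x hx =>
    obtain ⟨a, rfl⟩ := hx
    simp only [coef_single]
    split_ifs <;> norm_num
  | zero => simp
  | add x y _ _ hx hy => rw [map_add]; exact add_nonneg hx hy

theorem val_of_ne {m n : ℕ} {f : Chain m →ₗ[ℤ] Chain n} {a : Finset ℕ} (ha : a ≠ ∅)
    (b : Finset ℕ) : val f a b = coef n b (f (elt m a)) := if_neg ha

theorem elt_ne_zero {n : ℕ} {a : Finset ℕ} (h : elt n a ≠ 0) : a.Nonempty ∧ ∀ k ∈ a, k ≤ n := by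
  by_contra h'
  apply h
  unfold elt
  rw [dif_neg h']

theorem val_isO {m n : ℕ} {f : Chain m →ₗ[ℤ] Chain n} (hf : IsOr f) : IsO n m (val f) where
  empty b := by simp [val]
  nonneg a b := by
    by_cases ha : a = ∅
    · unfold val
      rw [if_pos ha]
      split_ifs <;> norm_num
    · rw [val_of_ne ha]
      apply coef_closure_nonneg
      unfold elt
      split_ifs
      · exact hf.map_basis _
      · rw [map_zero]; exact zero_mem _
  supp_left a b h := by
    by_cases ha : a = ∅
    · simp [ha]
    · rw [val_of_ne ha] at h
      rw [subset_range_iff]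
      refine (elt_ne_zero (n := m) ?_).2
      intro e
      rw [e] at h
      simp at h
  supp_right a b h := by
    by_cases ha : a = ∅
    · unfold val at h
      rw [if_pos ha] at h
      have : b = ∅ := by
        by_contra hb
        simp [hb] at h
      simp [this]
    · rw [val_of_ne ha] at h
      exact subset_range_iff.2 (coef_ne_zero h).2
  card_eq a b h := by
    by_cases ha : a = ∅
    · unfold val at h
      rw [if_pos ha] at h
      have : b = ∅ := by
        by_contra hb
        simp [hb] at h
      rw [this, ha]
    · rw [val_of_ne ha] at h
      have hpos := Finset.card_pos.2 (Finset.nonempty_iff_ne_empty.2 ha)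
      have hmem : elt m a ∈ degreePart m (a.card - 1) := elt_mem_degreePart a (by omega)
      have := hf.mem_chainMaps.1 _ _ hmem
      obtain ⟨hb, hb'⟩ := coef_ne_zero h
      have e := coef_apply (n := n) ⟨b, hb, hb'⟩ (f (elt m a))
      rw [e] at h
      have h2 := (Finsupp.mem_supported ℤ _).1 this (Finsupp.mem_support_iff.2 h)
      simp only [Set.mem_ofPred_eq] at h2
      omega
  chain a ha b := by
    have ha' := subset_range_iff.1 ha
    by_cases hae : a = ∅
    · subst hae
      simp [bd, alt, val]
    have hbd : bd (n + 1) (val f a) b = bd (n + 1) (fun b => coef n b (f (elt m a))) b := by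
      unfold bd
      exact Finset.sum_congr rfl fun v _ => by rw [val_of_ne hae]
    rw [hbd]
    by_cases hb : b = ∅
    · subst hb
      rw [← augmentation_eq, hf.augmentation_comp]
      have hne := Finset.nonempty_iff_ne_empty.2 hae
      have e := elt_of_simplex (n := m) ⟨a, hne, ha'⟩
      rw [e, augmentation, Finsupp.linearCombination_single]
      simp only [smul_eq_mul, one_mul]
      split_ifs with h1
      · obtain ⟨v, rfl⟩ := Finset.card_eq_one.1 h1
        simp [alt, sgn, val, Finset.filter_singleton]
      · unfold alt
        rw [Finset.sum_eq_zero]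
        intro v hv
        have : a.erase v ≠ ∅ := by
          intro e
          apply h1
          have := Finset.card_erase_of_mem hv
          rw [e, Finset.card_empty] at this
          have := Finset.card_pos.2 hne
          omega
        rw [val_of_ne this]
        unfold coef
        rw [dif_neg (by simp)]
        simp
    · rw [← coef_boundary b (Finset.nonempty_iff_ne_empty.2 hb), hf.mem_chainMaps.2,
        boundary_elt a ha', map_sum, map_sum]
      unfold alt
      refine Finset.sum_congr rfl fun v _ => ?_
      rw [map_smul, map_smul, smul_eq_mul]
      change sgn a v * _ = _
      congr 1
      by_cases h : a.erase v = ∅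
      · rw [h]
        simp [elt, val, hb]
      · rw [val_of_ne h]

theorem val_injective {m n : ℕ} {f g : Chain m →ₗ[ℤ] Chain n} (h : val f = val g) : f = g := by
  apply Finsupp.lhom_ext'
  intro a
  ext1
  change f (Finsupp.single a 1) = g (Finsupp.single a 1)
  ext b
  have := congrFun (congrFun h a.1) b.1
  rw [val_of_ne a.2.1.ne_empty, val_of_ne a.2.1.ne_empty, coef_apply, coef_apply,
    elt_of_simplex] at this
  exact this

/-- Matrices are defined on all finite sets of natural numbers, and vanish on those out of range.
Hence `φ` must also keep vertices out of range, and `hφ` is an equivalence. -/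
theorem val_comp_push {m p n : ℕ} {φ : ℕ → ℕ} (hφ : ∀ k, k ≤ m ↔ φ k ≤ p)
    (f : Chain p →ₗ[ℤ] Chain n) : val (f ∘ₗ push m p φ) = pull φ (val f) := by
  classical
  funext a b
  unfold pull
  by_cases ha : a = ∅
  · subst ha
    simp [val]
  have hne := Finset.nonempty_iff_ne_empty.2 ha
  have hne' : a.image φ ≠ ∅ := by simpa using ha
  rw [val_of_ne ha, val_of_ne hne', LinearMap.comp_apply]
  by_cases hm : ∀ k ∈ a, k ≤ m
  · rw [push_elt φ a hm]
    simp only [← Finset.card_image_iff]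
    split_ifs <;> simp
  · have e1 : elt m a = 0 := by unfold elt; rw [dif_neg fun h => hm h.2]
    have e2 : elt p (a.image φ) = 0 := by
      unfold elt
      rw [dif_neg]
      intro h
      apply hm
      intro k hk
      exact (hφ k).2 (h.2 _ (Finset.mem_image_of_mem φ hk))
    rw [e1, e2]
    simp

instance finite_simplex (n : ℕ) : Finite (Simplex n) := by
  have : Set.Finite {a : Finset ℕ | a.Nonempty ∧ ∀ k ∈ a, k ≤ n} := by
    refine (Finset.finite_toSet (Finset.range (n + 1)).powerset).subset ?_
    rintro a ⟨_, h⟩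
    exact Finset.mem_coe.2 (Finset.mem_powerset.2 (subset_range_iff.2 h))
  exact this.to_subtype

/-- The homomorphism with a given matrix. -/
def ofMat (m n : ℕ) (x : Mat) : Chain m →ₗ[ℤ] Chain n :=
  Finsupp.linearCombination ℤ fun a : Simplex m =>
    Finsupp.equivFunOnFinite.symm fun b : Simplex n => x a.1 b.1

theorem ofMat_single {m n : ℕ} (x : Mat) (a : Simplex m) (b : Simplex n) :
    ofMat m n x (Finsupp.single a 1) b = x a.1 b.1 := by
  unfold ofMat
  rw [Finsupp.linearCombination_single, one_smul]
  rfl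

theorem coef_ofMat {m n : ℕ} {x : Mat} (hx : IsO n m x) (a : Simplex m) (b : Finset ℕ) :
    coef n b (ofMat m n x (Finsupp.single a 1)) = x a.1 b := by
  by_cases hb : b.Nonempty ∧ ∀ k ∈ b, k ≤ n
  · have := coef_apply (n := n) ⟨b, hb⟩ (ofMat m n x (Finsupp.single a 1))
    rw [this, ofMat_single]
  · have h1 : coef n b (ofMat m n x (Finsupp.single a 1)) = 0 := by
      by_contra h
      exact hb (coef_ne_zero h)
    rw [h1]
    by_contra h
    apply hb
    have h := Ne.symm h
    refine ⟨?_, subset_range_iff.1 (hx.supp_right _ _ h)⟩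
    rw [← Finset.card_pos, hx.card_eq _ _ h]
    exact Finset.card_pos.2 a.2.1

theorem val_ofMat {m n : ℕ} {x : Mat} (hx : IsO n m x) : val (ofMat m n x) = x := by
  funext a b
  by_cases ha : a = ∅
  · subst ha
    rw [hx.empty]
    simp [val]
  rw [val_of_ne ha]
  by_cases ha' : ∀ k ∈ a, k ≤ m
  · have := elt_of_simplex (n := m) ⟨a, Finset.nonempty_iff_ne_empty.2 ha, ha'⟩
    rw [this, coef_ofMat hx]
  · have : elt m a = 0 := by unfold elt; rw [dif_neg fun h => ha' h.2]
    rw [this]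
    simp only [map_zero]
    by_contra h
    exact ha' (subset_range_iff.1 (hx.supp_left _ _ (Ne.symm h)))

theorem chain_ext {n : ℕ} {c d : Chain n} (h : ∀ b, b.Nonempty → coef n b c = coef n b d) :
    c = d := by
  ext b
  rw [← coef_apply, ← coef_apply, h b.1 b.2.1]

theorem ofMat_isOr {m n : ℕ} {x : Mat} (hx : IsO n m x) : IsOr (ofMat m n x) := by
  classical
  have hbd : ∀ (a : Simplex m) (b : Finset ℕ),
      bd (n + 1) (fun b => coef n b (ofMat m n x (Finsupp.single a 1))) b = alt x a.1 b := by
    intro a b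
    rw [← hx.chain a.1 (subset_range_iff.2 a.2.2) b]
    simp only [coef_ofMat hx, bd]
  refine ⟨⟨fun q c hc => ?_, fun c => ?_⟩, fun c => ?_, fun a => ?_⟩
  · rw [degreePart, Finsupp.supported_eq_span_single] at hc
    induction hc using Submodule.span_induction with
    | mem y hy =>
      obtain ⟨a, ha, rfl⟩ := hy
      simp only [Set.mem_ofPred_eq] at ha
      refine (Finsupp.mem_supported ℤ _).2 fun b hb => ?_
      rw [Finset.mem_coe, Finsupp.mem_support_iff, ofMat_single] at hb
      simp only [Set.mem_ofPred_eq]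
      rw [hx.card_eq _ _ hb, ha]
    | zero => simp
    | add y z _ _ hy hz => rw [map_add]; exact add_mem hy hz
    | smul r y _ hy => rw [map_smul]; exact Submodule.smul_mem _ _ hy
  · have : boundary n ∘ₗ ofMat m n x = ofMat m n x ∘ₗ boundary m := by
      apply Finsupp.lhom_ext'
      intro a
      ext1
      change boundary n (ofMat m n x (Finsupp.single a 1)) =
        ofMat m n x (boundary m (Finsupp.single a 1))
      apply chain_ext
      intro b hb
      rw [coef_boundary b hb, hbd, ← elt_of_simplex, boundary_elt a.1 a.2.2, map_sum, map_sum]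
      unfold alt
      refine Finset.sum_congr rfl fun v _ => ?_
      rw [map_smul, map_smul, smul_eq_mul]
      change sgn a.1 v * _ = sgn a.1 v * _
      congr 1
      by_cases h : a.1.erase v = ∅
      · rw [h, hx.empty, if_neg hb.ne_empty]
        simp [elt]
      · have e := elt_of_simplex (n := m) ⟨a.1.erase v, Finset.nonempty_iff_ne_empty.2 h,
          fun k hk => a.2.2 k (Finset.mem_of_mem_erase hk)⟩
        rw [e, coef_ofMat hx]
    exact LinearMap.congr_fun this c
  · have : augmentation n ∘ₗ ofMat m n x = augmentation m := by
      apply Finsupp.lhom_ext'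
      intro a
      ext1
      change augmentation n (ofMat m n x (Finsupp.single a 1)) =
        augmentation m (Finsupp.single a 1)
      rw [augmentation_eq, hbd, augmentation, Finsupp.linearCombination_single, one_smul]
      unfold alt
      split_ifs with h1
      · obtain ⟨v, hv⟩ := Finset.card_eq_one.1 h1
        rw [hv]
        simp [sgn, hx.empty, Finset.filter_singleton]
      · refine Finset.sum_eq_zero fun v hv => ?_
        by_contra h
        have h := right_ne_zero_of_mul h
        have := hx.card_eq _ _ h
        rw [Finset.card_empty, Finset.card_erase_of_mem hv] at this
        have := Finset.card_pos.2 a.2.1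
        omega
    exact LinearMap.congr_fun this c
  · have e : ofMat m n x (Finsupp.single a 1) =
        (ofMat m n x (Finsupp.single a 1)).sum fun b r => r.toNat • Finsupp.single b 1 := by
      conv_lhs => rw [← Finsupp.sum_single (ofMat m n x (Finsupp.single a 1))]
      refine Finsupp.sum_congr fun b _ => ?_
      have : 0 ≤ ofMat m n x (Finsupp.single a 1) b := by
        rw [ofMat_single]
        exact hx.nonneg _ _
      rw [← Nat.cast_smul_eq_nsmul ℤ, Int.toNat_of_nonneg this]
      simp
    rw [e]
    exact sum_mem fun b _ => nsmul_mem (AddSubmonoid.subset_closure (Set.mem_range_self b)) _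

/-- The element of `Or(m, n)` with a given matrix. -/
def ofIsO {m n : ℕ} {x : Mat} (hx : IsO n m x) : Or m n := ⟨ofMat m n x, ofMat_isOr hx⟩

theorem val_ofIsO {m n : ℕ} {x : Mat} (hx : IsO n m x) : val (ofIsO hx).1 = x := val_ofMat hx

theorem or_ext {m n : ℕ} {f g : Or m n} (h : val f.1 = val g.1) : f = g :=
  Subtype.ext (val_injective h)

end Oriental

end

/-! ### Faces, degeneracies and wedges of matrices -/

noncomputable section

namespace Oriental

/-- The face operation on matrices. -/
def mface (i : ℕ) (x : Mat) : Mat := fun a b => x (a.image (skip i)) b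

/-- The degeneracy operation on matrices. -/
def mdeg (i : ℕ) (x : Mat) : Mat := pull (dup i) x

/-- A matrix vanishes on the simplexes that contain `i`, `i + 1` and `i + 2`. -/
def Van (i : ℕ) (x : Mat) : Prop :=
  ∀ a, i ∈ a → i + 1 ∈ a → i + 2 ∈ a → ∀ b, x a b = 0

theorem skip_injective (i : ℕ) : Function.Injective (skip i) := by
  intro a b h
  unfold skip at h
  split_ifs at h <;> omega

theorem mface_eq_pull (i : ℕ) (x : Mat) : mface i x = pull (skip i) x := by
  funext a b
  unfold mface pull
  rw [if_pos (Finset.card_image_of_injective a (skip_injective i))]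

/-- Images can only lose elements, so the composite is injective on `a` exactly when both factors
are injective on the relevant sets. All simplicial identities thereby reduce to identities between
functions on vertices. -/
theorem pull_pull (φ ψ : ℕ → ℕ) (x : Mat) : pull ψ (pull φ x) = pull (φ ∘ ψ) x := by
  funext a b
  unfold pull
  rw [← Finset.image_image]
  have h1 : (a.image ψ).card ≤ a.card := Finset.card_image_le
  have h2 : ((a.image ψ).image φ).card ≤ (a.image ψ).card := Finset.card_image_le
  split_ifs <;> first | rfl | omega

theorem mface_mface {i j : ℕ} (h : i ≤ j) (x : Mat) :
    mface i (mface (j + 1) x) = mface j (mface i x) := by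
  simp only [mface_eq_pull, pull_pull]
  congr 1
  funext k
  simp only [Function.comp, skip]
  split_ifs <;> omega

theorem mface_mdeg_lt {i j : ℕ} (h : i ≤ j) (x : Mat) :
    mface i (mdeg (j + 1) x) = mdeg j (mface i x) := by
  simp only [mface_eq_pull, mdeg, pull_pull]
  congr 1
  funext k
  simp only [Function.comp, skip, dup]
  split_ifs <;> omega

theorem pull_id (x : Mat) : pull id x = x := by
  funext a b
  simp [pull]

theorem mface_mdeg_self (i : ℕ) (x : Mat) : mface i (mdeg i x) = x := by
  simp only [mface_eq_pull, mdeg, pull_pull]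
  have : dup i ∘ skip i = id := by
    funext k
    simp only [Function.comp, skip, dup, id]
    split_ifs <;> omega
  rw [this, pull_id]

theorem mface_mdeg_succ (i : ℕ) (x : Mat) : mface (i + 1) (mdeg i x) = x := by
  simp only [mface_eq_pull, mdeg, pull_pull]
  have : dup i ∘ skip (i + 1) = id := by
    funext k
    simp only [Function.comp, skip, dup, id]
    split_ifs <;> omega
  rw [this, pull_id]

theorem mface_mdeg_gt {i j : ℕ} (h : j < i) (x : Mat) :
    mface (i + 1) (mdeg j x) = mdeg j (mface i x) := by
  simp only [mface_eq_pull, mdeg, pull_pull]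
  congr 1
  funext k
  simp only [Function.comp, skip, dup]
  split_ifs <;> omega

theorem mdeg_mdeg {i j : ℕ} (h : i ≤ j) (x : Mat) :
    mdeg i (mdeg j x) = mdeg (j + 1) (mdeg i x) := by
  simp only [mdeg, pull_pull]
  congr 1
  funext k
  simp only [Function.comp, dup]
  split_ifs <;> omega

theorem val_face {m n i : ℕ} (hi : i ≤ m + 1) (f : Chain (m + 1) →ₗ[ℤ] Chain n) :
    val (face i f) = mface i (val f) := by
  rw [mface_eq_pull]
  refine val_comp_push (fun k => ?_) f
  unfold skip
  split_ifs <;> omega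

theorem val_degen {m n i : ℕ} (hi : i ≤ m) (f : Chain m →ₗ[ℤ] Chain n) :
    val (degen i f) = mdeg i (val f) := by
  refine val_comp_push (fun k => ?_) f
  unfold dup
  split_ifs <;> omega

theorem IsO.mface {n m i : ℕ} {x : Mat} (hx : IsO n (m + 1) x) (hi : i ≤ m + 1) :
    IsO n m (mface i x) := by
  have := val_isO (face_isOr i (ofMat_isOr hx))
  rwa [val_face hi, val_ofMat hx] at this

theorem IsO.mdeg {n m i : ℕ} {x : Mat} (hx : IsO n m x) (hi : i ≤ m) :
    IsO n (m + 1) (mdeg i x) := by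
  have := val_isO (degen_isOr i hi (ofMat_isOr hx))
  rwa [val_degen hi, val_ofMat hx] at this

theorem mem_image_skip {i v : ℕ} {a : Finset ℕ} :
    v ∈ a.image (skip i) ↔ (v < i ∧ v ∈ a) ∨ (i < v ∧ v - 1 ∈ a) := by
  simp only [Finset.mem_image, skip]
  constructor
  · rintro ⟨w, hw, h⟩
    split_ifs at h with h1
    · subst h
      exact Or.inl ⟨h1, hw⟩
    · subst h
      refine Or.inr ⟨by omega, by simpa using hw⟩
  · rintro (⟨h1, h2⟩ | ⟨h1, h2⟩)
    · exact ⟨v, h2, by simp [h1]⟩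
    · refine ⟨v - 1, h2, ?_⟩
      rw [if_neg (by omega)]
      omega

theorem image_skip_image_dup {i j : ℕ} {a : Finset ℕ} (h : i ∉ a)
    (hj : j = i ∨ j + 1 = i) : (a.image (dup j)).image (skip i) = a := by
  rw [Finset.image_image]
  conv_rhs => rw [← Finset.image_id (s := a)]
  apply Finset.image_congr
  intro k hk
  have : k ≠ i := fun e => h (e ▸ hk)
  simp only [Function.comp, skip, dup, id]
  split_ifs <;> omega

theorem eq_image_skip {i : ℕ} {a : Finset ℕ} (h : i ∉ a) :
    ∃ a' : Finset ℕ, a = a'.image (skip i) :=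
  ⟨a.image (dup i), (image_skip_image_dup h (Or.inl rfl)).symm⟩

/-- A simplex without `k` is a simplex of the face opposite `k`; this is the form in which thinness
of a face is applied. -/
theorem Van.of_notMem {i k : ℕ} {x : Mat} (h : Van i (mface k x)) {a : Finset ℕ} (hk : k ∉ a)
    (h0 : skip k i ∈ a) (h1 : skip k (i + 1) ∈ a) (h2 : skip k (i + 2) ∈ a) (b : Finset ℕ) :
    x a b = 0 := by
  obtain ⟨a', rfl⟩ := eq_image_skip hk
  have hs : ∀ v, skip k v ∈ a'.image (skip k) → v ∈ a' := by
    intro v hv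
    obtain ⟨w, hw, e⟩ := Finset.mem_image.1 hv
    rwa [skip_injective k e] at hw
  exact h a' (hs _ h0) (hs _ h1) (hs _ h2) b

theorem IsO.subset_of_ne {n m : ℕ} {x : Mat} (hx : IsO n m x) {a b : Finset ℕ} (h : x a b ≠ 0) :
    (∀ v ∈ a, v ≤ m) ∧ ∀ v ∈ b, v ≤ n :=
  ⟨subset_range_iff.1 (hx.supp_left _ _ h), subset_range_iff.1 (hx.supp_right _ _ h)⟩

theorem bd_zero {N : ℕ} {c : Finset ℕ → ℤ} (h : ∀ b, c b = 0) (b : Finset ℕ) : bd N c b = 0 :=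
  Finset.sum_eq_zero fun v _ => by rw [h, mul_zero]

/-- If a matrix vanishes on a simplex and on all of its faces but one, then it vanishes on that
face. -/
theorem IsO.eq_zero_of_insert {n m : ℕ} {x : Mat} (hx : IsO n m x) {a : Finset ℕ} {v : ℕ}
    (hv : v ≤ m) (hva : v ∉ a) (h0 : ∀ b, x (insert v a) b = 0)
    (h1 : ∀ u ∈ a, ∀ b, x ((insert v a).erase u) b = 0) (b : Finset ℕ) : x a b = 0 := by
  by_contra hne
  have ha := hx.supp_left _ _ hne
  have := hx.chain (insert v a)
    (Finset.insert_subset (Finset.mem_range.2 (by omega)) ha) b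
  rw [bd_zero h0, alt, Finset.sum_insert hva, Finset.erase_insert hva,
    Finset.sum_eq_zero (fun u hu => by rw [h1 u hu, mul_zero]), add_zero] at this
  rcases mul_eq_zero.1 this.symm with h | h
  · exact sgn_ne_zero _ _ h
  · exact hne h

/-- The wedge operation on matrices. -/
def mwedge (i : ℕ) (x y : Mat) : Mat := fun a b =>
  mdeg (i + 1) x a b - mdeg i (mdeg i (mface (i + 1) y)) a b + mdeg i y a b

theorem val_wedge {m n i : ℕ} (hi : i ≤ m) (x y : Chain (m + 1) →ₗ[ℤ] Chain n) :
    val (wedge i x y) = mwedge i (val x) (val y) := by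
  funext a b
  unfold mwedge
  rw [← val_face (by omega), ← val_degen hi, ← val_degen (by omega), ← val_degen (by omega),
    ← val_degen (by omega)]
  by_cases ha : a = ∅
  · simp [val, ha]
  · simp only [val_of_ne ha, wedge, LinearMap.add_apply, LinearMap.sub_apply, map_add, map_sub]

theorem mdeg_apply_of_notMem {i : ℕ} {x : Mat} {a : Finset ℕ} (h : i ∉ a ∨ i + 1 ∉ a) :
    mdeg i x a = x (a.image (dup i)) := by
  funext b
  unfold mdeg pull
  rw [if_pos]
  rw [Finset.card_image_iff]
  intro u hu v hv e
  simp only [Finset.mem_coe] at hu hv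
  simp only [dup] at e
  rcases h with h | h
  · have h1 : u ≠ i := fun e => h (e ▸ hu)
    have h2 : v ≠ i := fun e => h (e ▸ hv)
    split_ifs at e <;> omega
  · have h1 : u ≠ i + 1 := fun e => h (e ▸ hu)
    have h2 : v ≠ i + 1 := fun e => h (e ▸ hv)
    split_ifs at e <;> omega

theorem mdeg_apply_of_mem {i : ℕ} {x : Mat} {a : Finset ℕ} (h : i ∈ a) (h' : i + 1 ∈ a)
    (b : Finset ℕ) : mdeg i x a b = 0 := by
  unfold mdeg pull
  rw [if_neg]
  intro e
  rw [Finset.card_image_iff] at e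
  have := e (Finset.mem_coe.2 h) (Finset.mem_coe.2 h') (by simp [dup])
  omega

theorem mem_image_dup {i v : ℕ} {a : Finset ℕ} :
    v ∈ a.image (dup i) ↔ (v ≤ i ∧ v ∈ a) ∨ (i ≤ v ∧ v + 1 ∈ a) := by
  simp only [Finset.mem_image, dup]
  constructor
  · rintro ⟨w, hw, h⟩
    split_ifs at h with h1
    · subst h
      exact Or.inl ⟨h1, hw⟩
    · subst h
      refine Or.inr ⟨by omega, ?_⟩
      rwa [Nat.sub_add_cancel (by omega)]
  · rintro (⟨h1, h2⟩ | ⟨h1, h2⟩)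
    · exact ⟨v, h2, by simp [h1]⟩
    · refine ⟨v + 1, h2, ?_⟩
      rw [if_neg (by omega)]
      omega

theorem mwedge_van (i : ℕ) (x y : Mat) : Van i (mwedge i x y) := by
  intro a h0 h1 h2 b
  unfold mwedge
  rw [mdeg_apply_of_mem h1 h2, mdeg_apply_of_mem h0 h1, mdeg_apply_of_mem h0 h1]
  ring

theorem mface_mwedge_right {i : ℕ} {x y : Mat} (h : mface i x = mface (i + 1) y) :
    mface i (mwedge i x y) = y := by
  have e : mface i (mwedge i x y) = fun a b => mface i (mdeg (i + 1) x) a b -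
      mface i (mdeg i (mdeg i (mface (i + 1) y))) a b + mface i (mdeg i y) a b := rfl
  rw [e, mface_mdeg_lt le_rfl, mface_mdeg_self, mface_mdeg_self, h]
  funext a b
  ring

theorem mface_mwedge_left {i : ℕ} {x y : Mat} :
    mface (i + 2) (mwedge i x y) = x := by
  have e : mface (i + 2) (mwedge i x y) = fun a b => mface (i + 1 + 1) (mdeg (i + 1) x) a b -
      mface (i + 1 + 1) (mdeg i (mdeg i (mface (i + 1) y))) a b +
        mface (i + 1 + 1) (mdeg i y) a b := rfl
  rw [e, mface_mdeg_succ, mface_mdeg_gt (by omega), mface_mdeg_succ, mface_mdeg_gt (by omega)]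
  funext a b
  ring

/-- A simplex without `i` or without `i + 2` lies in one of the two given faces, and on simplexes
with all of `i`, `i + 1`, `i + 2` both sides vanish. If only `i + 1` is missing, insert it: the
enlarged simplex and all its faces vanish except those opposite `i`, `i + 1`, `i + 2`, so the chain
condition writes `w a` as the sum of the values on the other two. -/
theorem mwedge_eq {n m i : ℕ} (hi : i ≤ m) {w : Mat} (hw : IsO n (m + 2) w) (h : Van i w) :
    mwedge i (mface (i + 2) w) (mface i w) = w := by
  have hf : mface i (mface (i + 2) w) = mface (i + 1) (mface i w) := mface_mface (by omega) w
  funext a b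
  by_cases h0 : i ∈ a
  swap
  · obtain ⟨a', rfl⟩ := eq_image_skip h0
    have := congrFun (congrFun (mface_mwedge_right hf) a') b
    exact this
  by_cases h2 : i + 2 ∈ a
  swap
  · obtain ⟨a', rfl⟩ := eq_image_skip h2
    have := congrFun (congrFun (mface_mwedge_left (i := i) (x := mface (i + 2) w)
      (y := mface i w)) a') b
    exact this
  by_cases h1 : i + 1 ∈ a
  · rw [mwedge_van _ _ _ a h0 h1 h2, h a h0 h1 h2]
  have e1 : mdeg (i + 1) (mface (i + 2) w) a b = w ((insert (i + 1) a).erase (i + 2)) b := by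
    rw [mdeg_apply_of_notMem (Or.inl h1)]
    change w _ b = _
    congr 1
    ext v
    simp only [mem_image_skip, mem_image_dup, Finset.mem_erase, Finset.mem_insert]
    constructor
    · rintro (⟨hv, (⟨hv', hva⟩ | ⟨hv', hva⟩)⟩ | ⟨hv, (⟨hv', hva⟩ | ⟨hv', hva⟩)⟩)
      · exact ⟨by omega, Or.inr hva⟩
      · exact ⟨by omega, Or.inl (by omega)⟩
      · omega
      · exact ⟨by omega, Or.inr (by rwa [Nat.sub_add_cancel (by omega)] at hva)⟩
    · rintro ⟨hv, rfl | hva⟩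
      · exact Or.inl ⟨by omega, Or.inr ⟨le_rfl, h2⟩⟩
      · rcases lt_or_ge v (i + 2) with h' | h'
        · exact Or.inl ⟨h', Or.inl ⟨by omega, hva⟩⟩
        · exact Or.inr ⟨by omega, Or.inr ⟨by omega, by rwa [Nat.sub_add_cancel (by omega)]⟩⟩
  have e2 : mdeg i (mface i w) a b = w ((insert (i + 1) a).erase i) b := by
    rw [mdeg_apply_of_notMem (Or.inr h1)]
    change w _ b = _
    congr 1
    ext v
    simp only [mem_image_skip, mem_image_dup, Finset.mem_erase, Finset.mem_insert]
    constructor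
    · rintro (⟨hv, (⟨hv', hva⟩ | ⟨hv', hva⟩)⟩ | ⟨hv, (⟨hv', hva⟩ | ⟨hv', hva⟩)⟩)
      · exact ⟨by omega, Or.inr hva⟩
      · omega
      · exact ⟨by omega, Or.inl (by omega)⟩
      · exact ⟨by omega, Or.inr (by rwa [Nat.sub_add_cancel (by omega)] at hva)⟩
    · rintro ⟨hv, rfl | hva⟩
      · exact Or.inr ⟨by omega, Or.inl ⟨by omega, by simpa using h0⟩⟩
      · rcases lt_or_ge v i with h' | h'
        · exact Or.inl ⟨h', Or.inl ⟨by omega, hva⟩⟩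
        · exact Or.inr ⟨by omega, Or.inr ⟨by
            have : v ≠ i + 1 := fun e => h1 (e ▸ hva)
            omega, by rwa [Nat.sub_add_cancel (by omega)]⟩⟩
  have e3 : mdeg i (mdeg i (mface (i + 1) (mface i w))) a b = 0 := by
    rw [mdeg_apply_of_notMem (Or.inr h1), mdeg_apply_of_mem]
    · exact mem_image_dup.2 (Or.inl ⟨le_rfl, h0⟩)
    · exact mem_image_dup.2 (Or.inr ⟨by omega, h2⟩)
  unfold mwedge
  rw [e1, e2, e3]
  by_cases hr : a ⊆ Finset.range (m + 2 + 1)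
  · have hch := hw.chain (insert (i + 1) a)
      (Finset.insert_subset (Finset.mem_range.2 (by omega)) hr) b
    rw [bd_zero (h _ (by simp [h0]) (by simp) (by simp [h2])), alt, Finset.sum_insert h1,
      Finset.erase_insert h1, Finset.sum_eq_add_of_mem i (i + 2) h0 h2 (by omega)] at hch
    -- The consecutive vertices `i`, `i + 1`, `i + 2` carry alternating signs.
    · have s1 : sgn (insert (i + 1) a) (i + 1) = - sgn (insert (i + 1) a) i := by
        have hi2 : insert (i + 1) a = insert i (insert (i + 1) (a.erase i)) := by
          rw [Finset.insert_comm, Finset.insert_erase h0]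
        have : sgn (insert (i + 1) a) (i + 1) = - sgn (insert (i + 1) (a.erase i)) (i + 1) := by
          rw [hi2, sgn_insert_lt (by omega) (by simp)]
        rw [this]
        have h3 : sgn (insert (i + 1) a) i = sgn (insert (i + 1) (a.erase i)) i := by
          rw [hi2, sgn_insert_self]
        rw [h3]
        congr 1
        unfold sgn
        congr 2
        ext u
        simp only [Finset.mem_filter, Finset.mem_insert, Finset.mem_erase]
        constructor
        · rintro ⟨hu, hu'⟩
          refine ⟨hu, ?_⟩
          omega
        · rintro ⟨hu, hu'⟩
          exact ⟨hu, by omega⟩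
      have s2 : sgn (insert (i + 1) a) (i + 2) = sgn (insert (i + 1) a) i := by
        rw [sgn_insert_lt (by omega) h1, sgn_insert_gt (by omega)]
        have hi2 : a = insert i (a.erase i) := by rw [Finset.insert_erase h0]
        rw [hi2, sgn_insert_lt (by omega) (by simp), sgn_insert_self, neg_neg]
        unfold sgn
        congr 2
        ext u
        simp only [Finset.mem_filter, Finset.mem_erase]
        constructor
        · rintro ⟨⟨hu1, hu⟩, hu'⟩
          refine ⟨⟨hu1, hu⟩, ?_⟩
          have : u ≠ i + 1 := fun e => h1 (e ▸ hu)
          omega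
        · rintro ⟨hu, hu'⟩
          exact ⟨hu, by omega⟩
      rw [s1, s2] at hch
      have hne := sgn_ne_zero (insert (i + 1) a) i
      have : sgn (insert (i + 1) a) i * (w ((insert (i + 1) a).erase (i + 2)) b - 0 +
          w ((insert (i + 1) a).erase i) b - w a b) = 0 := by linarith
      rcases mul_eq_zero.1 this with h' | h'
      · exact absurd h' hne
      · linarith
    · intro u hu hne
      rw [h, mul_zero]
      · simp [h0, hne.1.symm]
      · simp only [Finset.mem_erase, Finset.mem_insert, true_or, and_true]
        rintro rfl
        exact h1 hu
      · simp [h2, hne.2.symm]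
  -- Out of range the chain condition is not available. But deleting a vertex within range leaves a
  -- simplex that is still out of range, so all terms vanish.
  · have hz : ∀ u ∈ Finset.range (m + 2 + 1), u ∈ a → w ((insert (i + 1) a).erase u) b = 0 := by
      intro u hu _
      by_contra hne
      apply hr
      intro v hv
      by_cases huv : v = u
      · rw [huv]; exact hu
      · exact hw.supp_left _ _ hne (Finset.mem_erase.2 ⟨huv, Finset.mem_insert_of_mem hv⟩)
    rw [hz _ (Finset.mem_range.2 (by omega)) h2, hz _ (Finset.mem_range.2 (by omega)) h0]
    by_contra hne
    exact hr (hw.supp_left a b (by omega))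

end Oriental

end

/-! ### The complicial identities in orientals -/

noncomputable section

namespace Oriental

theorem val_d {n m i : ℕ} (hi : i ≤ m + 1) (x : (nerve n).X (m + 1)) :
    val ((nerve n).d i x hi).1 = mface i (val x.1) := val_face hi _

theorem val_s {n m i : ℕ} (hi : i ≤ m) (x : (nerve n).X m) :
    val ((nerve n).s i x hi).1 = mdeg i (val x.1) := val_degen hi _

/-- In `Or(-, n)` the wedges at place `i` are the elements that vanish on the simplexes containing
`i`, `i + 1` and `i + 2`. -/
theorem isWedge_iff {n m i : ℕ} (hi : i ≤ m) (x y : (nerve n).X (m + 1))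
    (w : (nerve n).X (m + 2)) :
    (nerve n).IsWedge i x y w hi ↔
      mface i (val w.1) = val y.1 ∧ mface (i + 2) (val w.1) = val x.1 ∧ Van i (val w.1) := by
  constructor
  · rintro ⟨h, rfl⟩
    have h' : mface i (val x.1) = mface (i + 1) (val y.1) := by
      rw [← val_d (by omega), ← val_d (by omega), h]
    have e : val ((nerve n).wedge i hi x y h).1 = mwedge i (val x.1) (val y.1) :=
      val_wedge hi _ _
    rw [e]
    exact ⟨mface_mwedge_right h', mface_mwedge_left, mwedge_van _ _ _⟩
  · rintro ⟨h1, h2, h3⟩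
    have h : (nerve n).d i x = (nerve n).d (i + 1) y := by
      apply or_ext
      rw [val_d (by omega), val_d (by omega), ← h1, ← h2]
      exact mface_mface (by omega) _
    refine ⟨h, or_ext ?_⟩
    have e : val ((nerve n).wedge i hi x y h).1 = mwedge i (val x.1) (val y.1) :=
      val_wedge hi _ _
    rw [e, ← h1, ← h2]
    exact mwedge_eq hi (val_isO w.2) h3

theorem Van.mface_lt {i j : ℕ} {x : Mat} (h : Van (i + 1) x) (hj : j ≤ i) :
    Van i (mface j x) := by
  intro a h0 h1 h2 b
  apply h
  · exact mem_image_skip.2 (Or.inr ⟨by omega, h0⟩)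
  · exact mem_image_skip.2 (Or.inr ⟨by omega, h1⟩)
  · exact mem_image_skip.2 (Or.inr ⟨by omega, h2⟩)

theorem Van.mface_gt {i j : ℕ} {x : Mat} (h : Van i x) (hj : i + 3 ≤ j) : Van i (mface j x) := by
  intro a h0 h1 h2 b
  apply h
  · exact mem_image_skip.2 (Or.inl ⟨by omega, h0⟩)
  · exact mem_image_skip.2 (Or.inl ⟨by omega, h1⟩)
  · exact mem_image_skip.2 (Or.inl ⟨by omega, h2⟩)

theorem van_mdeg {i : ℕ} (x : Mat) : Van i (mdeg i x) := fun _ h0 h1 _ b =>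
  mdeg_apply_of_mem h0 h1 b

theorem van_mdeg_succ {i : ℕ} (x : Mat) : Van i (mdeg (i + 1) x) := fun _ _ h1 h2 b =>
  mdeg_apply_of_mem h1 h2 b

/-- A simplex with `i + 1`, `i + 2`, `i + 3` either contains `i`, where thinness at `i` applies, or
lies in the face opposite `i`. `Van.pred` is the mirror image. -/
theorem Van.succ {i : ℕ} {x : Mat} (h : Van i x) (h' : Van i (mface i x)) : Van (i + 1) x := by
  intro a h1 h2 h3 b
  by_cases h0 : i ∈ a
  · exact h a h0 h1 h2 b
  · refine h'.of_notMem h0 ?_ ?_ ?_ b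
    · simpa [skip] using h1
    · simpa [skip] using h2
    · simpa [skip] using h3

theorem Van.pred {i : ℕ} {x : Mat} (h : Van (i + 1) x) (h' : Van i (mface (i + 3) x)) :
    Van i x := by
  intro a h0 h1 h2 b
  by_cases h3 : i + 3 ∈ a
  · exact h a h1 h2 h3 b
  · refine h'.of_notMem h3 ?_ ?_ ?_ b
    · simpa [skip] using h0
    · simpa [skip] using h1
    · simpa [skip] using h2

/-- The pattern of the vanishing lemmas that follow: a simplex of the face opposite `v` lacks `v`.
Insert `v`; the enlarged simplex and its faces other than the one opposite `v` vanish, by thinness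
of the element or of one of the given faces, so the chain condition leaves only the wanted value. -/
theorem Van.mface_succ {n m i : ℕ} {x : Mat} (hx : IsO n m x) (him : i + 3 ≤ m)
    (h : Van i x) (h0 : Van i (mface i x)) (h2 : Van i (mface (i + 2) x)) :
    Van i (mface (i + 1) x) := by
  have hs := h.succ h0
  intro a ha0 ha1 ha2 b
  change x (a.image (skip (i + 1))) b = 0
  have g0 : i ∈ a.image (skip (i + 1)) := mem_image_skip.2 (Or.inl ⟨by omega, ha0⟩)
  have g1 : i + 1 ∉ a.image (skip (i + 1)) := fun h => by
    rcases mem_image_skip.1 h with h | h <;> omega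
  have g2 : i + 2 ∈ a.image (skip (i + 1)) := mem_image_skip.2 (Or.inr ⟨by omega, ha1⟩)
  have g3 : i + 3 ∈ a.image (skip (i + 1)) := mem_image_skip.2 (Or.inr ⟨by omega, ha2⟩)
  refine hx.eq_zero_of_insert (v := i + 1) (by omega) g1 ?_ ?_ b
  · exact h _ (by simp [g0]) (by simp) (by simp [g2])
  · intro u hu
    by_cases e0 : u = i + 2
    · subst e0
      refine h2.of_notMem (by simp) ?_ ?_ ?_ <;> simp [skip, g0, g3]
    by_cases e1 : u = i
    · subst e1
      exact hs _ (by simp) (Finset.mem_erase.2 ⟨by omega, Finset.mem_insert_of_mem g2⟩)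
        (Finset.mem_erase.2 ⟨by omega, Finset.mem_insert_of_mem g3⟩)
    · exact h _ (by simp [g0, Ne.symm e1]) (by
        simp only [Finset.mem_erase, Finset.mem_insert, true_or, and_true]
        rintro rfl
        exact g1 hu) (by simp [g2, Ne.symm e0])

theorem Van.mface_add_two {n m i : ℕ} {x : Mat} (hx : IsO n m x) (him : i + 3 ≤ m)
    (h : Van (i + 1) x) (h3 : Van i (mface (i + 3) x)) (h1 : Van i (mface (i + 1) x)) :
    Van i (mface (i + 2) x) := by
  have hs := h.pred h3
  intro a ha0 ha1 ha2 b
  change x (a.image (skip (i + 2))) b = 0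
  have g0 : i ∈ a.image (skip (i + 2)) := mem_image_skip.2 (Or.inl ⟨by omega, ha0⟩)
  have g2 : i + 2 ∉ a.image (skip (i + 2)) := fun h => by
    rcases mem_image_skip.1 h with h | h <;> omega
  have g1 : i + 1 ∈ a.image (skip (i + 2)) := mem_image_skip.2 (Or.inl ⟨by omega, ha1⟩)
  have g3 : i + 3 ∈ a.image (skip (i + 2)) := mem_image_skip.2 (Or.inr ⟨by omega, ha2⟩)
  refine hx.eq_zero_of_insert (v := i + 2) (by omega) g2 ?_ ?_ b
  · exact h _ (by simp [g1]) (by simp) (by simp [g3])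
  · intro u hu
    have hu2 : i + 2 ≠ u := by
      rintro rfl
      exact g2 hu
    by_cases e0 : u = i + 1
    · subst e0
      refine h1.of_notMem (by simp) ?_ ?_ ?_ <;> simp [skip, g0, g3]
    by_cases e1 : u = i + 3
    · subst e1
      exact hs _ (by simp [g0]) (by simp [g1]) (by simp)
    · exact h _ (by simp [g1, Ne.symm e0]) (by simp [hu2]) (by simp [g3, Ne.symm e1])

/-- The two distant places interact only in the case where `a` contains `j` and `j + 2` but not `j +
1`; then `j + 1` is inserted. The other cases are thinness of `x` or of one of its two faces. -/
theorem Van.interchange {n m i j : ℕ} {x : Mat} (hx : IsO n m x) (hij : i + 3 ≤ j)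
    (hj : j + 2 ≤ m) (h : Van j x) (h1 : Van i (mface j x)) (h2 : Van i (mface (j + 2) x)) :
    Van i x := by
  have hA : ∀ a, i ∈ a → i + 1 ∈ a → i + 2 ∈ a → j ∉ a → ∀ b, x a b = 0 := by
    intro a h0 h1' h2' h3 b
    refine h1.of_notMem h3 ?_ ?_ ?_ b
    · rwa [skip, if_pos (by omega)]
    · rwa [skip, if_pos (by omega)]
    · rwa [skip, if_pos (by omega)]
  have hB : ∀ a, i ∈ a → i + 1 ∈ a → i + 2 ∈ a → j + 2 ∉ a → ∀ b, x a b = 0 := by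
    intro a h0 h1' h2' h3 b
    refine h2.of_notMem h3 ?_ ?_ ?_ b
    · rwa [skip, if_pos (by omega)]
    · rwa [skip, if_pos (by omega)]
    · rwa [skip, if_pos (by omega)]
  intro a g0 g1 g2 b
  by_cases k0 : j ∈ a
  swap
  · exact hA a g0 g1 g2 k0 b
  by_cases k2 : j + 2 ∈ a
  swap
  · exact hB a g0 g1 g2 k2 b
  by_cases k1 : j + 1 ∈ a
  · exact h a k0 k1 k2 b
  refine hx.eq_zero_of_insert (v := j + 1) (by omega) k1 ?_ ?_ b
  · exact h _ (by simp [k0]) (by simp) (by simp [k2])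
  · intro u hu
    have hu2 : j + 1 ≠ u := by
      rintro rfl
      exact k1 hu
    have key : ∀ k, k ∈ a → k ≠ u → k ∈ (insert (j + 1) a).erase u := fun k hk hk' =>
      Finset.mem_erase.2 ⟨hk', Finset.mem_insert_of_mem hk⟩
    by_cases e0 : u = j
    · subst e0
      exact hA _ (key _ g0 (by omega)) (key _ g1 (by omega)) (key _ g2 (by omega)) (by simp)
    by_cases e1 : u = j + 2
    · subst e1
      exact hB _ (key _ g0 (by omega)) (key _ g1 (by omega)) (key _ g2 (by omega)) (by simp)
    · exact h _ (key _ k0 (Ne.symm e0)) (by simp [hu2]) (key _ k2 (Ne.symm e1))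

theorem Van.interchange' {n m i j : ℕ} {x : Mat} (hx : IsO n m x) (hij : i + 3 ≤ j)
    (hj : j + 2 ≤ m) (h : Van i x) (h1 : Van (j - 1) (mface i x))
    (h2 : Van (j - 1) (mface (i + 2) x)) : Van j x := by
  have hA : ∀ a, j ∈ a → j + 1 ∈ a → j + 2 ∈ a → i ∉ a → ∀ b, x a b = 0 := by
    intro a h0 h1' h2' h3 b
    refine h1.of_notMem h3 ?_ ?_ ?_ b
    all_goals rw [skip, if_neg (by omega)]
    · rwa [show j - 1 + 1 = j by omega]
    · rwa [show j - 1 + 1 + 1 = j + 1 by omega]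
    · rwa [show j - 1 + 2 + 1 = j + 2 by omega]
  have hB : ∀ a, j ∈ a → j + 1 ∈ a → j + 2 ∈ a → i + 2 ∉ a → ∀ b, x a b = 0 := by
    intro a h0 h1' h2' h3 b
    refine h2.of_notMem h3 ?_ ?_ ?_ b
    all_goals rw [skip, if_neg (by omega)]
    · rwa [show j - 1 + 1 = j by omega]
    · rwa [show j - 1 + 1 + 1 = j + 1 by omega]
    · rwa [show j - 1 + 2 + 1 = j + 2 by omega]
  intro a g0 g1 g2 b
  by_cases k0 : i ∈ a
  swap
  · exact hA a g0 g1 g2 k0 b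
  by_cases k2 : i + 2 ∈ a
  swap
  · exact hB a g0 g1 g2 k2 b
  by_cases k1 : i + 1 ∈ a
  · exact h a k0 k1 k2 b
  refine hx.eq_zero_of_insert (v := i + 1) (by omega) k1 ?_ ?_ b
  · exact h _ (by simp [k0]) (by simp) (by simp [k2])
  · intro u hu
    have hu2 : i + 1 ≠ u := by
      rintro rfl
      exact k1 hu
    have key : ∀ k, k ∈ a → k ≠ u → k ∈ (insert (i + 1) a).erase u := fun k hk hk' =>
      Finset.mem_erase.2 ⟨hk', Finset.mem_insert_of_mem hk⟩
    by_cases e0 : u = i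
    · subst e0
      exact hA _ (key _ g0 (by omega)) (key _ g1 (by omega)) (key _ g2 (by omega)) (by simp)
    by_cases e1 : u = i + 2
    · subst e1
      exact hB _ (key _ g0 (by omega)) (key _ g1 (by omega)) (key _ g2 (by omega)) (by simp)
    · exact h _ (key _ k0 (Ne.symm e0)) (by simp [hu2]) (key _ k2 (Ne.symm e1))

/-- The vanishing property of the elements `A` to which the whiskering identity applies. -/
theorem Van.whisker_source {n m i : ℕ} {D : Mat} (hD : IsO n m D) (him : i + 4 ≤ m)
    (h : Van (i + 1) D) (h3 : Van (i + 1) (mface (i + 3) D)) (h1 : Van i (mface (i + 1) D))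
    {a : Finset ℕ} (g0 : i ∈ a) (g1 : i + 1 ∈ a) (g2 : i + 2 ∈ a) (g3 : i + 3 ∈ a)
    (b : Finset ℕ) : mface (i + 2) D a b = 0 := by
  change D (a.image (skip (i + 2))) b = 0
  have k0 : i ∈ a.image (skip (i + 2)) := mem_image_skip.2 (Or.inl ⟨by omega, g0⟩)
  have k1 : i + 1 ∈ a.image (skip (i + 2)) := mem_image_skip.2 (Or.inl ⟨by omega, g1⟩)
  have k2 : i + 2 ∉ a.image (skip (i + 2)) := fun h => by
    rcases mem_image_skip.1 h with h | h <;> omega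
  have k3 : i + 3 ∈ a.image (skip (i + 2)) := mem_image_skip.2 (Or.inr ⟨by omega, g2⟩)
  have k4 : i + 4 ∈ a.image (skip (i + 2)) := mem_image_skip.2 (Or.inr ⟨by omega, g3⟩)
  refine hD.eq_zero_of_insert (v := i + 2) (by omega) k2 ?_ ?_ b
  · exact h _ (by simp [k1]) (by simp) (by simp [k3])
  · intro u hu
    have hu2 : i + 2 ≠ u := by
      rintro rfl
      exact k2 hu
    by_cases e0 : u = i + 1
    · subst e0
      refine h1.of_notMem (by simp) ?_ ?_ ?_ <;> simp [skip, k0, k3]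
    by_cases e1 : u = i + 3
    · subst e1
      refine h3.of_notMem (by simp) ?_ ?_ ?_ <;> simp [skip, k1, k4]
    · exact h _ (by simp [k1, Ne.symm e0]) (by simp [hu2]) (by simp [k3, Ne.symm e1])

/-- The face opposite `i + 2` is not assumed thin. It need only vanish on simplexes with the four
vertices `i, …, i + 3`, and this is what `Van.whisker_source` provides for the elements `A` of the
whiskering axiom. -/
theorem Van.whisker_left {n m i : ℕ} {B : Mat} (hB : IsO n m B) (him : i + 4 ≤ m)
    (hA : ∀ a, i ∈ a → i + 1 ∈ a → i + 2 ∈ a → i + 3 ∈ a → ∀ b, mface (i + 2) B a b = 0)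
    (h : Van i B) (h0 : Van (i + 1) (mface i B)) : Van (i + 2) B := by
  intro a g2 g3 g4 b
  by_cases g0 : i ∈ a
  swap
  · refine h0.of_notMem g0 ?_ ?_ ?_ b
    · simpa [skip] using g2
    · rwa [skip, if_neg (by omega)]
    · rwa [skip, if_neg (by omega)]
  by_cases g1 : i + 1 ∈ a
  · exact h a g0 g1 g2 b
  refine hB.eq_zero_of_insert (v := i + 1) (by omega) g1 ?_ ?_ b
  · exact h _ (by simp [g0]) (by simp) (by simp [g2])
  · intro u hu
    have hu2 : i + 1 ≠ u := by
      rintro rfl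
      exact g1 hu
    by_cases e0 : u = i
    · subst e0
      refine h0.of_notMem (by simp) ?_ ?_ ?_
      all_goals rw [skip, if_neg (by omega)]
      · exact Finset.mem_erase.2 ⟨by omega, Finset.mem_insert_of_mem g2⟩
      · exact Finset.mem_erase.2 ⟨by omega, Finset.mem_insert_of_mem g3⟩
      · exact Finset.mem_erase.2 ⟨by omega, Finset.mem_insert_of_mem g4⟩
    by_cases e1 : u = i + 2
    · subst e1
      intro b
      obtain ⟨a', ha'⟩ := eq_image_skip (i := i + 2) (a := (insert (i + 1) a).erase (i + 2))
        (by simp)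
      have key : ∀ k, skip (i + 2) k ∈ (insert (i + 1) a).erase (i + 2) → k ∈ a' := by
        intro k hk
        rw [ha'] at hk
        obtain ⟨w, hw, e⟩ := Finset.mem_image.1 hk
        rwa [skip_injective _ e] at hw
      rw [ha']
      refine hA a' (key _ ?_) (key _ ?_) (key _ ?_) (key _ ?_) b <;> simp [skip, g0, g3, g4]
    · exact h _ (by simp [g0, Ne.symm e0]) (by simp [hu2]) (by simp [g2, Ne.symm e1])

theorem Van.whisker_right {n m i : ℕ} {B : Mat} (hB : IsO n m B) (him : i + 4 ≤ m)
    (hA : ∀ a, i ∈ a → i + 1 ∈ a → i + 2 ∈ a → i + 3 ∈ a → ∀ b, mface (i + 2) B a b = 0)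
    (h : Van (i + 2) B) (h4 : Van i (mface (i + 4) B)) : Van i B := by
  intro a g0 g1 g2 b
  by_cases g4 : i + 4 ∈ a
  swap
  · refine h4.of_notMem g4 ?_ ?_ ?_ b
    · simpa [skip] using g0
    · simpa [skip] using g1
    · simpa [skip] using g2
  by_cases g3 : i + 3 ∈ a
  · exact h a g2 g3 g4 b
  refine hB.eq_zero_of_insert (v := i + 3) (by omega) g3 ?_ ?_ b
  · exact h _ (by simp [g2]) (by simp) (by simp [g4])
  · intro u hu
    have hu2 : i + 3 ≠ u := by
      rintro rfl
      exact g3 hu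
    by_cases e0 : u = i + 4
    · subst e0
      refine h4.of_notMem (by simp) ?_ ?_ ?_
      · simp [skip, g0]
      · simp [skip, g1]
      · simp [skip, g2]
    by_cases e1 : u = i + 2
    · subst e1
      intro b
      obtain ⟨a', ha'⟩ := eq_image_skip (i := i + 2) (a := (insert (i + 3) a).erase (i + 2))
        (by simp)
      have key : ∀ k, skip (i + 2) k ∈ (insert (i + 3) a).erase (i + 2) → k ∈ a' := by
        intro k hk
        rw [ha'] at hk
        obtain ⟨w, hw, e⟩ := Finset.mem_image.1 hk
        rwa [skip_injective _ e] at hw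
      rw [ha']
      refine hA a' (key _ ?_) (key _ ?_) (key _ ?_) (key _ ?_) b <;> simp [skip, g0, g1, g4]
    · exact h _ (by simp [g2, Ne.symm e1]) (by simp [hu2]) (by simp [g4, Ne.symm e0])

theorem nerve_isSimplicial (n : ℕ) : (nerve n).IsSimplicial where
  d_d m i j hij hj x := or_ext (by
    rw [val_d (by omega), val_d (by omega), val_d (by omega), val_d (by omega), mface_mface hij])
  d_s_lt m i j hij hj x := or_ext (by
    rw [val_d (by omega), val_s (by omega), val_s (by omega), val_d (by omega),
      mface_mdeg_lt hij])
  d_s_self m i hi x := or_ext (by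
    rw [val_d (by omega), val_s (by omega), mface_mdeg_self])
  d_s_succ m i hi x := or_ext (by
    rw [val_d (by omega), val_s (by omega), mface_mdeg_succ])
  d_s_gt m i j hij hi x := or_ext (by
    rw [val_d (by omega), val_s (by omega), val_s (by omega), val_d (by omega),
      mface_mdeg_gt hij])
  s_s m i j hij hj x := or_ext (by
    rw [val_s (by omega), val_s (by omega), val_s (by omega), val_s (by omega), mdeg_mdeg hij])

/-- By `isWedge_iff` every wedge axiom splits into equations between faces, which are simplicial
identities, and one vanishing statement, which is a lemma above. -/
theorem nerve_isComplicial (n : ℕ) : (nerve n).IsComplicial where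
  toIsSimplicial := nerve_isSimplicial n
  d_wedge_lt m i j hj hi x y w h := by
    rw [isWedge_iff] at h ⊢
    obtain ⟨h1, h2, h3⟩ := h
    rw [val_d (by omega), val_d (by omega), val_d (by omega), ← h1, ← h2]
    refine ⟨(mface_mface (by omega) _).symm, ?_, h3.mface_lt hj⟩
    exact (mface_mface (i := j) (j := i + 2) (by omega) _).symm
  d_wedge_right m i hi x y w h := by
    rw [isWedge_iff] at h
    exact or_ext (by rw [val_d (by omega), h.1])
  d_wedge_left m i hi x y w h := by
    rw [isWedge_iff] at h
    exact or_ext (by rw [val_d (by omega), h.2.1])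
  d_wedge_gt m i j hj hi x y w h := by
    rw [isWedge_iff] at h ⊢
    obtain ⟨h1, h2, h3⟩ := h
    rw [val_d (by omega), val_d (by omega), val_d (by omega), ← h1, ← h2]
    exact ⟨mface_mface (by omega) _, mface_mface (by omega) _, h3.mface_gt (by omega)⟩
  s_eq_left m i hi x := by
    rw [isWedge_iff, val_s (by omega), val_s (by omega), val_d (by omega)]
    exact ⟨mface_mdeg_self _ _, mface_mdeg_gt (by omega) _, van_mdeg _⟩
  s_eq_right m i hi x := by
    rw [isWedge_iff, val_s (by omega), val_s (by omega), val_d (by omega)]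
    exact ⟨mface_mdeg_lt le_rfl _, mface_mdeg_succ _ _, van_mdeg_succ _⟩
  wedge_form_left m i hi y z b c A h h' := by
    rw [isWedge_iff] at h h'
    obtain ⟨h1, h2, h3⟩ := h
    obtain ⟨k1, k2, k3⟩ := h'
    -- The operands of a wedge are its faces, so the witness can only be the face opposite `(i + 1)
    -- + 2`. The witnesses for the other axioms are found in the same way.
    refine ⟨(nerve n).d (i + 3) A, ?_, ?_⟩
    · rw [isWedge_iff, val_d (by omega), val_d (by omega)]
      refine ⟨?_, ?_, k3.mface_gt (by omega)⟩
      · rw [mface_mface (by omega), k1, h2]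
      · rw [mface_mface le_rfl, k2]
    · rw [isWedge_iff, val_d (by omega), val_d (by omega)]
      refine ⟨rfl, rfl, k3.succ ?_⟩
      rwa [k1]
  wedge_form_right m i hi x y b c A h h' := by
    rw [isWedge_iff] at h h'
    obtain ⟨h1, h2, h3⟩ := h
    obtain ⟨k1, k2, k3⟩ := h'
    refine ⟨(nerve n).d i A, ?_, ?_⟩
    · rw [isWedge_iff, val_d (by omega), val_d (by omega)]
      refine ⟨?_, ?_, k3.mface_lt le_rfl⟩
      · rw [← mface_mface le_rfl, k1]
      · rw [← mface_mface (by omega), k2, h1]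
    · rw [isWedge_iff, val_d (by omega), val_d (by omega)]
      refine ⟨rfl, rfl, k3.pred ?_⟩
      rwa [k2]
  wedge_assoc m i hi x y z w := by
    have hw : IsO n (m + 3) (val w.1) := val_isO w.2
    constructor
    · rintro ⟨p, q, hp, hq, hw'⟩
      rw [isWedge_iff] at hp hq hw'
      obtain ⟨p1, p2, p3⟩ := hp
      obtain ⟨q1, q2, q3⟩ := hq
      obtain ⟨w1, w2, w3⟩ := hw'
      rw [← w1] at p1 p2 p3
      rw [← w2] at q1 q2 q3
      refine ⟨(nerve n).d (i + 3) w, (nerve n).d (i + 1) w, ?_, ?_, ?_⟩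
      · rw [isWedge_iff, val_d (by omega)]
        refine ⟨?_, ?_, w3.mface_gt (by omega)⟩
        · rw [mface_mface (by omega), p2]
        · rw [mface_mface le_rfl, q2]
      · rw [isWedge_iff, val_d (by omega), val_d (by omega), val_d (by omega)]
        refine ⟨?_, ?_, w3.mface_succ hw (by omega) p3 q3⟩
        · rw [mface_mface le_rfl, p1]
        · exact (mface_mface (by omega) _).symm
      · rw [isWedge_iff, val_d (by omega), val_d (by omega)]
        exact ⟨rfl, rfl, w3.succ p3⟩
    · rintro ⟨p, q, hp, hq, hw'⟩
      rw [isWedge_iff] at hp hq hw'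
      obtain ⟨p1, p2, p3⟩ := hp
      obtain ⟨q1, q2, q3⟩ := hq
      obtain ⟨w1, w2, w3⟩ := hw'
      rw [← w2] at p1 p2 p3
      rw [← w1] at q1 q2 q3
      refine ⟨(nerve n).d i w, (nerve n).d (i + 2) w, ?_, ?_, ?_⟩
      · rw [isWedge_iff, val_d (by omega)]
        refine ⟨?_, ?_, w3.mface_lt le_rfl⟩
        · rw [← mface_mface le_rfl, q1]
        · rw [← mface_mface (by omega), p1]
      · rw [isWedge_iff, val_d (by omega), val_d (by omega), val_d (by omega)]
        refine ⟨?_, ?_, w3.mface_add_two hw (by omega) p3 q3⟩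
        · exact mface_mface (by omega) _
        · rw [← mface_mface le_rfl, p2]
      · rw [isWedge_iff, val_d (by omega), val_d (by omega)]
        exact ⟨rfl, rfl, w3.pred p3⟩
  wedge_whisker m i hi x y z b c D hb hc hD A hA w B := by
    have hB : IsO n (m + 4) (val B.1) := val_isO B.2
    rw [isWedge_iff] at hb hc hD
    obtain ⟨d1, d2, d3⟩ := hD
    have hb3 := hb.2.2
    have hc3 := hc.2.2
    rw [← d2] at hb3
    rw [← d1] at hc3
    have hAv : val A.1 = mface (i + 2) (val D.1) := by rw [hA, val_d (by omega)]
    have hA0 := fun a g0 g1 g2 g3 b => Van.whisker_source (val_isO D.2) (by omega) d3 hb3 hc3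
      (a := a) g0 g1 g2 g3 b
    rw [← hAv] at hA0
    constructor
    · rintro ⟨p, hp, hB'⟩
      rw [isWedge_iff] at hp hB'
      obtain ⟨p1, p2, p3⟩ := hp
      obtain ⟨b1, b2, b3⟩ := hB'
      rw [← b1] at p1 p2 p3
      rw [← b2] at hA0
      refine ⟨(nerve n).d (i + 4) B, ?_, ?_⟩
      · rw [isWedge_iff, val_d (by omega), val_d (by omega), ← b2]
        refine ⟨?_, ?_, b3.mface_gt (by omega)⟩
        · rw [mface_mface (by omega)]
          exact p2
        · rw [mface_mface (by omega)]
      · rw [isWedge_iff, val_d (by omega)]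
        exact ⟨b2, rfl, Van.whisker_left hB (by omega) hA0 b3 p3⟩
    · rintro ⟨p, hp, hB'⟩
      rw [isWedge_iff] at hp hB'
      obtain ⟨p1, p2, p3⟩ := hp
      obtain ⟨b1, b2, b3⟩ := hB'
      rw [← b2] at p1 p2 p3
      rw [← b1] at hA0
      refine ⟨(nerve n).d i B, ?_, ?_⟩
      · rw [isWedge_iff, val_d (by omega), val_d (by omega), ← b1]
        refine ⟨?_, ?_, b3.mface_lt (by omega)⟩
        · rw [← mface_mface (by omega)]
        · rw [← p1, mface_mface (by omega)]
      · rw [isWedge_iff, val_d (by omega)]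
        exact ⟨rfl, b1, Van.whisker_right hB (by omega) hA0 b3 p3⟩
  wedge_interchange m i j hij hj x y z w B := by
    have hB : IsO n (m + 3) (val B.1) := val_isO B.2
    constructor
    · rintro ⟨p, q, hp, hq, hB'⟩
      rw [isWedge_iff] at hp hq hB'
      obtain ⟨p1, p2, p3⟩ := hp
      obtain ⟨q1, q2, q3⟩ := hq
      obtain ⟨b1, b2, b3⟩ := hB'
      rw [← b2] at p1 p2 p3
      rw [← b1] at q1 q2 q3
      refine ⟨(nerve n).d (i + 2) B, (nerve n).d i B, ?_, ?_, ?_⟩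
      · rw [isWedge_iff, val_d (by omega)]
        refine ⟨?_, ?_, b3.mface_lt (by omega)⟩
        · rw [← mface_mface (by omega), q2]
        · rw [← mface_mface (i := i + 2) (j := j + 2) (by omega)]
          exact p2
      · rw [isWedge_iff, val_d (by omega)]
        refine ⟨?_, ?_, b3.mface_lt (by omega)⟩
        · rw [← mface_mface (by omega), q1]
        · rw [← mface_mface (i := i) (j := j + 2) (by omega)]
          exact p1
      · rw [isWedge_iff, val_d (by omega), val_d (by omega)]
        exact ⟨rfl, rfl, b3.interchange hB (by omega) (by omega) q3 p3⟩
    · rintro ⟨p, q, hp, hq, hB'⟩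
      rw [isWedge_iff] at hp hq hB'
      obtain ⟨p1, p2, p3⟩ := hp
      obtain ⟨q1, q2, q3⟩ := hq
      obtain ⟨b1, b2, b3⟩ := hB'
      rw [← b2] at p1 p2 p3
      rw [← b1] at q1 q2 q3
      refine ⟨(nerve n).d (j + 3) B, (nerve n).d (j + 1) B, ?_, ?_, ?_⟩
      · rw [isWedge_iff, val_d (by omega)]
        refine ⟨?_, ?_, b3.mface_gt (by omega)⟩
        · rw [mface_mface (by omega), q2]
        · rw [mface_mface (i := i + 2) (j := j + 2) (by omega)]
          exact p2
      · rw [isWedge_iff, val_d (by omega)]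
        refine ⟨?_, ?_, b3.mface_gt (by omega)⟩
        · rw [mface_mface (by omega), q1]
        · rw [mface_mface (i := i + 2) (j := j) (by omega), p1]
      · rw [isWedge_iff, val_d (by omega), val_d (by omega)]
        exact ⟨rfl, rfl, b3.interchange' hB (by omega) (by omega) q3 p3⟩

end Oriental

end

/-! ### Thin elements and iterated wedges in a set with complicial identities -/

noncomputable section

namespace WedgeData

/-- The elements of all degrees. -/
abbrev E (U : WedgeData.{u}) : Type u := Σ m, U.X m

/-- The face operations on elements of all degrees. -/
def D (U : WedgeData.{u}) (i : ℕ) : U.E → U.E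
  | ⟨0, x⟩ => ⟨0, x⟩
  | ⟨m + 1, x⟩ => if h : i ≤ m + 1 then ⟨m, U.d i x h⟩ else ⟨m + 1, x⟩

/-- The degeneracy operations on elements of all degrees. -/
def S (U : WedgeData.{u}) (i : ℕ) : U.E → U.E
  | ⟨m, x⟩ => if h : i ≤ m then ⟨m + 1, U.s i x h⟩ else ⟨m, x⟩

/-- An element is thin at `i` if it is a wedge at place `i`. -/
def Th (U : WedgeData.{u}) (i : ℕ) (e : U.E) : Prop :=
  ∃ (m : ℕ) (hi : i ≤ m) (w : U.X (m + 2)), e = ⟨m + 2, w⟩ ∧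
    U.IsWedge i (U.d (i + 2) w) (U.d i w) w hi

variable {U : WedgeData.{u}}

/-- Out of range, `D` and `S` return their argument. Working with elements of all degrees together
avoids casts between degrees such as `m + 1 - s`. -/
theorem D_mk {m i : ℕ} (hi : i ≤ m + 1) (x : U.X (m + 1)) :
    U.D i ⟨m + 1, x⟩ = ⟨m, U.d i x hi⟩ := dif_pos hi

theorem S_mk {m i : ℕ} (hi : i ≤ m) (x : U.X m) :
    U.S i ⟨m, x⟩ = ⟨m + 1, U.s i x hi⟩ := dif_pos hi

theorem th_mk {m i : ℕ} (hi : i ≤ m) (w : U.X (m + 2)) :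
    U.Th i ⟨m + 2, w⟩ ↔ U.IsWedge i (U.d (i + 2) w) (U.d i w) w hi := by
  constructor
  · rintro ⟨m', hi', w', h, h'⟩
    cases h
    exact h'
  · intro h
    exact ⟨m, hi, w, rfl, h⟩

theorem dim_D {i : ℕ} {e : U.E} (hi : i ≤ e.1) (h : 1 ≤ e.1) : (U.D i e).1 + 1 = e.1 := by
  obtain ⟨m, x⟩ := e
  obtain ⟨k, rfl⟩ : ∃ k, m = k + 1 := ⟨m - 1, by dsimp only at h; omega⟩
  rw [D_mk hi]

theorem dim_S {i : ℕ} {e : U.E} (hi : i ≤ e.1) : (U.S i e).1 = e.1 + 1 := by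
  obtain ⟨m, x⟩ := e
  rw [S_mk hi]

theorem Th.le {i : ℕ} {e : U.E} (h : U.Th i e) : i + 2 ≤ e.1 := by
  obtain ⟨m, hi, w, rfl, -⟩ := h
  dsimp only
  omega

theorem exists_mk {e : U.E} {k : ℕ} (h : e.1 = k) : ∃ x : U.X k, e = ⟨k, x⟩ := by
  obtain ⟨m, x⟩ := e
  subst h
  exact ⟨x, rfl⟩

theorem D_D (hU : U.IsComplicial) {i j : ℕ} {e : U.E} (hij : i ≤ j) (hj : j + 1 ≤ e.1)
    (h2 : 2 ≤ e.1) : U.D i (U.D (j + 1) e) = U.D j (U.D i e) := by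
  obtain ⟨m, hm⟩ : ∃ m, e.1 = m + 2 := ⟨e.1 - 2, by omega⟩
  obtain ⟨x, rfl⟩ := exists_mk hm
  dsimp only at hj
  rw [D_mk (by omega), D_mk (by omega), D_mk (by omega), D_mk (by omega),
    hU.d_d m i j hij (by omega)]

theorem D_S_lt (hU : U.IsComplicial) {i j : ℕ} {e : U.E} (hij : i ≤ j) (hj : j + 1 ≤ e.1) :
    U.D i (U.S (j + 1) e) = U.S j (U.D i e) := by
  obtain ⟨m, hm⟩ : ∃ m, e.1 = m + 1 := ⟨e.1 - 1, by omega⟩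
  obtain ⟨x, rfl⟩ := exists_mk hm
  dsimp only at hj
  rw [S_mk (by omega), D_mk (by omega), D_mk (by omega), S_mk (by omega),
    hU.d_s_lt m i j hij (by omega)]

theorem D_S_self (hU : U.IsComplicial) {i : ℕ} {e : U.E} (hi : i ≤ e.1) :
    U.D i (U.S i e) = e := by
  obtain ⟨m, x⟩ := e
  dsimp only at hi
  rw [S_mk (by omega), D_mk (by omega), hU.d_s_self m i hi]

theorem D_S_succ (hU : U.IsComplicial) {i : ℕ} {e : U.E} (hi : i ≤ e.1) :
    U.D (i + 1) (U.S i e) = e := by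
  obtain ⟨m, x⟩ := e
  dsimp only at hi
  rw [S_mk (by omega), D_mk (by omega), hU.d_s_succ m i hi]

theorem D_S_gt (hU : U.IsComplicial) {i j : ℕ} {e : U.E} (hij : j < i) (hi : i ≤ e.1) :
    U.D (i + 1) (U.S j e) = U.S j (U.D i e) := by
  obtain ⟨m, hm⟩ : ∃ m, e.1 = m + 1 := ⟨e.1 - 1, by omega⟩
  obtain ⟨x, rfl⟩ := exists_mk hm
  dsimp only at hi
  rw [S_mk (by omega), D_mk (by omega), D_mk (by omega), S_mk (by omega),
    hU.d_s_gt m i j hij (by omega)]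

theorem IsWedge.th (hU : U.IsComplicial) {m i : ℕ} (hi : i ≤ m) {x y : U.X (m + 1)}
    {w : U.X (m + 2)} (h : U.IsWedge i x y w) : U.Th i ⟨m + 2, w⟩ := by
  rw [th_mk hi, hU.d_wedge_left m i hi x y w h, hU.d_wedge_right m i hi x y w h]
  exact h

theorem Th.D_lt (hU : U.IsComplicial) {i j : ℕ} {e : U.E} (h : U.Th (i + 1) e) (hj : j ≤ i) :
    U.Th i (U.D j e) := by
  obtain ⟨m, hi, w, rfl, h⟩ := h
  obtain ⟨k, rfl⟩ : ∃ k, m = k + 1 := ⟨m - 1, by omega⟩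
  rw [D_mk (by omega)]
  exact (hU.d_wedge_lt k i j hj (by omega) _ _ _ h).th hU (by omega)

theorem Th.D_gt (hU : U.IsComplicial) {i j : ℕ} {e : U.E} (h : U.Th i e) (hj : i + 3 ≤ j)
    (hj' : j ≤ e.1) : U.Th i (U.D j e) := by
  obtain ⟨m, hi, w, rfl, h⟩ := h
  dsimp only at hj'
  obtain ⟨k, rfl⟩ : ∃ k, m = k + 1 := ⟨m - 1, by omega⟩
  obtain ⟨l, rfl⟩ : ∃ l, j = l + 1 := ⟨j - 1, by omega⟩
  rw [D_mk (by omega)]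
  exact (hU.d_wedge_gt k i l (by omega) (by omega) _ _ _ h).th hU (by omega)

theorem exists_fill (hU : U.IsComplicial) {i : ℕ} {e e' : U.E} (hd : e.1 = e'.1)
    (hi : i + 1 ≤ e.1) (h : U.D i e = U.D (i + 1) e') :
    ∃ w : U.E, w.1 = e.1 + 1 ∧ U.Th i w ∧ U.D i w = e' ∧ U.D (i + 2) w = e := by
  obtain ⟨m, hm⟩ : ∃ m, e.1 = m + 1 := ⟨e.1 - 1, by omega⟩
  obtain ⟨x, rfl⟩ := exists_mk hm
  obtain ⟨y, rfl⟩ := exists_mk hd.symm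
  dsimp only at hi y
  rw [D_mk (by omega), D_mk (by omega)] at h
  have h' : U.d i x = U.d (i + 1) y := by
    simpa using h
  have hw : U.IsWedge i x y (U.wedge i (by omega) x y h') := ⟨h', rfl⟩
  refine ⟨⟨m + 2, U.wedge i (by omega) x y h'⟩, rfl, hw.th hU (by omega), ?_, ?_⟩
  · rw [D_mk (by omega), hU.d_wedge_right m i (by omega) _ _ _ hw]
  · rw [D_mk (by omega), hU.d_wedge_left m i (by omega) _ _ _ hw]

/-- Together with `exists_fill` this replaces the partial operation: a thin element exists, and is
unique, for each compatible pair of faces opposite `i` and `i + 2`. -/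
theorem Th.unique {i : ℕ} {w w' : U.E} (h : U.Th i w) (h' : U.Th i w')
    (h0 : U.D i w = U.D i w') (h2 : U.D (i + 2) w = U.D (i + 2) w') : w = w' := by
  obtain ⟨m, hi, x, rfl, h, hx⟩ := h
  obtain ⟨m', hi', x', rfl, h', hx'⟩ := h'
  rw [D_mk (by omega), D_mk (by omega)] at h0 h2
  have hm : m = m' := by
    have := congrArg Sigma.fst h0
    dsimp only at this
    omega
  subst hm
  have e0 : U.d i x = U.d i x' := by
    simpa using h0
  have e2 : U.d (i + 2) x = U.d (i + 2) x' := by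
    simpa using h2
  rw [← hx, ← hx']
  congr 2

/-- Here the wedge axioms begin to be restated for thin elements; the operands become faces and the
equations are absorbed by the simplicial identities. The statements are parallel to those on
vanishing matrices, here to `Van.pred`. -/
theorem Th.pred (hU : U.IsComplicial) {i : ℕ} {A : U.E} (h : U.Th (i + 1) A)
    (h' : U.Th i (U.D (i + 3) A)) : U.Th i A := by
  obtain ⟨m, hi, w, rfl, h⟩ := h
  rw [D_mk (by omega)] at h'
  obtain ⟨k, rfl⟩ : ∃ k, m = k + 1 := ⟨m - 1, by omega⟩
  rw [th_mk (by omega)] at h'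
  obtain ⟨p, -, hp⟩ := hU.wedge_form_right k i (by omega) _ _ _ _ _ h' h
  exact hp.th hU (by omega)

theorem Th.D_succ (hU : U.IsComplicial) {i : ℕ} {A : U.E} (h : U.Th i A)
    (h0 : U.Th i (U.D i A)) (h2 : U.Th i (U.D (i + 2) A)) : U.Th i (U.D (i + 1) A) := by
  obtain ⟨m, hi, w, rfl, h⟩ := h
  rw [D_mk (by omega)] at h0 h2
  have hle := h0.le
  dsimp only at hle
  obtain ⟨k, rfl⟩ : ∃ k, m = k + 1 := ⟨m - 1, by omega⟩
  rw [th_mk (by omega)] at h0 h2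
  have e : U.d i (U.d (i + 2) w) = U.d (i + 1) (U.d i w) :=
    hU.d_d (k + 1) i (i + 1) (by omega) (by omega) w
  rw [e] at h2
  obtain ⟨p, q, -, hq, hw⟩ := (hU.wedge_assoc k i (by omega) _ _ _ _).1 ⟨_, _, h0, h2, h⟩
  rw [D_mk (by omega), hU.d_wedge_right _ _ (by omega) _ _ _ hw]
  exact hq.th hU (by omega)

theorem Th.D_add_two (hU : U.IsComplicial) {i : ℕ} {A : U.E} (h : U.Th (i + 1) A)
    (h3 : U.Th i (U.D (i + 3) A)) (h1 : U.Th i (U.D (i + 1) A)) : U.Th i (U.D (i + 2) A) := by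
  obtain ⟨m, hi, w, rfl, h⟩ := h
  rw [D_mk (by omega)] at h1 h3
  obtain ⟨k, rfl⟩ : ∃ k, m = k + 1 := ⟨m - 1, by omega⟩
  rw [th_mk (by omega)] at h1 h3
  have e : U.d (i + 2) (U.d (i + 1) w) = U.d (i + 1) (U.d (i + 3) w) :=
    (hU.d_d (k + 1) (i + 1) (i + 2) (by omega) (by omega) w).symm
  rw [e] at h1
  obtain ⟨p, q, -, hq, hw⟩ := (hU.wedge_assoc k i (by omega) _ _ _ _).2 ⟨_, _, h3, h1, h⟩
  rw [D_mk (by omega), hU.d_wedge_left _ _ (by omega) _ _ _ hw]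
  exact hq.th hU (by omega)

theorem Th.interchange (hU : U.IsComplicial) {i j : ℕ} {B : U.E} (hij : i + 3 ≤ j)
    (h : U.Th j B) (h0 : U.Th i (U.D j B)) (h2 : U.Th i (U.D (j + 2) B)) : U.Th i B := by
  obtain ⟨m, hi, w, rfl, h⟩ := h
  obtain ⟨l, rfl⟩ : ∃ l, j = l + 1 := ⟨j - 1, by omega⟩
  obtain ⟨k, rfl⟩ : ∃ k, m = k + 1 := ⟨m - 1, by omega⟩
  rw [D_mk (by omega), th_mk (by omega)] at h0 h2
  obtain ⟨p, q, -, -, hw⟩ := (hU.wedge_interchange k i l (by omega) (by omega) _ _ _ _ _).1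
    ⟨_, _, h2, h0, h⟩
  exact hw.th hU (by omega)

theorem Th.interchange' (hU : U.IsComplicial) {i j : ℕ} {B : U.E} (hij : i + 2 ≤ j)
    (h : U.Th i B) (h0 : U.Th j (U.D i B)) (h2 : U.Th j (U.D (i + 2) B)) : U.Th (j + 1) B := by
  obtain ⟨m, hi, w, rfl, h⟩ := h
  rw [D_mk (by omega)] at h0 h2
  have hle := h0.le
  dsimp only at hle
  obtain ⟨k, rfl⟩ : ∃ k, m = k + 1 := ⟨m - 1, by omega⟩
  rw [th_mk (by omega)] at h0 h2
  obtain ⟨p, q, -, -, hw⟩ := (hU.wedge_interchange k i j (by omega) (by omega) _ _ _ _ _).2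
    ⟨_, _, h2, h0, h⟩
  exact hw.th hU (by omega)

theorem th_S (hU : U.IsComplicial) {i : ℕ} {e : U.E} (hi : i + 1 ≤ e.1) :
    U.Th i (U.S i e) := by
  obtain ⟨m, hm⟩ : ∃ m, e.1 = m + 1 := ⟨e.1 - 1, by omega⟩
  obtain ⟨x, rfl⟩ := exists_mk hm
  dsimp only at hi
  rw [S_mk (by omega)]
  exact (hU.s_eq_left m i (by omega) x).th hU (by omega)

theorem th_S_succ (hU : U.IsComplicial) {i : ℕ} {e : U.E} (hi : i + 1 ≤ e.1) :
    U.Th i (U.S (i + 1) e) := by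
  obtain ⟨m, hm⟩ : ∃ m, e.1 = m + 1 := ⟨e.1 - 1, by omega⟩
  obtain ⟨x, rfl⟩ := exists_mk hm
  dsimp only at hi
  rw [S_mk (by omega)]
  exact (hU.s_eq_right m i (by omega) x).th hU (by omega)

/-- The elements to which the whiskering identity applies. -/
def Whisk (U : WedgeData.{u}) (i : ℕ) (A : U.E) : Prop :=
  ∃ D₀ : U.E, U.Th (i + 1) D₀ ∧ U.Th (i + 1) (U.D (i + 3) D₀) ∧ U.Th i (U.D (i + 1) D₀) ∧
    U.D (i + 2) D₀ = A

/-- The degenerate element `s_{i+1} A` serves as `D₀`: its faces opposite `i + 1` and `i + 2` are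
both `A`, and its face opposite `i + 3` is again degenerate. For `Th.whisk'` the choice is `s_{i+2}
A`. -/
theorem Th.whisk (hU : U.IsComplicial) {i : ℕ} {A : U.E} (h : U.Th i A) (hd : i + 3 ≤ A.1) :
    U.Whisk i A := by
  have h1 := dim_D (U := U) (i := i + 2) (e := A) (by omega) (by omega)
  refine ⟨U.S (i + 1) A, th_S hU (by omega), ?_, ?_, D_S_succ hU (by omega)⟩
  · rw [D_S_gt hU (by omega) (by omega)]
    exact th_S hU (by omega)
  · rw [D_S_self hU (by omega)]
    exact h

theorem Th.whisk' (hU : U.IsComplicial) {i : ℕ} {A : U.E} (h : U.Th (i + 1) A) :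
    U.Whisk i A := by
  have hd := h.le
  have h1 := dim_D (U := U) (i := i + 1) (e := A) (by omega) (by omega)
  refine ⟨U.S (i + 2) A, th_S_succ hU (by omega), ?_, ?_, D_S_self hU (by omega)⟩
  · rwa [D_S_succ hU (by omega)]
  · rw [D_S_lt hU (by omega) (by omega)]
    exact th_S_succ hU (by omega)

theorem Th.whisker_right (hU : U.IsComplicial) {i : ℕ} {B : U.E} (h : U.Th (i + 2) B)
    (h4 : U.Th i (U.D (i + 4) B)) (hA : U.Whisk i (U.D (i + 2) B)) : U.Th i B := by
  obtain ⟨m, hi, w, rfl, h⟩ := h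
  obtain ⟨k, rfl⟩ : ∃ k, m = k + 2 := ⟨m - 2, by omega⟩
  rw [D_mk (by omega), th_mk (by omega)] at h4
  rw [D_mk (by omega)] at hA
  obtain ⟨D₀, d1, d2, d3, d4⟩ := hA
  obtain ⟨m', hi', D₀, rfl, d1⟩ := d1
  rw [D_mk (by omega)] at d2 d3 d4
  obtain rfl : m' = k + 2 := by
    have := congrArg Sigma.fst d4
    dsimp only at this
    omega
  have d4' : U.d (i + 2) D₀ = U.d (i + 2) w := by
    simpa using d4
  rw [th_mk (by omega)] at d2 d3
  have e : U.d (i + 2) (U.d (i + 1) D₀) = U.d (i + 1) (U.d (i + 3) D₀) :=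
    (hU.d_d _ (i + 1) (i + 2) (by omega) (by omega) D₀).symm
  rw [e] at d3
  have e2 : U.d (i + 2) (U.d (i + 4) w) = U.d (i + 3) (U.d (i + 2) w) :=
    hU.d_d _ (i + 2) (i + 3) (by omega) (by omega) w
  rw [e2] at h4
  obtain ⟨p, -, hp⟩ := (hU.wedge_whisker k i (by omega) _ _ _ _ _ _ d2 d3 d1 _ d4'.symm _ _).2
    ⟨_, h4, h⟩
  exact hp.th hU (by omega)

theorem Th.whisker_left (hU : U.IsComplicial) {i : ℕ} {B : U.E} (h : U.Th i B)
    (h0 : U.Th (i + 1) (U.D i B)) (hA : U.Whisk i (U.D (i + 2) B)) : U.Th (i + 2) B := by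
  obtain ⟨m, hi, w, rfl, h⟩ := h
  rw [D_mk (by omega)] at h0 hA
  obtain ⟨D₀, d1, d2, d3, d4⟩ := hA
  obtain ⟨m', hi', D₀, rfl, d1⟩ := d1
  rw [D_mk (by omega)] at d2 d3 d4
  obtain rfl : m = m' := by
    have := congrArg Sigma.fst d4
    dsimp only at this
    omega
  have hd2 := d2.le
  dsimp only at hd2
  obtain ⟨k, rfl⟩ : ∃ k, m = k + 2 := ⟨m - 2, by omega⟩
  have d4' : U.d (i + 2) D₀ = U.d (i + 2) w := by
    simpa using d4
  rw [th_mk (by omega)] at h0 d2 d3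
  have e : U.d (i + 2) (U.d (i + 1) D₀) = U.d (i + 1) (U.d (i + 3) D₀) :=
    (hU.d_d _ (i + 1) (i + 2) (by omega) (by omega) D₀).symm
  rw [e] at d3
  have e2 : U.d (i + 1) (U.d i w) = U.d i (U.d (i + 2) w) :=
    (hU.d_d _ i (i + 1) (by omega) (by omega) w).symm
  rw [e2] at h0
  obtain ⟨p, -, hp⟩ := (hU.wedge_whisker k i (by omega) _ _ _ _ _ _ d2 d3 d1 _ d4'.symm _ _).1
    ⟨_, h0, h⟩
  exact hp.th hU (by omega)

/-- `IsG j s Y X W`: the element `W` is an `s`-fold iterated wedge at place `j`, whose face opposite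
`j` is `X` and whose iterated face opposite `j + 2, …, j + s + 1` is `Y`. -/
def IsG (U : WedgeData.{u}) (j : ℕ) : ℕ → U.E → U.E → U.E → Prop
  | 0, Y, X, W => W = Y ∧ U.D j Y = X
  | s + 1, Y, X, W => U.Th j W ∧ U.D j W = X ∧ IsG U j s Y (U.D (j + 1) X) (U.D (j + 2) W)

theorem IsG.D_eq {j s : ℕ} {Y X W : U.E} (h : U.IsG j s Y X W) : U.D j W = X := by
  cases s with
  | zero => rw [h.1, h.2]
  | succ s => exact h.2.1

/-- The inner wedge is formed first, over the face of `X` opposite `j + 1`; its face opposite `j` is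
then compatible with `X`. -/
theorem exists_isG (hU : U.IsComplicial) {j s : ℕ} {Y X : U.E} (hd : Y.1 + s = X.1 + 1)
    (hj : j + s ≤ X.1) (h : U.D j Y = (U.D (j + 1))^[s] X) :
    ∃ W, W.1 = X.1 + 1 ∧ U.IsG j s Y X W := by
  induction s generalizing X with
  | zero => exact ⟨Y, hd, rfl, h⟩
  | succ s ih =>
    have hX := dim_D (U := U) (i := j + 1) (e := X) (by omega) (by omega)
    obtain ⟨W', hW', hG⟩ := ih (X := U.D (j + 1) X) (by omega) (by omega) h
    obtain ⟨W, h1, h2, h3, h4⟩ := exists_fill hU (e := W') (e' := X) (i := j) (by omega) (by omega)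
      hG.D_eq
    exact ⟨W, by omega, h2, h3, by rwa [h4]⟩

theorem IsG.unique {j s : ℕ} {Y X W W' : U.E} (h : U.IsG j s Y X W) (h' : U.IsG j s Y X W') :
    W = W' := by
  induction s generalizing X W W' with
  | zero => rw [h.1, h'.1]
  | succ s ih => exact h.1.unique h'.1 (by rw [h.2.1, h'.2.1]) (ih h.2.2 h'.2.2)

/-- This and the next three lemmas carry thinness from the ingredients of an iterated wedge at place
`j` to the result. The axiom in use depends on the position of `i` relative to `j`: interchange when
they are far apart, whiskering at distance two, `Th.pred` when adjacent. -/
theorem IsG.th_lt (hU : U.IsComplicial) {i j s : ℕ} {Y X W : U.E} (hij : i + 3 ≤ j)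
    (h : U.IsG j s Y X W) (hY : U.Th i Y) (hX : U.Th i X) : U.Th i W := by
  induction s generalizing X W with
  | zero => rwa [h.1]
  | succ s ih =>
    obtain ⟨h1, h2, h3⟩ := h
    have hd := h1.le
    have hW := dim_D (U := U) (i := j) (e := W) (by omega) (by omega)
    rw [h2] at hW
    exact h1.interchange hU hij (by rwa [h2]) (ih h3 (hX.D_gt hU (by omega) (by omega)))

theorem IsG.th_pred (hU : U.IsComplicial) {i s : ℕ} {Y X W : U.E}
    (h : U.IsG (i + 1) s Y X W) (hY : U.Th i Y) : U.Th i W := by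
  induction s generalizing X W with
  | zero => rwa [h.1]
  | succ s ih => exact h.1.pred hU (ih h.2.2)

theorem IsG.th_whisk (hU : U.IsComplicial) {i s : ℕ} {Y X W : U.E}
    (h : U.IsG (i + 2) s Y X W) (hY : U.Th i Y)
    (hX : ∀ q < s, U.Whisk i ((U.D (i + 3))^[q] X)) : U.Th i W := by
  induction s generalizing X W with
  | zero => rwa [h.1]
  | succ s ih =>
    refine h.1.whisker_right hU (ih h.2.2 fun q hq => hX (q + 1) (by omega)) ?_
    rw [h.2.1]
    exact hX 0 (by omega)

/-- Passing to an inner wedge deletes a vertex below `i + 1` and lowers the place by one, by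
interchange. If `i` comes down to `j` before the wedges are exhausted, whiskering ends the argument
and `Y` need not be thin; otherwise `Y` is reached at place `i + 1 - s`. -/
theorem IsG.th_succ (hU : U.IsComplicial) {i j s : ℕ} {Y X W : U.E} (hij : j + 1 ≤ i)
    (h : U.IsG j s Y X W) (hX : U.Th i X) (hY : j + s ≤ i → U.Th (i + 1 - s) Y) :
    U.Th (i + 1) W := by
  induction s generalizing X W i with
  | zero =>
    rw [h.1]
    exact hY (by omega)
  | succ s ih =>
    obtain ⟨h1, h2, h3⟩ := h
    have hd := hX.le
    have hd1 := h1.le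
    have hW := dim_D (U := U) (i := j) (e := W) (by omega) (by omega)
    have hW' := dim_D (U := U) (i := j + 2) (e := W) (by omega) (by omega)
    rw [h2] at hW
    obtain ⟨i, rfl⟩ : ∃ k, i = k + 1 := ⟨i - 1, by omega⟩
    obtain h | rfl : j + 1 ≤ i ∨ i = j := by omega
    · refine h1.interchange' hU (by omega) (by rwa [h2]) ?_
      refine ih h h3 (hX.D_lt hU (by omega)) fun h' => ?_
      have := hY (by omega)
      rwa [show i + 1 + 1 - (s + 1) = i + 1 - s by omega] at this
    · refine h1.whisker_left hU (by rwa [h2]) ?_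
      cases s with
      | zero =>
        rw [h3.1]
        exact (hY (by omega)).whisk' hU
      | succ s => exact h3.1.whisk hU (by omega)

/-- The last degeneracy is thin at `d`, with faces `s_d d_d e` and `e` opposite `d` and `d + 2`.
Induction on the dimension makes the former thin at `i` when `i` is far from `d`; when `i` is near,
degeneracies are thin for other reasons. -/
theorem Th.S_last (hU : U.IsComplicial) {i : ℕ} {e : U.E} (h : U.Th i e) :
    U.Th i (U.S e.1 e) := by
  obtain ⟨d, hd⟩ : ∃ d, e.1 = d := ⟨_, rfl⟩
  rw [hd]
  induction d generalizing e with
  | zero => have := h.le; omega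
  | succ d ih =>
    have hle := h.le
    have h1 : U.Th d (U.S (d + 1) e) := th_S_succ hU (by omega)
    have h2 : U.D (d + 2) (U.S (d + 1) e) = e := D_S_succ hU (by omega)
    have h3 : U.D d (U.S (d + 1) e) = U.S d (U.D d e) := D_S_lt hU le_rfl (by omega)
    have h4 := dim_D (U := U) (i := d) (e := e) (by omega) (by omega)
    obtain h5 | rfl | rfl : i + 3 ≤ d ∨ d = i + 2 ∨ d = i + 1 := by omega
    · refine h1.interchange hU h5 ?_ (by rwa [h2])
      rw [h3]
      exact ih (h.D_gt hU (by omega) (by omega)) (by omega)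
    · refine h1.whisker_right hU (by rwa [h2]) (Th.whisk' hU ?_)
      rw [h3]
      exact th_S_succ hU (by omega)
    · exact h1.pred hU (by rwa [h2])

end WedgeData

end

/-! ### Consequences of nonnegativity: vertices sent to `n`, and the dependence condition -/

noncomputable section

namespace Oriental

theorem sgn_erase_lt {b : Finset ℕ} {u v : ℕ} (h : u < v) (hu : u ∈ b) :
    sgn (b.erase u) v = - sgn b v := by
  conv_rhs => rw [← Finset.insert_erase hu]
  rw [sgn_insert_lt h (Finset.notMem_erase u b), neg_neg]

theorem sgn_erase_gt {b : Finset ℕ} {u v : ℕ} (h : v ≤ u) :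
    sgn (b.erase u) v = sgn b v := by
  by_cases hu : u ∈ b
  · conv_rhs => rw [← Finset.insert_erase hu]
    rw [sgn_insert_gt h]
  · rw [Finset.erase_eq_of_notMem hu]

theorem sgn_eq_of_forall_lt {b : Finset ℕ} {v : ℕ} (h : ∀ u ∈ b, u < v) :
    sgn b v = (-1) ^ b.card := by
  unfold sgn
  rw [Finset.filter_true_of_mem h]

theorem sgn_empty (v : ℕ) : sgn ∅ v = 1 := by simp [sgn]

theorem sgn_singleton {u v : ℕ} (h : v ≤ u) : sgn {u} v = 1 := by
  unfold sgn
  rw [Finset.filter_singleton, if_neg (by omega)]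
  simp

theorem sum_sum_eq_zero_of_antisymm {S : Finset ℕ} {g : ℕ → ℕ → ℤ}
    (h : ∀ u ∈ S, ∀ v ∈ S, g u v = - g v u) : ∑ u ∈ S, ∑ v ∈ S, g u v = 0 := by
  have h1 : ∑ u ∈ S, ∑ v ∈ S, g u v = - ∑ u ∈ S, ∑ v ∈ S, g u v := by
    conv_rhs => rw [Finset.sum_comm]
    simp only [← Finset.sum_neg_distrib]
    exact Finset.sum_congr rfl fun u hu => Finset.sum_congr rfl fun v hv => h u hu v hv
  omega

theorem bd_bd (N : ℕ) (c : Finset ℕ → ℤ) (b : Finset ℕ) : bd N (bd N c) b = 0 := by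
  have e : bd N (bd N c) b = ∑ u ∈ Finset.range N \ b, ∑ v ∈ Finset.range N \ b,
      if u = v then 0 else sgn b u * (sgn (insert u b) v * c (insert v (insert u b))) := by
    unfold bd
    refine Finset.sum_congr rfl fun u hu => ?_
    rw [Finset.mul_sum]
    have hs : Finset.range N \ insert u b = (Finset.range N \ b).erase u := by
      ext v
      simp only [Finset.mem_sdiff, Finset.mem_insert, Finset.mem_erase]
      tauto
    rw [hs, ← Finset.add_sum_erase _ _ hu, if_pos rfl, zero_add]
    exact Finset.sum_congr rfl fun v hv => by
      rw [if_neg (Finset.ne_of_mem_erase hv).symm]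
  rw [e]
  refine sum_sum_eq_zero_of_antisymm fun u hu v hv => ?_
  have hu' := (Finset.mem_sdiff.1 hu).2
  have hv' := (Finset.mem_sdiff.1 hv).2
  rw [Finset.insert_comm]
  rcases lt_trichotomy u v with h | h | h
  · rw [if_neg h.ne, if_neg h.ne', sgn_insert_lt h hu', sgn_insert_gt h.le]
    ring
  · rw [if_pos h, if_pos h.symm, neg_zero]
  · rw [if_neg h.ne', if_neg h.ne, sgn_insert_lt h hv', sgn_insert_gt h.le]
    ring

theorem alt_alt (x : Mat) (a b : Finset ℕ) : alt (alt x) a b = 0 := by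
  have e : alt (alt x) a b = ∑ u ∈ a, ∑ v ∈ a,
      if u = v then 0 else sgn a u * (sgn (a.erase u) v * x ((a.erase u).erase v) b) := by
    unfold alt
    refine Finset.sum_congr rfl fun u hu => ?_
    rw [Finset.mul_sum, ← Finset.add_sum_erase _ _ hu, if_pos rfl, zero_add]
    exact Finset.sum_congr rfl fun v hv => by
      rw [if_neg (Finset.ne_of_mem_erase hv).symm]
  rw [e]
  refine sum_sum_eq_zero_of_antisymm fun u hu v hv => ?_
  rw [Finset.erase_right_comm]
  rcases lt_trichotomy u v with h | h | h
  · rw [if_neg h.ne, if_neg h.ne', sgn_erase_lt h hu, sgn_erase_gt h.le]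
    ring
  · rw [if_pos h, if_pos h.symm, neg_zero]
  · rw [if_neg h.ne', if_neg h.ne, sgn_erase_lt h hv, sgn_erase_gt h.le]
    ring

theorem bd_alt (N : ℕ) (x : Mat) (a b : Finset ℕ) :
    bd N (alt x a) b = alt (fun a' => bd N (x a')) a b := by
  unfold bd alt
  simp only [Finset.mul_sum]
  rw [Finset.sum_comm]
  exact Finset.sum_congr rfl fun v _ => Finset.sum_congr rfl fun u _ => by ring

theorem bd_add (N : ℕ) (c d : Finset ℕ → ℤ) (b : Finset ℕ) :
    bd N (fun b => c b + d b) b = bd N c b + bd N d b := by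
  unfold bd
  rw [← Finset.sum_add_distrib]
  exact Finset.sum_congr rfl fun v _ => by ring

theorem bd_sub (N : ℕ) (c d : Finset ℕ → ℤ) (b : Finset ℕ) :
    bd N (fun b => c b - d b) b = bd N c b - bd N d b := by
  unfold bd
  rw [← Finset.sum_sub_distrib]
  exact Finset.sum_congr rfl fun v _ => by ring

theorem bd_congr {N : ℕ} {c d : Finset ℕ → ℤ} {b : Finset ℕ}
    (h : ∀ v < N, v ∉ b → c (insert v b) = d (insert v b)) : bd N c b = bd N d b :=
  Finset.sum_congr rfl fun v hv => by
    obtain ⟨h1, h2⟩ := Finset.mem_sdiff.1 hv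
    rw [h v (Finset.mem_range.1 h1) h2]

/-- The parts of the boundary of a chain on the simplexes with greatest vertex `n`. -/
theorem bd_insert_top (n : ℕ) (c : Finset ℕ → ℤ) (b : Finset ℕ) :
    bd (n + 1) c (insert n b) = bd n (fun b => c (insert n b)) b := by
  unfold bd
  have hs : Finset.range (n + 1) \ insert n b = Finset.range n \ b := by
    ext v
    simp only [Finset.mem_sdiff, Finset.mem_insert, Finset.mem_range]
    constructor
    · rintro ⟨h1, h2⟩
      exact ⟨by omega, by tauto⟩
    · rintro ⟨h1, h2⟩
      exact ⟨by omega, by rintro (h | h) <;> [omega; exact h2 h]⟩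
  rw [hs]
  refine Finset.sum_congr rfl fun v hv => ?_
  have := Finset.mem_range.1 (Finset.mem_sdiff.1 hv).1
  rw [sgn_insert_gt this.le, Finset.insert_comm]

/-- A cycle with nonnegative coefficients in positive dimension is zero. -/
theorem eq_zero_of_bd_eq_zero {N q : ℕ} {c : Finset ℕ → ℤ} (h0 : ∀ b, 0 ≤ c b)
    (hs : ∀ b, c b ≠ 0 → b ⊆ Finset.range N) (hq : ∀ b, c b ≠ 0 → b.card = q + 1)
    (hb : ∀ b, bd N c b = 0) (b : Finset ℕ) : c b = 0 := by
  induction N generalizing q c b with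
  | zero =>
    by_contra h
    have h1 := hs b h
    have h2 := hq b h
    rw [Finset.range_zero, Finset.subset_empty] at h1
    subst h1
    simp at h2
  | succ N ih =>
    -- The simplexes with greatest vertex `N`, with `N` removed, form again a nonnegative cycle on
    -- fewer vertices and of one degree less. In degree zero the cycle condition at `∅` says that
    -- nonnegative coefficients sum to zero.
    have htop : ∀ b, N ∉ b → c (insert N b) = 0 := by
      intro b hNb
      cases q with
      | zero =>
        by_contra h
        have h1 := hq _ h
        rw [Finset.card_insert_of_notMem hNb] at h1
        have h2 : b = ∅ := Finset.card_eq_zero.1 (by omega)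
        subst h2
        have h3 := hb ∅
        unfold bd at h3
        rw [Finset.sum_eq_zero_iff_of_nonneg] at h3
        · have := h3 N (by simp)
          simp [sgn_ne_zero] at this
          exact h (by simpa using this)
        · intro v hv
          simp [sgn, h0]
      | succ q =>
        have := ih (q := q) (c := fun b => if N ∈ b then 0 else c (insert N b))
          (fun b => by split_ifs <;> simp [h0]) ?_ ?_ ?_ b
        · simpa [hNb] using this
        · intro b h
          split_ifs at h with h'
          · exact absurd rfl h
          · intro v hv
            have := Finset.mem_range.1 (hs _ h (Finset.mem_insert_of_mem hv))
            have : v ≠ N := fun e => h' (e ▸ hv)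
            exact Finset.mem_range.2 (by omega)
        · intro b h
          split_ifs at h with h'
          · exact absurd rfl h
          · have := hq _ h
            rw [Finset.card_insert_of_notMem h'] at this
            omega
        · intro b
          by_cases h' : N ∈ b
          · exact Finset.sum_eq_zero fun v _ => by simp [h']
          · rw [← hb (insert N b), bd_insert_top]
            refine bd_congr fun v hv _ => ?_
            rw [if_neg]
            rw [Finset.mem_insert]
            rintro (h | h) <;> [omega; exact h' h]
    have htop' : ∀ b, N ∈ b → c b = 0 := fun b h => by
      have := htop (b.erase N) (Finset.notMem_erase N b)
      rwa [Finset.insert_erase h] at this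
    refine ih h0 (fun b h => ?_) hq (fun b => ?_) b
    · intro v hv
      have := Finset.mem_range.1 (hs _ h hv)
      have : v ≠ N := fun e => h (htop' b (e ▸ hv))
      exact Finset.mem_range.2 (by omega)
    · rw [← hb b]
      unfold bd
      refine Finset.sum_subset (fun v hv => ?_) fun v hv hv' => ?_
      · simp only [Finset.mem_sdiff, Finset.mem_range] at hv ⊢
        exact ⟨by omega, hv.2⟩
      · simp only [Finset.mem_sdiff, Finset.mem_range] at hv hv'
        have : v = N := by
          by_contra hne
          exact hv' ⟨by omega, hv.2⟩
        rw [htop' _ (by rw [this]; exact Finset.mem_insert_self N b), mul_zero]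

/-- The matrices of elements of `Or(m, n)` that send the vertices from `p` onwards, and no
others, to `n`. -/
structure Cls (n m p : ℕ) (x : Mat) : Prop extends IsO n m x where
  le : p ≤ m + 1
  vertex : ∀ v ≤ m, x {v} {n} = if p ≤ v then 1 else 0

theorem IsO.sum_vertex {n m : ℕ} {x : Mat} (hx : IsO n m x) {v : ℕ} (hv : v ≤ m) :
    ∑ u ∈ Finset.range (n + 1), x {v} {u} = 1 := by
  have h := hx.chain {v} (by simpa using Nat.lt_succ_of_le hv) ∅
  unfold bd alt at h
  simpa [sgn_singleton, sgn_empty, hx.empty] using h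

/-- The coefficient of `n` in the image of a vertex is zero or one, as nonnegative coefficients sum
to one. It does not decrease with the vertex: in the boundary of the image of the edge from `v` to
`v + 1` the vertex `n` is always a target, so its coefficient is nonnegative. -/
theorem exists_cls {n m : ℕ} {x : Mat} (hx : IsO n m x) : ∃ p, Cls n m p x := by
  have hle : ∀ v ≤ m, x {v} {n} ≤ 1 := by
    intro v hv
    rw [← hx.sum_vertex hv]
    exact Finset.single_le_sum (f := fun u => x {v} {u}) (fun u _ => hx.nonneg _ _) (by simp)
  have hmono : ∀ v, v + 1 ≤ m → x {v} {n} ≤ x {v + 1} {n} := by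
    intro v hv
    have h := hx.chain {v, v + 1} (by
      intro u hu
      simp only [Finset.mem_insert, Finset.mem_singleton] at hu
      exact Finset.mem_range.2 (by omega)) {n}
    have h1 : alt x {v, v + 1} {n} = x {v + 1} {n} - x {v} {n} := by
      unfold alt
      rw [Finset.sum_pair (by omega)]
      have e1 : ({v, v + 1} : Finset ℕ).erase v = {v + 1} := by
        ext u; simp only [Finset.mem_erase, Finset.mem_insert, Finset.mem_singleton]; omega
      have e2 : ({v, v + 1} : Finset ℕ).erase (v + 1) = {v} := by
        ext u; simp only [Finset.mem_erase, Finset.mem_insert, Finset.mem_singleton]; omega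
      have e3 : sgn {v, v + 1} v = 1 := by
        rw [sgn_insert_self, sgn_singleton (by omega)]
      have e4 : sgn {v, v + 1} (v + 1) = -1 := by
        rw [sgn_insert_lt (by omega) (by simp), sgn_singleton le_rfl]
      rw [e1, e2, e3, e4]
      ring
    have h2 : 0 ≤ bd (n + 1) (x {v, v + 1}) {n} := by
      refine Finset.sum_nonneg fun u hu => ?_
      simp only [Finset.mem_sdiff, Finset.mem_range, Finset.mem_singleton] at hu
      have : sgn {n} u = 1 := by
        exact sgn_singleton (by omega)
      rw [this, one_mul]
      exact hx.nonneg _ _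
    omega
  have key : ∀ k ≤ m + 1, ∃ p ≤ k, ∀ v < k, x {v} {n} = if p ≤ v then 1 else 0 := by
    intro k
    induction k with
    | zero => exact fun _ => ⟨0, le_rfl, fun v hv => by omega⟩
    | succ k ih =>
      intro hk
      obtain ⟨p, hp, h⟩ := ih (by omega)
      have h0 := hx.nonneg {k} {n}
      have h1 := hle k (by omega)
      by_cases hpk : p < k
      · refine ⟨p, by omega, fun v hv => ?_⟩
        obtain hv | rfl : v < k ∨ v = k := by omega
        · exact h v hv
        · have h2 := h (v - 1) (by omega)
          have h3 := hmono (v - 1) (by omega)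
          rw [if_pos (by omega)] at h2
          rw [show v - 1 + 1 = v by omega] at h3
          rw [if_pos hpk.le]
          omega
      · obtain rfl : p = k := by omega
        obtain h2 | h2 : x {p} {n} = 0 ∨ x {p} {n} = 1 := by omega
        · refine ⟨p + 1, le_rfl, fun v hv => ?_⟩
          rw [if_neg (by omega)]
          obtain hv | rfl : v < p ∨ v = p := by omega
          · rw [h v hv, if_neg (by omega)]
          · exact h2
        · refine ⟨p, by omega, fun v hv => ?_⟩
          obtain hv | rfl : v < p ∨ v = p := by omega
          · exact h v hv
          · rw [h2, if_pos le_rfl]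
  obtain ⟨p, hp, h⟩ := key (m + 1) le_rfl
  exact ⟨p, hx, hp, fun v hv => h v (by omega)⟩

theorem Cls.unique {n m p q : ℕ} {x : Mat} (h : Cls n m p x) (h' : Cls n m q x) : p = q := by
  by_contra hne
  wlog hpq : p < q generalizing p q
  · exact this h' h (Ne.symm hne) (by omega)
  have h1 := h.vertex p (by have := h'.le; omega)
  have h2 := h'.vertex p (by have := h'.le; omega)
  rw [if_pos le_rfl] at h1
  rw [if_neg (by omega)] at h2
  omega

theorem IsO.le_of_ne {n m : ℕ} {x : Mat} (hx : IsO n m x) {a b : Finset ℕ} (h : x a b ≠ 0)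
    {v : ℕ} (hv : v ∈ a) : v ≤ m := (hx.subset_of_ne h).1 v hv

/-- By induction on dimension no proper face of `a` involves `n`. So the terms of `x a` that contain
`n`, with `n` removed, form a nonnegative cycle. -/
theorem Cls.eq_zero_of_lt {n m p : ℕ} {x : Mat} (h : Cls n m p x) {a : Finset ℕ}
    (ha : ∀ v ∈ a, v < p) {b : Finset ℕ} (hb : n ∈ b) : x a b = 0 := by
  induction hk : a.card generalizing a b with
  | zero =>
    rw [Finset.card_eq_zero.1 hk, h.empty, if_neg (Finset.ne_empty_of_mem hb)]
  | succ k ih =>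
    by_cases ham : a ⊆ Finset.range (m + 1)
    swap
    · by_contra hne
      exact ham (h.supp_left _ _ hne)
    cases k with
    | zero =>
      obtain ⟨v, rfl⟩ := Finset.card_eq_one.1 hk
      by_contra hne
      obtain ⟨u, rfl⟩ := Finset.card_eq_one.1 (h.card_eq _ _ hne)
      obtain rfl := Finset.mem_singleton.1 hb
      have h1 := ha v (by simp)
      have h2 := h.le
      rw [h.vertex v (by omega), if_neg (by omega)] at hne
      exact hne rfl
    | succ k =>
      have hc := eq_zero_of_bd_eq_zero (N := n) (q := k)
        (c := fun b => if n ∈ b then 0 else x a (insert n b)) ?_ ?_ ?_ ?_ (b.erase n)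
      · simpa [Finset.insert_erase hb] using hc
      · intro b
        split_ifs
        · exact le_rfl
        · exact h.nonneg _ _
      · intro b hne
        split_ifs at hne with h'
        · exact absurd rfl hne
        · intro v hv
          have := (h.subset_of_ne hne).2 v (Finset.mem_insert_of_mem hv)
          have : v ≠ n := fun e => h' (e ▸ hv)
          exact Finset.mem_range.2 (by omega)
      · intro b hne
        split_ifs at hne with h'
        · exact absurd rfl hne
        · have := h.card_eq _ _ hne
          rw [Finset.card_insert_of_notMem h'] at this
          omega
      · intro b
        by_cases h' : n ∈ b
        · exact Finset.sum_eq_zero fun v _ => by simp [h']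
        · have h1 : alt x a (insert n b) = 0 := Finset.sum_eq_zero fun v hv => by
            rw [ih (fun u hu => ha u (Finset.mem_of_mem_erase hu)) (Finset.mem_insert_self n b)
              (by rw [Finset.card_erase_of_mem hv]; omega), mul_zero]
          rw [← h1, ← h.chain a ham, bd_insert_top]
          refine bd_congr fun v hv _ => ?_
          rw [if_neg]
          rw [Finset.mem_insert]
          rintro (h | h) <;> [omega; exact h' h]

theorem Cls.vertex_eq {n m p : ℕ} {x : Mat} (h : Cls n m p x) {v : ℕ} (hpv : p ≤ v) (hv : v ≤ m)
    (b : Finset ℕ) : x {v} b = if b = {n} then 1 else 0 := by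
  have h1 := h.vertex v hv
  rw [if_pos hpv] at h1
  split_ifs with hb
  · rw [hb, h1]
  · by_contra hne
    obtain ⟨u, rfl⟩ := Finset.card_eq_one.1 (h.card_eq _ _ hne)
    have hun : u ≠ n := fun e => hb (by rw [e])
    have hle := (h.subset_of_ne hne).2 u (by simp)
    have h2 := h.sum_vertex hv
    have h3 : ∑ w ∈ ({n, u} : Finset ℕ), x {v} {w} ≤ 1 := by
      rw [← h2]
      refine Finset.sum_le_sum_of_subset_of_nonneg ?_ fun _ _ _ => h.nonneg _ _
      intro w hw
      simp only [Finset.mem_insert, Finset.mem_singleton] at hw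
      exact Finset.mem_range.2 (by omega)
    rw [Finset.sum_pair hun.symm, h1] at h3
    have := h.nonneg {v} {u}
    omega

/-- All the vertices go to `n`, so the image of an edge is a nonnegative cycle, hence zero; then the
same holds in each higher dimension in turn. -/
theorem Cls.eq_zero_of_ge {n m p : ℕ} {x : Mat} (h : Cls n m p x) {a : Finset ℕ}
    (ha : ∀ v ∈ a, p ≤ v) (hc : 2 ≤ a.card) (b : Finset ℕ) : x a b = 0 := by
  obtain ⟨k, hk⟩ : ∃ k, a.card = k + 2 := ⟨a.card - 2, by omega⟩
  induction k generalizing a b with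
  | zero =>
    by_cases ham : a ⊆ Finset.range (m + 1)
    swap
    · by_contra hne
      exact ham (h.supp_left _ _ hne)
    refine eq_zero_of_bd_eq_zero (q := 1) (h.nonneg a) (h.supp_right a)
      (fun b hb => by rw [h.card_eq _ _ hb, hk]) (fun b => ?_) b
    rw [h.chain a ham]
    obtain ⟨u, v, huv, rfl⟩ := Finset.card_eq_two.1 hk
    wlog hlt : u < v generalizing u v
    · rw [Finset.pair_comm]
      rw [Finset.pair_comm] at ha hc hk ham
      exact this v u huv.symm ha hc hk ham (by omega)
    have hu := Finset.mem_range.1 (ham (Finset.mem_insert_self u _))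
    have hv := Finset.mem_range.1 (ham (Finset.mem_insert_of_mem (Finset.mem_singleton_self v)))
    have hpu := ha u (by simp)
    have hpv := ha v (by simp)
    unfold alt
    rw [Finset.sum_pair huv]
    have e1 : ({u, v} : Finset ℕ).erase u = {v} := by
      rw [Finset.erase_insert (by simpa using huv)]
    have e2 : ({u, v} : Finset ℕ).erase v = {u} := by
      rw [Finset.pair_comm, Finset.erase_insert (by simpa using huv.symm)]
    have e3 : sgn {u, v} u = - sgn {u, v} v := by
      rw [sgn_insert_self, sgn_insert_lt hlt (by simpa using huv)]
      rw [sgn_singleton hlt.le, sgn_singleton le_rfl, neg_neg]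
    rw [e1, e2, e3, h.vertex_eq hpu (by omega), h.vertex_eq hpv (by omega)]
    ring
  | succ k ih =>
    by_cases ham : a ⊆ Finset.range (m + 1)
    swap
    · by_contra hne
      exact ham (h.supp_left _ _ hne)
    refine eq_zero_of_bd_eq_zero (q := k + 2) (h.nonneg a) (h.supp_right a)
      (fun b hb => by rw [h.card_eq _ _ hb, hk]) (fun b => ?_) b
    rw [h.chain a ham]
    refine Finset.sum_eq_zero fun v hv => ?_
    have hcard : (a.erase v).card = k + 2 := by rw [Finset.card_erase_of_mem hv]; omega
    rw [ih (fun u hu => ha u (Finset.mem_of_mem_erase hu)) (by omega) _ hcard, mul_zero]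

open Classical in
/-- The part of a matrix that consists of the simplexes in the join of `n` in the values on the
simplexes with vertices at most `p`. -/
def topPart (n p : ℕ) (x : Mat) : Mat := fun a b =>
  if n ∈ b ∧ ∀ v ∈ a, v ≤ p then x a b else 0

open Classical in
/-- The part of a matrix complementary to `topPart`. -/
def botPart (n p : ℕ) (x : Mat) : Mat := fun a b =>
  if n ∈ b ∧ ∀ v ∈ a, v ≤ p then 0 else x a b

open Classical in
/-- The discrepancy between `botPart` and a chain map. -/
def defect (n p : ℕ) (x : Mat) : Mat := fun a b =>
  if ∀ v ∈ a, v ≤ p then (if n ∈ b then 0 else x a (insert n b))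
    else ∑ v ∈ a, if p < v then topPart n p x (a.erase v) b else 0

/-- `botPart` vanishes on the simplexes that contain `p` and some vertex in `[f, p)`. -/
def Dep (n p f : ℕ) (x : Mat) : Prop :=
  ∀ a, p ∈ a → (∃ v ∈ a, f ≤ v ∧ v < p) → ∀ b, botPart n p x a b = 0

theorem top_add_bot (n p : ℕ) (x : Mat) (a b : Finset ℕ) :
    topPart n p x a b + botPart n p x a b = x a b := by
  unfold topPart botPart
  split_ifs <;> ring

theorem IsO.topPart_nonneg {n m : ℕ} {x : Mat} (hx : IsO n m x) (p : ℕ) (a b : Finset ℕ) :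
    0 ≤ topPart n p x a b := by
  unfold topPart
  split_ifs
  · exact hx.nonneg _ _
  · exact le_rfl

theorem IsO.botPart_nonneg {n m : ℕ} {x : Mat} (hx : IsO n m x) (p : ℕ) (a b : Finset ℕ) :
    0 ≤ botPart n p x a b := by
  unfold botPart
  split_ifs
  · exact le_rfl
  · exact hx.nonneg _ _

theorem topPart_eq_zero {n p : ℕ} {x : Mat} {a b : Finset ℕ} (h : x a b = 0) :
    topPart n p x a b = 0 := by
  unfold topPart
  rw [h, ite_self]

theorem botPart_eq_zero {n p : ℕ} {x : Mat} {a b : Finset ℕ} (h : x a b = 0) :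
    botPart n p x a b = 0 := by
  unfold botPart
  rw [h, ite_self]

theorem topPart_of_lt {n p : ℕ} {x : Mat} {a : Finset ℕ} {v : ℕ} (hv : v ∈ a) (h : p < v)
    (b : Finset ℕ) : topPart n p x a b = 0 := by
  unfold topPart
  rw [if_neg]
  rintro ⟨-, h'⟩
  have := h' v hv
  omega

theorem botPart_of_lt {n p : ℕ} {x : Mat} {a : Finset ℕ} {v : ℕ} (hv : v ∈ a) (h : p < v)
    (b : Finset ℕ) : botPart n p x a b = x a b := by
  rw [← top_add_bot n p x, topPart_of_lt hv h, zero_add]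

theorem Cls.topPart_eq_zero {n m p : ℕ} {x : Mat} (h : Cls n m p x) {a : Finset ℕ} (ha : p ∉ a)
    (b : Finset ℕ) : topPart n p x a b = 0 := by
  unfold topPart
  split_ifs with h'
  · refine h.eq_zero_of_lt (fun v hv => lt_of_le_of_ne (h'.2 v hv) ?_) h'.1
    rintro rfl
    exact ha hv
  · rfl

theorem Cls.botPart_eq {n m p : ℕ} {x : Mat} (h : Cls n m p x) {a : Finset ℕ} (ha : p ∉ a)
    (b : Finset ℕ) : botPart n p x a b = x a b := by
  rw [← top_add_bot n p x, h.topPart_eq_zero ha, zero_add]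

theorem IsO.defect_nonneg {n m : ℕ} {x : Mat} (hx : IsO n m x) (p : ℕ) (a b : Finset ℕ) :
    0 ≤ defect n p x a b := by
  unfold defect
  split_ifs
  · exact le_rfl
  · exact hx.nonneg _ _
  · refine Finset.sum_nonneg fun v _ => ?_
    split_ifs
    · exact hx.topPart_nonneg p _ _
    · exact le_rfl

theorem defect_eq_zero {n p : ℕ} {x : Mat} {a : Finset ℕ} (h : ∀ b, x a b = 0)
    (h' : ∀ v ∈ a, p < v → ∀ b, topPart n p x (a.erase v) b = 0) (b : Finset ℕ) :
    defect n p x a b = 0 := by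
  unfold defect
  split_ifs
  · rfl
  · exact h _
  · refine Finset.sum_eq_zero fun v hv => ?_
    split_ifs with hv'
    · exact h' v hv hv' b
    · rfl

theorem defect_eq_zero_of_two {n p : ℕ} {x : Mat} {a : Finset ℕ} {u v : ℕ} (hu : u ∈ a)
    (hv : v ∈ a) (huv : u < v) (hpu : p < u) (b : Finset ℕ) : defect n p x a b = 0 := by
  unfold defect
  rw [if_neg]
  · refine Finset.sum_eq_zero fun w hw => ?_
    split_ifs with hw'
    · by_cases h : w = u
      · exact topPart_of_lt (Finset.mem_erase.2 ⟨by omega, hv⟩) (by omega) _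
      · exact topPart_of_lt (Finset.mem_erase.2 ⟨Ne.symm h, hu⟩) (by omega) _
    · rfl
  · intro h
    have := h u hu
    omega

/-- Since `x` is a chain map, the failure for `botPart` is the opposite of that for `topPart`. If
`a` has no vertex beyond `p`, the failure comes from boundary terms that drop `n`. Otherwise it
comes from faces that drop the only vertex beyond `p`. In both cases the dropped vertex is last, so
the sign is that of `p` in `a`; the point is that `defect` is nonnegative. -/
theorem IsO.alt_botPart_sub {n m p : ℕ} {x : Mat} (hx : IsO n m x) {a : Finset ℕ}
    (ha : a ⊆ Finset.range (m + 1)) (hp : p ∈ a) (b : Finset ℕ) :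
    alt (botPart n p x) a b - bd (n + 1) (botPart n p x a) b = sgn a p * defect n p x a b := by
  have h1 : alt (botPart n p x) a b = alt x a b - alt (topPart n p x) a b := by
    unfold alt
    rw [← Finset.sum_sub_distrib]
    exact Finset.sum_congr rfl fun v _ => by rw [← top_add_bot n p x]; ring
  have h2 : bd (n + 1) (botPart n p x a) b = bd (n + 1) (x a) b - bd (n + 1) (topPart n p x a) b := by
    unfold bd
    rw [← Finset.sum_sub_distrib]
    exact Finset.sum_congr rfl fun v _ => by rw [← top_add_bot n p x]; ring
  rw [h1, h2, hx.chain a ha b]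
  by_cases hlow : ∀ v ∈ a, v ≤ p
  · have htop : ∀ a' ⊆ a, ∀ b, topPart n p x a' b = if n ∈ b then x a' b else 0 := by
      intro a' ha' b
      unfold topPart
      have : ∀ v ∈ a', v ≤ p := fun v hv => hlow v (ha' hv)
      by_cases hn : n ∈ b
      · rw [if_pos ⟨hn, this⟩, if_pos hn]
      · rw [if_neg (fun h => hn h.1), if_neg hn]
    unfold defect
    rw [if_pos hlow]
    by_cases hn : n ∈ b
    · rw [if_pos hn]
      have h3 : alt (topPart n p x) a b = alt x a b := Finset.sum_congr rfl fun v _ => by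
        rw [htop _ (Finset.erase_subset v a), if_pos hn]
      have h4 : bd (n + 1) (topPart n p x a) b = bd (n + 1) (x a) b := bd_congr fun v _ _ => by
        rw [htop _ subset_rfl, if_pos (Finset.mem_insert_of_mem hn)]
      rw [h3, h4, hx.chain a ha b]
      ring
    · rw [if_neg hn]
      have h3 : alt (topPart n p x) a b = 0 := Finset.sum_eq_zero fun v _ => by
        rw [htop _ (Finset.erase_subset v a), if_neg hn, mul_zero]
      have h4 : bd (n + 1) (topPart n p x a) b = sgn b n * x a (insert n b) := by
        unfold bd
        rw [Finset.sum_eq_single n]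
        · rw [htop _ subset_rfl, if_pos (Finset.mem_insert_self n b)]
        · intro v _ hv
          rw [htop _ subset_rfl, if_neg, mul_zero]
          rw [Finset.mem_insert]
          rintro (h | h)
          · exact hv h.symm
          · exact hn h
        · intro h
          exact absurd (Finset.mem_sdiff.2 ⟨Finset.self_mem_range_succ n, hn⟩) h
      rw [h3, h4]
      by_cases hx0 : x a (insert n b) = 0
      · rw [hx0]; ring
      have hc := hx.card_eq _ _ hx0
      rw [Finset.card_insert_of_notMem hn] at hc
      have hs1 : sgn b n = (-1) ^ b.card := sgn_eq_of_forall_lt fun u hu => by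
        have := (hx.subset_of_ne hx0).2 u (Finset.mem_insert_of_mem hu)
        have : u ≠ n := fun e => hn (e ▸ hu)
        omega
      have hs2 : sgn a p = (-1) ^ b.card := by
        rw [← sgn_erase_self, sgn_eq_of_forall_lt, Finset.card_erase_of_mem hp,
          ← hc, Nat.add_sub_cancel]
        intro u hu
        have := hlow u (Finset.mem_of_mem_erase hu)
        have := Finset.ne_of_mem_erase hu
        omega
      rw [hs1, hs2]
      ring
  · have h4 : bd (n + 1) (topPart n p x a) b = 0 := bd_zero (fun b => by
      unfold topPart
      rw [if_neg (fun h => hlow h.2)]) b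
    rw [h4]
    unfold defect
    rw [if_neg hlow, Finset.mul_sum]
    have h5 : alt (topPart n p x) a b =
        - ∑ v ∈ a, sgn a p * (if p < v then topPart n p x (a.erase v) b else 0) := by
      unfold alt
      rw [← Finset.sum_neg_distrib]
      refine Finset.sum_congr rfl fun v hv => ?_
      by_cases h0 : topPart n p x (a.erase v) b = 0
      · simp [h0]
      have hl : ∀ u ∈ a.erase v, u ≤ p := by
        by_contra h
        apply h0
        unfold topPart
        rw [if_neg (fun h' => h h'.2)]
      have hpv : p < v := by
        by_contra hpv
        apply hlow
        intro u hu
        by_cases huv : u = v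
        · omega
        · exact hl u (Finset.mem_erase.2 ⟨huv, hu⟩)
      rw [if_pos hpv]
      have hs1 : sgn a v = (-1) ^ (a.card - 1) := by
        rw [← sgn_erase_self, sgn_eq_of_forall_lt, Finset.card_erase_of_mem hv]
        intro u hu
        have := hl u hu
        omega
      have hpe : p ∈ a.erase v := Finset.mem_erase.2 ⟨hpv.ne, hp⟩
      have hs2 : sgn a p = (-1) ^ (a.card - 1 - 1) := by
        rw [← sgn_erase_gt hpv.le, ← sgn_erase_self, sgn_eq_of_forall_lt,
          Finset.card_erase_of_mem hpe, Finset.card_erase_of_mem hv]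
        intro u hu
        have := hl u (Finset.mem_of_mem_erase hu)
        have := Finset.ne_of_mem_erase hu
        omega
      have hc : 1 ≤ a.card - 1 := by
        rw [← Finset.card_erase_of_mem hv]
        exact Finset.card_pos.2 ⟨p, hpe⟩
      obtain ⟨k, hk⟩ : ∃ k, a.card - 1 = k + 1 := ⟨a.card - 1 - 1, by omega⟩
      rw [hs1, hs2, hk, Nat.add_sub_cancel, pow_succ]
      ring
    rw [h5]
    ring

theorem sgn_eq_neg_of_adjacent {a : Finset ℕ} {c p : ℕ} (hc : c ∈ a) (hcp : c < p)
    (h : ∀ v ∈ a, v ≤ c ∨ p ≤ v) : sgn a p = - sgn a c := by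
  rw [← sgn_erase_gt (le_refl c), ← neg_neg (sgn a p), ← sgn_erase_lt hcp hc]
  unfold sgn
  congr 3
  ext v
  simp only [Finset.mem_filter, Finset.mem_erase]
  constructor
  · rintro ⟨⟨h1, h2⟩, h3⟩
    have := h v h2
    exact ⟨⟨h1, h2⟩, by omega⟩
  · rintro ⟨h1, h3⟩
    exact ⟨h1, by omega⟩

/-- All faces of `a` except those opposite `c` and `p` contain both `c` and `p`, so `botPart`
vanishes on them and on `a` itself. The two remaining faces have opposite signs because `c` and `p`
are adjacent in `a`. -/
theorem Dep.exchange {n m p f : ℕ} {x : Mat} (hx : IsO n m x) (h : Dep n p f x) {a : Finset ℕ}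
    (ha : a ⊆ Finset.range (m + 1)) (hp : p ∈ a) {c : ℕ} (hc : c ∈ a) (hfc : f ≤ c) (hcp : c < p)
    (hac : ∀ v ∈ a, v ≤ c ∨ p ≤ v) (b : Finset ℕ) :
    botPart n p x (a.erase p) b = botPart n p x (a.erase c) b + defect n p x a b := by
  have h1 := hx.alt_botPart_sub ha hp b
  have h2 : bd (n + 1) (botPart n p x a) b = 0 := bd_zero (h a hp ⟨c, hc, hfc, hcp⟩) b
  have h3 : alt (botPart n p x) a b =
      sgn a p * botPart n p x (a.erase p) b + sgn a c * botPart n p x (a.erase c) b := by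
    unfold alt
    rw [← Finset.sum_pair (f := fun v => sgn a v * botPart n p x (a.erase v) b) hcp.ne']
    symm
    refine Finset.sum_subset (by
      intro v hv
      simp only [Finset.mem_insert, Finset.mem_singleton] at hv
      rcases hv with rfl | rfl <;> assumption) fun v hv hv' => ?_
    simp only [Finset.mem_insert, Finset.mem_singleton, not_or] at hv'
    rw [h _ (Finset.mem_erase.2 ⟨Ne.symm hv'.1, hp⟩)
      ⟨c, Finset.mem_erase.2 ⟨Ne.symm hv'.2, hc⟩, hfc, hcp⟩, mul_zero]
  have h4 := sgn_eq_neg_of_adjacent hc hcp hac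
  rw [h2, h3, sub_zero] at h1
  have h5 : sgn a c = - sgn a p := by rw [h4, neg_neg]
  rw [h5] at h1
  have h6 : sgn a p * (botPart n p x (a.erase p) b - botPart n p x (a.erase c) b -
      defect n p x a b) = 0 := by
    rw [mul_sub, mul_sub, ← h1]
    ring
  have := (mul_eq_zero.1 h6).resolve_left (sgn_ne_zero a p)
  omega

end Oriental

end

/-! ### The filler and its values -/

noncomputable section

namespace Oriental

theorem eq_or_of_dup_eq {j u v : ℕ} (h : dup j u = dup j v) :
    u = v ∨ (u = j ∧ v = j + 1) ∨ (u = j + 1 ∧ v = j) := by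
  unfold dup at h
  split_ifs at h <;> omega

theorem dup_injOn {j : ℕ} {b : Finset ℕ} (h : j ∉ b ∨ j + 1 ∉ b) :
    Set.InjOn (dup j) (b : Set ℕ) := by
  intro u hu v hv e
  rcases eq_or_of_dup_eq e with h' | ⟨rfl, rfl⟩ | ⟨rfl, rfl⟩
  · exact h'
  · rcases h with h | h
    · exact absurd hu h
    · exact absurd hv h
  · rcases h with h | h
    · exact absurd hv h
    · exact absurd hu h

theorem image_dup_erase {j v : ℕ} {b : Finset ℕ} (h : j ∉ b ∨ j + 1 ∉ b) (hv : v ∈ b) :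
    (b.erase v).image (dup j) = (b.image (dup j)).erase (dup j v) := by
  ext t
  simp only [Finset.mem_image, Finset.mem_erase]
  constructor
  · rintro ⟨u, ⟨h1, h2⟩, rfl⟩
    exact ⟨fun e => h1 (dup_injOn h h2 hv e), u, h2, rfl⟩
  · rintro ⟨h1, u, h2, rfl⟩
    exact ⟨u, ⟨fun e => h1 (by rw [e]), h2⟩, rfl⟩

theorem sgn_image_dup {j v : ℕ} {b : Finset ℕ} (h : j ∉ b ∨ j + 1 ∉ b) (hv : v ≠ j + 1 ∨ j ∉ b) :
    sgn (b.image (dup j)) (dup j v) = sgn b v := by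
  unfold sgn
  have e : (b.image (dup j)).filter (· < dup j v) = (b.filter (· < v)).image (dup j) := by
    ext t
    simp only [Finset.mem_filter, Finset.mem_image]
    constructor
    · rintro ⟨⟨u, hu, rfl⟩, h2⟩
      exact ⟨u, ⟨hu, (dup_monotone j).reflect_lt h2⟩, rfl⟩
    · rintro ⟨u, ⟨hu, h2⟩, rfl⟩
      refine ⟨⟨u, hu, rfl⟩, lt_of_le_of_ne (dup_monotone j h2.le) fun e => ?_⟩
      rcases eq_or_of_dup_eq e with h' | ⟨rfl, rfl⟩ | ⟨rfl, rfl⟩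
      · omega
      · rcases hv with hv | hv
        · exact hv rfl
        · exact hv hu
      · omega
  rw [e, Finset.card_image_of_injOn]
  exact (dup_injOn h).mono (by exact_mod_cast Finset.filter_subset _ b)

theorem dup_mem_image {j v : ℕ} {b : Finset ℕ} (hv : v ∈ b) : dup j v ∈ b.image (dup j) :=
  Finset.mem_image_of_mem _ hv

/-- No element of `b` lies in the interval `[j + 2, p + 1]`. -/
def Miss (j p : ℕ) (b : Finset ℕ) : Prop := ∀ v ∈ b, v ≤ j + 1 ∨ p + 1 < v

theorem Miss.notMem_image {j p : ℕ} {b : Finset ℕ} (h : Miss j p b) {v : ℕ} (hv : j < v)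
    (hv' : v ≤ p) : v ∉ b.image (dup j) := by
  rw [mem_image_dup]
  rintro (⟨h1, h2⟩ | ⟨h1, h2⟩)
  · omega
  · have := h _ h2
    omega

theorem Miss.erase {j p : ℕ} {b : Finset ℕ} (h : Miss j p b) (v : ℕ) : Miss j p (b.erase v) :=
  fun u hu => h u (Finset.mem_of_mem_erase hu)

open Classical in
/-- The homotopy from which `fill` is constructed. -/
def fillHomotopy (n j p : ℕ) (x : Mat) : Mat := fun b c =>
  if j + 1 ∈ b ∧ j ∉ b ∧ Miss j p b then
    -(sgn b j) * botPart n p x (insert p (b.image (dup j))) c else 0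

/-- The element whose faces at `j + 1` and `j` are `x` and a simpler element. -/
def fill (n m j p : ℕ) (x : Mat) : Mat := fun b c =>
  if b ⊆ Finset.range (m + 2) then
    mdeg j x b c - (bd (n + 1) (fillHomotopy n j p x b) c + alt (fillHomotopy n j p x) b c) else 0

section
variable {n m j p : ℕ} {x : Mat} {b : Finset ℕ}

theorem fillHomotopy_pos (h1 : j + 1 ∈ b) (h0 : j ∉ b) (h : Miss j p b) (c : Finset ℕ) :
    fillHomotopy n j p x b c = -(sgn b j) * botPart n p x (insert p (b.image (dup j))) c :=
  if_pos ⟨h1, h0, h⟩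

theorem fillHomotopy_neg (h : ¬ (j + 1 ∈ b ∧ j ∉ b ∧ Miss j p b)) (c : Finset ℕ) :
    fillHomotopy n j p x b c = 0 := if_neg h

theorem image_dup_subset (hj : j ≤ m) (hb : b ⊆ Finset.range (m + 2)) :
    b.image (dup j) ⊆ Finset.range (m + 1) := by
  rw [subset_range_iff] at hb ⊢
  intro k hk
  obtain ⟨l, hl, rfl⟩ := Finset.mem_image.1 hk
  exact dup_le hj l (hb l hl)

theorem subset_of_image_dup_subset (h : b.image (dup j) ⊆ Finset.range (m + 1)) :
    b ⊆ Finset.range (m + 2) := by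
  rw [subset_range_iff] at h ⊢
  intro k hk
  have := h _ (dup_mem_image hk)
  unfold dup at this
  split_ifs at this <;> omega

/-- The filler is the degeneracy `s_j x` corrected by `∂H + H∂`, where the homotopy `H` lives on
simplexes with `j + 1`, without `j`, and with no vertex in `[j + 2, p + 1]`. Its values depend on
which of `j`, `j + 1` occur and on how many vertices lie in that interval. Here no term of `H` is
met. -/
theorem fill_of_notMem (hx : IsO n m x) (h1 : j + 1 ∉ b) (c : Finset ℕ) :
    fill n m j p x b c = x (b.image (dup j)) c := by
  unfold fill
  split_ifs with hb
  · have h2 : bd (n + 1) (fillHomotopy n j p x b) c = 0 :=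
      bd_zero (fillHomotopy_neg fun h => h1 h.1) c
    have h3 : alt (fillHomotopy n j p x) b c = 0 := Finset.sum_eq_zero fun v _ => by
      rw [fillHomotopy_neg (fun h => h1 (Finset.mem_of_mem_erase h.1)), mul_zero]
    rw [h2, h3, mdeg_apply_of_notMem (Or.inr h1)]
    ring
  · by_contra h
    exact hb (subset_of_image_dup_subset (hx.supp_left _ _ (Ne.symm h)))

theorem alt_fillHomotopy_of_mem (h0 : j ∈ b) (c : Finset ℕ) :
    alt (fillHomotopy n j p x) b c = sgn b j * fillHomotopy n j p x (b.erase j) c := by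
  unfold alt
  rw [Finset.sum_eq_single_of_mem j h0]
  intro v _ hv
  rw [fillHomotopy_neg, mul_zero]
  rintro ⟨-, h, -⟩
  exact h (Finset.mem_erase.2 ⟨hv.symm, h0⟩)

theorem fill_of_mem_of_mem (hb : b ⊆ Finset.range (m + 2)) (h0 : j ∈ b) (h1 : j + 1 ∈ b)
    (h : Miss j p b) (c : Finset ℕ) :
    fill n m j p x b c = botPart n p x (insert p (b.image (dup j))) c := by
  unfold fill
  have h2 : bd (n + 1) (fillHomotopy n j p x b) c = 0 :=
    bd_zero (fillHomotopy_neg fun h => h.2.1 h0) c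
  have h3 : (b.erase j).image (dup j) = b.image (dup j) := by
    ext t
    simp only [mem_image_dup, Finset.mem_erase]
    constructor
    · tauto
    · rintro (⟨ht, ht'⟩ | ⟨ht, ht'⟩)
      · by_cases e : t = j
        · subst e
          exact Or.inr ⟨le_rfl, by omega, h1⟩
        · exact Or.inl ⟨ht, e, ht'⟩
      · exact Or.inr ⟨ht, by omega, ht'⟩
  rw [if_pos hb, mdeg_apply_of_mem h0 h1, h2, alt_fillHomotopy_of_mem h0, fillHomotopy_pos
    (Finset.mem_erase.2 ⟨by omega, h1⟩) (Finset.notMem_erase j b) (h.erase j), sgn_erase_self, h3]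
  linear_combination (botPart n p x (insert p (b.image (dup j))) c) * sgn_mul_self b j

theorem fill_of_mem_of_mem_of_not_miss (h0 : j ∈ b) (h1 : j + 1 ∈ b) (h : ¬ Miss j p b)
    (c : Finset ℕ) : fill n m j p x b c = 0 := by
  unfold fill
  have h2 : bd (n + 1) (fillHomotopy n j p x b) c = 0 :=
    bd_zero (fillHomotopy_neg fun h => h.2.1 h0) c
  rw [mdeg_apply_of_mem h0 h1, h2, alt_fillHomotopy_of_mem h0, fillHomotopy_neg]
  · simp
  · rintro ⟨-, -, h'⟩
    apply h
    intro v hv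
    by_cases e : v = j
    · omega
    · exact h' v (Finset.mem_erase.2 ⟨e, hv⟩)

/-- The formula is `IsO.alt_botPart_sub` for `insert p (b.image (dup j))`. The face opposite `p` is
the value of `s_j x`, the face opposite `j` is the one displayed, and the other faces cancel against
`H∂`, while its boundary cancels `∂H`. The vertices `j` and `p` are adjacent, hence of opposite
sign, because `b` misses the interval. -/
theorem fill_of_miss (hx : Cls n m p x) (hj : j < p) (hp : p ≤ m)
    (hb : b ⊆ Finset.range (m + 2)) (h0 : j ∉ b) (h1 : j + 1 ∈ b) (h : Miss j p b)
    (c : Finset ℕ) :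
    fill n m j p x b c = botPart n p x ((insert p (b.image (dup j))).erase j) c +
      defect n p x (insert p (b.image (dup j))) c := by
  have hpa : p ∉ b.image (dup j) := h.notMem_image hj le_rfl
  have hdj : dup j (j + 1) = j := by simp [dup]
  have hja : j ∈ b.image (dup j) := by
    have := dup_mem_image (j := j) h1
    rwa [hdj] at this
  have hA : insert p (b.image (dup j)) ⊆ Finset.range (m + 1) :=
    Finset.insert_subset (Finset.mem_range.2 (by omega)) (image_dup_subset (by omega) hb)
  have hsj : sgn (b.image (dup j)) j = sgn b j := by
    have := sgn_image_dup (j := j) (v := j + 1) (b := b) (Or.inl h0) (Or.inr h0)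
    rw [hdj] at this
    rw [this]
    unfold sgn
    congr 2
    ext u
    simp only [Finset.mem_filter]
    constructor
    · rintro ⟨hu, hu'⟩
      have : u ≠ j := fun e => h0 (e ▸ hu)
      exact ⟨hu, by omega⟩
    · rintro ⟨hu, hu'⟩
      exact ⟨hu, by omega⟩
  have hsp : sgn (insert p (b.image (dup j))) p = - sgn b j := by
    rw [sgn_insert_self, sgn_eq_neg_of_adjacent hja hj, hsj]
    intro v hv
    by_contra hv'
    exact h.notMem_image (by omega) (by omega : v ≤ p) hv
  have halt : alt (botPart n p x) (insert p (b.image (dup j))) c =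
      - sgn b j * botPart n p x (b.image (dup j)) c +
        sgn b j * botPart n p x ((insert p (b.image (dup j))).erase j) c +
        sgn b j * alt (fillHomotopy n j p x) b c := by
    unfold alt
    rw [Finset.sum_insert hpa, Finset.erase_insert hpa, hsp, Finset.sum_image (dup_injOn (Or.inl h0)),
      ← Finset.add_sum_erase _ _ h1, hdj, sgn_insert_gt hj.le, hsj, add_assoc,
      ← Finset.add_sum_erase (a := j + 1) b (fun v => sgn b v * fillHomotopy n j p x (b.erase v) c) h1,
      fillHomotopy_neg (b := b.erase (j + 1)) (fun h' => Finset.notMem_erase _ _ h'.1), mul_zero,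
      zero_add, Finset.mul_sum]
    congr 2
    refine Finset.sum_congr rfl fun v hv => ?_
    have hvb := Finset.mem_of_mem_erase hv
    have hvj1 := Finset.ne_of_mem_erase hv
    have hvj : v ≠ j := fun e => h0 (e ▸ hvb)
    rw [fillHomotopy_pos (Finset.mem_erase.2 ⟨hvj1.symm, h1⟩)
      (fun h' => h0 (Finset.mem_of_mem_erase h')) (h.erase v), image_dup_erase (Or.inl h0) hvb]
    have hdp : dup j v ≠ p := fun e => hpa (e ▸ dup_mem_image hvb)
    rw [Finset.erase_insert_of_ne hdp.symm]
    rcases h v hvb with hv' | hv'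
    · rw [sgn_erase_lt (by omega) hvb, sgn_insert_gt (by unfold dup; split_ifs <;> omega),
        sgn_image_dup (Or.inl h0) (Or.inl hvj1)]
      linear_combination (-(sgn b v) * botPart n p x
        (insert p ((b.image (dup j)).erase (dup j v))) c) * sgn_mul_self b j
    · rw [sgn_erase_gt (by omega), sgn_insert_lt (by unfold dup; split_ifs <;> omega) hpa,
        sgn_image_dup (Or.inl h0) (Or.inl hvj1)]
      linear_combination (sgn b v * botPart n p x
        (insert p ((b.image (dup j)).erase (dup j v))) c) * sgn_mul_self b j
  have hbd : bd (n + 1) (fillHomotopy n j p x b) c =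
      - sgn b j * bd (n + 1) (botPart n p x (insert p (b.image (dup j)))) c := by
    unfold bd
    rw [Finset.mul_sum]
    exact Finset.sum_congr rfl fun v _ => by rw [fillHomotopy_pos h1 h0 h]; ring
  have hmain := hx.alt_botPart_sub hA (Finset.mem_insert_self _ _) c
  rw [hsp, halt] at hmain
  have htop := top_add_bot n p x (b.image (dup j)) c
  rw [hx.topPart_eq_zero hpa, zero_add] at htop
  unfold fill
  rw [if_pos hb, hbd, mdeg_apply_of_notMem (Or.inl h0), ← htop]
  have hs := sgn_mul_self b j
  linear_combination (- sgn b j) * hmain - (botPart n p x (b.image (dup j)) c -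
    botPart n p x ((insert p (b.image (dup j))).erase j) c -
    alt (fillHomotopy n j p x) b c - defect n p x (insert p (b.image (dup j))) c) * hs

/-- Only deletion of `v` leads into the support of the homotopy, so a single term of `H∂` survives.
-/
theorem fill_of_unique (hb : b ⊆ Finset.range (m + 2)) (h0 : j ∉ b) (h1 : j + 1 ∈ b)
    {v : ℕ} (hv : v ∈ b) (hjv : j + 1 < v) (hvp : v ≤ p + 1)
    (h : ∀ u ∈ b, u ≤ j + 1 ∨ u = v ∨ p + 1 < u) (c : Finset ℕ) :
    fill n m j p x b c = x (b.image (dup j)) c -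
      botPart n p x (insert p ((b.image (dup j)).erase (v - 1))) c := by
  unfold fill
  have hm : ¬ Miss j p b := fun h' => by
    have := h' v hv
    omega
  have h2 : bd (n + 1) (fillHomotopy n j p x b) c = 0 :=
    bd_zero (fillHomotopy_neg fun h => hm h.2.2) c
  have h3 : alt (fillHomotopy n j p x) b c = sgn b v * fillHomotopy n j p x (b.erase v) c := by
    unfold alt
    rw [Finset.sum_eq_single_of_mem v hv]
    intro u _ huv
    rw [fillHomotopy_neg, mul_zero]
    rintro ⟨-, -, h'⟩
    have := h' v (Finset.mem_erase.2 ⟨huv.symm, hv⟩)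
    omega
  have hm' : Miss j p (b.erase v) := fun u hu => by
    have := h u (Finset.mem_of_mem_erase hu)
    have := Finset.ne_of_mem_erase hu
    omega
  have hs : sgn b v = - sgn b j := by
    rw [sgn_eq_neg_of_adjacent h1 hjv]
    · unfold sgn
      congr 3
      ext u
      simp only [Finset.mem_filter]
      constructor
      · rintro ⟨hu, hu'⟩
        have : u ≠ j := fun e => h0 (e ▸ hu)
        exact ⟨hu, by omega⟩
      · rintro ⟨hu, hu'⟩
        exact ⟨hu, by omega⟩
    · intro u hu
      have := h u hu
      omega
  have hd : dup j v = v - 1 := by unfold dup; rw [if_neg (by omega)]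
  rw [if_pos hb, h2, h3, mdeg_apply_of_notMem (Or.inl h0), fillHomotopy_pos
    (Finset.mem_erase.2 ⟨by omega, h1⟩) (fun h' => h0 (Finset.mem_of_mem_erase h')) hm',
    image_dup_erase (Or.inl h0) hv, hd, sgn_erase_gt (by omega), hs]
  linear_combination (- botPart n p x (insert p ((b.image (dup j)).erase (v - 1))) c) *
    sgn_mul_self b j

theorem fill_of_two (hb : b ⊆ Finset.range (m + 2)) (h0 : j ∉ b)
    {u v : ℕ} (hu : u ∈ b) (hv : v ∈ b) (huv : u ≠ v) (hju : j + 1 < u) (hup : u ≤ p + 1)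
    (hjv : j + 1 < v) (hvp : v ≤ p + 1) (c : Finset ℕ) :
    fill n m j p x b c = x (b.image (dup j)) c := by
  unfold fill
  have hm : ¬ Miss j p b := fun h' => by
    have := h' v hv
    omega
  have h2 : bd (n + 1) (fillHomotopy n j p x b) c = 0 :=
    bd_zero (fillHomotopy_neg fun h => hm h.2.2) c
  have h3 : alt (fillHomotopy n j p x) b c = 0 := Finset.sum_eq_zero fun w _ => by
    rw [fillHomotopy_neg, mul_zero]
    rintro ⟨-, -, h'⟩
    by_cases e : w = u
    · have := h' v (Finset.mem_erase.2 ⟨by omega, hv⟩)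
      omega
    · have := h' u (Finset.mem_erase.2 ⟨Ne.symm e, hu⟩)
      omega
  rw [if_pos hb, h2, h3, mdeg_apply_of_notMem (Or.inl h0)]
  ring

theorem fill_of_top (hb : b ⊆ Finset.range (m + 2)) (h0 : j ∉ b) (h1 : j + 1 ∈ b) (hj : j < p)
    (hv : p + 1 ∈ b) (h : ∀ u ∈ b, u ≤ j + 1 ∨ p + 1 ≤ u) (c : Finset ℕ) :
    fill n m j p x b c = topPart n p x (b.image (dup j)) c := by
  have hpa : p ∈ b.image (dup j) := mem_image_dup.2 (Or.inr ⟨hj.le, hv⟩)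
  rw [fill_of_unique hb h0 h1 hv (by omega) le_rfl (fun u hu => by have := h u hu; omega),
    Nat.add_sub_cancel, Finset.insert_erase hpa, ← top_add_bot n p x]
  ring

/-- The difference in `fill_of_unique` is nonnegative by the dependence condition: `Dep.exchange`,
replacing `v - 1` by `p`, turns it into the defect. -/
theorem fill_of_between (hx : Cls n m p x) (hp : p ≤ m) (hd : Dep n p (j + 1) x)
    (hb : b ⊆ Finset.range (m + 2)) (h0 : j ∉ b) (h1 : j + 1 ∈ b)
    {v : ℕ} (hv : v ∈ b) (hjv : j + 1 < v) (hvp : v ≤ p)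
    (h : ∀ u ∈ b, u ≤ j + 1 ∨ u = v ∨ p + 1 < u) (c : Finset ℕ) :
    fill n m j p x b c = defect n p x (insert p (b.image (dup j))) c := by
  have hpa : p ∉ b.image (dup j) := by
    rw [mem_image_dup]
    rintro (⟨h1, h2⟩ | ⟨h1, h2⟩)
    · omega
    · have := h _ h2
      omega
  have hva : v - 1 ∈ b.image (dup j) := mem_image_dup.2 (Or.inr ⟨by omega, by
    rwa [show v - 1 + 1 = v by omega]⟩)
  have hA : insert p (b.image (dup j)) ⊆ Finset.range (m + 1) :=
    Finset.insert_subset (Finset.mem_range.2 (by omega)) (image_dup_subset (by omega) hb)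
  have hex := hd.exchange hx.toIsO hA (Finset.mem_insert_self _ _)
    (Finset.mem_insert_of_mem hva) (by omega) (by omega) (fun u hu => ?_) c
  · rw [Finset.erase_insert hpa, Finset.erase_insert_of_ne (by omega)] at hex
    have htop := top_add_bot n p x (b.image (dup j)) c
    rw [hx.topPart_eq_zero hpa, zero_add] at htop
    rw [fill_of_unique hb h0 h1 hv hjv (by omega) h, ← htop, hex]
    ring
  · rcases Finset.mem_insert.1 hu with rfl | hu
    · exact Or.inr le_rfl
    rcases mem_image_dup.1 hu with ⟨h1, h2⟩ | ⟨h1, h2⟩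
    · omega
    · have := h _ h2
      omega

/-- The number of vertices of `b` in `[j + 2, p + 1]`: none, only `p + 1`, only one that is smaller
than `p + 1`, or at least two. -/
theorem miss_or (b : Finset ℕ) (j p : ℕ) : Miss j p b ∨
    (p + 1 ∈ b ∧ ∀ u ∈ b, u ≤ j + 1 ∨ p + 1 ≤ u) ∨
    (∃ v ∈ b, j + 1 < v ∧ v ≤ p ∧ ∀ u ∈ b, u ≤ j + 1 ∨ u = v ∨ p + 1 < u) ∨
    ∃ u ∈ b, ∃ v ∈ b, u < v ∧ j + 1 < u ∧ v ≤ p + 1 := by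
  by_cases h : Miss j p b
  · exact Or.inl h
  right
  unfold Miss at h
  push Not at h
  obtain ⟨v, hv, hv1, hv2⟩ := h
  by_cases h2 : ∃ u ∈ b, u ≠ v ∧ j + 1 < u ∧ u ≤ p + 1
  · obtain ⟨u, hu, huv, hu1, hu2⟩ := h2
    right; right
    rcases lt_or_gt_of_ne huv with h | h
    · exact ⟨u, hu, v, hv, h, hu1, hv2⟩
    · exact ⟨v, hv, u, hu, h, hv1, hu2⟩
  · push Not at h2
    by_cases hvp : v = p + 1
    · left
      refine ⟨hvp ▸ hv, fun u hu => ?_⟩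
      have := h2 u hu
      omega
    · right; left
      refine ⟨v, hv, hv1, by omega, fun u hu => ?_⟩
      have := h2 u hu
      omega

end

end Oriental

end

noncomputable section

namespace Oriental

/-! ### Faces and classes -/

theorem image_skip_singleton (i v : ℕ) : ({v} : Finset ℕ).image (skip i) = {skip i v} :=
  Finset.image_singleton _ _

theorem Cls.mface_lt {n m p i : ℕ} {x : Mat} (hx : Cls n (m + 1) (p + 1) x) (hi : i ≤ p) :
    Cls n m p (mface i x) where
  toIsO := hx.toIsO.mface (by have := hx.le; omega)
  le := by have := hx.le; omega
  vertex v hv := by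
    change x _ _ = _
    rw [image_skip_singleton, hx.vertex _ (by unfold skip; split_ifs <;> omega)]
    unfold skip
    split_ifs <;> first | rfl | omega

theorem Cls.mface_ge {n m p i : ℕ} {x : Mat} (hx : Cls n (m + 1) p x) (hi : p ≤ i)
    (hi' : i ≤ m + 1) : Cls n m p (mface i x) where
  toIsO := hx.toIsO.mface hi'
  le := by omega
  vertex v hv := by
    change x _ _ = _
    rw [image_skip_singleton, hx.vertex _ (by unfold skip; split_ifs <;> omega)]
    unfold skip
    split_ifs <;> first | rfl | omega

theorem botPart_mface {n p i : ℕ} {x : Mat} (hi : i ≤ p + 1) (a b : Finset ℕ) :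
    botPart n p (mface i x) a b = botPart n (p + 1) x (a.image (skip i)) b := by
  have : (∀ v ∈ a.image (skip i), v ≤ p + 1) ↔ ∀ v ∈ a, v ≤ p := by
    rw [Finset.forall_mem_image]
    refine forall₂_congr fun v _ => ?_
    unfold skip
    split_ifs <;> omega
  unfold botPart
  simp only [this]
  rfl

theorem Dep.mface {n p f i : ℕ} {x : Mat} (h : Dep n (p + 1) f x) (hi : i ≤ p) :
    Dep n p f (mface i x) := by
  rintro a hp ⟨v, hv, h1, h2⟩ b
  rw [botPart_mface (by omega)]
  refine h _ (mem_image_skip.2 (Or.inr ⟨by omega, by simpa using hp⟩))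
    ⟨skip i v, Finset.mem_image_of_mem _ hv, ?_, ?_⟩ b <;> unfold skip <;> split_ifs <;> omega

theorem Dep.mface_lt {n p f i : ℕ} {x : Mat} (h : Dep n (p + 1) (f + 1) x) (hi : i ≤ f) :
    Dep n p f (Oriental.mface i x) := by
  rintro a hp ⟨v, hv, h1, h2⟩ b
  rw [botPart_mface (by omega)]
  refine h _ (mem_image_skip.2 (Or.inr ⟨by omega, by simpa using hp⟩))
    ⟨skip i v, Finset.mem_image_of_mem _ hv, ?_, ?_⟩ b <;> unfold skip <;> split_ifs <;> omega

theorem Dep.mono {n p f g : ℕ} {x : Mat} (h : Dep n p f x) (hfg : f ≤ g) : Dep n p g x :=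
  fun a hp ⟨v, hv, h1, h2⟩ => h a hp ⟨v, hv, by omega, h2⟩

theorem dep_of_le {n p f : ℕ} (x : Mat) (h : p ≤ f) : Dep n p f x := by
  rintro a - ⟨v, -, h1, h2⟩
  omega

theorem image_dup_image_skip {i j : ℕ} (a : Finset ℕ) (h : i = j ∨ i = j + 1) :
    (a.image (skip i)).image (dup j) = a := by
  rw [Finset.image_image]
  conv_rhs => rw [← Finset.image_id (s := a)]
  apply Finset.image_congr
  intro k _
  simp only [Function.comp, skip, dup, id]
  split_ifs <;> omega

theorem notMem_image_skip (i : ℕ) (a : Finset ℕ) : i ∉ a.image (skip i) := by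
  rw [mem_image_skip]
  omega

/-- The increasing function that omits `k, …, k + s - 1`. -/
def skips (k s v : ℕ) : ℕ := if v < k then v else v + s

theorem mface_iterate (k s : ℕ) (x : Mat) (a b : Finset ℕ) :
    (mface k)^[s] x a b = x (a.image (skips k s)) b := by
  induction s generalizing x with
  | zero =>
    have : skips k 0 = id := by funext v; simp [skips]
    rw [this, Finset.image_id]
    rfl
  | succ s ih =>
    rw [Function.iterate_succ_apply, ih]
    unfold mface
    rw [Finset.image_image]
    congr 2
    funext v
    simp only [Function.comp, skip, skips]
    split_ifs <;> omega

theorem mem_image_skips {k s v : ℕ} {a : Finset ℕ} :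
    v ∈ a.image (skips k s) ↔ (v < k ∧ v ∈ a) ∨ (k + s ≤ v ∧ v - s ∈ a) := by
  simp only [Finset.mem_image, skips]
  constructor
  · rintro ⟨w, hw, h⟩
    split_ifs at h with h1
    · subst h
      exact Or.inl ⟨h1, hw⟩
    · subst h
      exact Or.inr ⟨by omega, by simpa using hw⟩
  · rintro (⟨h1, h2⟩ | ⟨h1, h2⟩)
    · exact ⟨v, h2, if_pos h1⟩
    · exact ⟨v - s, h2, by rw [if_neg (by omega)]; omega⟩

theorem Van.mface_iterate {i k : ℕ} {x : Mat} (h : Van i x) (hk : i + 3 ≤ k) (s : ℕ) :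
    Van i ((mface k)^[s] x) := by
  induction s with
  | zero => exact h
  | succ s ih =>
    rw [Function.iterate_succ_apply']
    exact ih.mface_gt hk

/-! ### Properties of the filler -/

section
variable {n m j p : ℕ} {x : Mat}

theorem low_iff (hj : j ≤ p) (b : Finset ℕ) :
    (∀ v ∈ b.image (dup j), v ≤ p) ↔ ∀ v ∈ b, v ≤ p + 1 := by
  rw [Finset.forall_mem_image]
  refine forall₂_congr fun v _ => ?_
  unfold dup
  split_ifs <;> omega

theorem fill_of_not_subset {b : Finset ℕ} (hb : ¬ b ⊆ Finset.range (m + 2)) (c : Finset ℕ) :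
    fill n m j p x b c = 0 := if_neg hb

/-- Only the case of one intermediate vertex needs `Dep n p (j + 1)`; it is what makes the
correction of `s_j x` admissible. -/
theorem fill_nonneg (hx : Cls n m p x) (hj : j < p) (hp : p ≤ m) (hd : Dep n p (j + 1) x)
    (b c : Finset ℕ) : 0 ≤ fill n m j p x b c := by
  by_cases hb : b ⊆ Finset.range (m + 2)
  swap
  · rw [fill_of_not_subset hb]
  by_cases h1 : j + 1 ∈ b
  swap
  · rw [fill_of_notMem hx.toIsO h1]
    exact hx.nonneg _ _
  by_cases h0 : j ∈ b
  · by_cases hm : Miss j p b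
    · rw [fill_of_mem_of_mem hb h0 h1 hm]
      exact hx.botPart_nonneg _ _ _
    · rw [fill_of_mem_of_mem_of_not_miss h0 h1 hm]
  rcases miss_or b j p with hm | ⟨hv, h⟩ | ⟨v, hv, hv1, hv2, h⟩ | ⟨u, hu, v, hv, huv, hu1, hv2⟩
  · rw [fill_of_miss hx hj hp hb h0 h1 hm]
    exact add_nonneg (hx.botPart_nonneg _ _ _) (hx.defect_nonneg _ _ _)
  · rw [fill_of_top hb h0 h1 hj hv h]
    exact hx.topPart_nonneg _ _ _
  · rw [fill_of_between hx hp hd hb h0 h1 hv hv1 hv2 h]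
    exact hx.defect_nonneg _ _ _
  · rw [fill_of_two hb h0 hu hv huv.ne hu1 (by omega) (by omega) hv2]
    exact hx.nonneg _ _

/-- Away from the simplexes that miss the interval, the correction only removes terms from `s_j x`.
Hence the face opposite `j` inherits zeros from `x`. -/
theorem fill_le (hx : Cls n m p x) {b : Finset ℕ} (h0 : j ∉ b)
    (h : j + 1 ∉ b ∨ ¬ Miss j p b) (c : Finset ℕ) :
    fill n m j p x b c ≤ x (b.image (dup j)) c := by
  by_cases hb : b ⊆ Finset.range (m + 2)
  swap
  · rw [fill_of_not_subset hb]
    exact hx.nonneg _ _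
  by_cases h1 : j + 1 ∈ b
  swap
  · rw [fill_of_notMem hx.toIsO h1]
  rcases miss_or b j p with hm | ⟨hv, h⟩ | ⟨v, hv, hv1, hv2, h⟩ | ⟨u, hu, v, hv, huv, hu1, hv2⟩
  · exact absurd hm (h.resolve_left (not_not.2 h1))
  · by_cases hj : j < p
    · rw [fill_of_top hb h0 h1 hj hv h, ← top_add_bot n p x (b.image (dup j))]
      have := hx.botPart_nonneg p (b.image (dup j)) c
      omega
    · unfold Miss at *
      rename_i h'
      rcases h' with h' | h'
      · exact absurd h1 h'
      · exfalso
        apply h'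
        intro u hu
        have := h u hu
        by_cases e : u ≤ j + 1
        · exact Or.inl e
        · right; omega
  · rw [fill_of_unique hb h0 h1 hv hv1 (by omega) h]
    have := hx.botPart_nonneg p (insert p ((b.image (dup j)).erase (v - 1))) c
    omega
  · rw [fill_of_two hb h0 hu hv huv.ne hu1 (by omega) (by omega) hv2]

theorem fillHomotopy_ne_zero (hx : Cls n m p x) (hj : j < p) {b c : Finset ℕ}
    (h : fillHomotopy n j p x b c ≠ 0) :
    c.card = b.card + 1 ∧ c ⊆ Finset.range (n + 1) := by
  by_cases h' : j + 1 ∈ b ∧ j ∉ b ∧ Miss j p b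
  · obtain ⟨h1, h0, hm⟩ := h'
    rw [fillHomotopy_pos h1 h0 hm] at h
    have hne : x (insert p (b.image (dup j))) c ≠ 0 := fun e => h (by
      rw [botPart_eq_zero e, mul_zero])
    refine ⟨?_, hx.supp_right _ _ hne⟩
    rw [hx.card_eq _ _ hne, Finset.card_insert_of_notMem (hm.notMem_image hj le_rfl),
      Finset.card_image_of_injOn (dup_injOn (Or.inl h0))]
  · exact absurd (fillHomotopy_neg h' c) h

theorem fill_ne_zero (hx : Cls n m p x) (hj : j < p) (hp : p ≤ m) {b c : Finset ℕ}
    (h : fill n m j p x b c ≠ 0) : c.card = b.card ∧ c ⊆ Finset.range (n + 1) := by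
  by_cases h1 : mdeg j x b c ≠ 0
  · exact ⟨(hx.mdeg (i := j) (by omega)).card_eq _ _ h1,
      (hx.mdeg (i := j) (by omega)).supp_right _ _ h1⟩
  by_cases h2 : bd (n + 1) (fillHomotopy n j p x b) c ≠ 0
  · obtain ⟨v, hv, hne⟩ := Finset.exists_ne_zero_of_sum_ne_zero h2
    have := fillHomotopy_ne_zero hx hj (right_ne_zero_of_mul hne)
    rw [Finset.card_insert_of_notMem (Finset.mem_sdiff.1 hv).2] at this
    exact ⟨by omega, (Finset.subset_insert _ _).trans this.2⟩
  by_cases h3 : alt (fillHomotopy n j p x) b c ≠ 0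
  · obtain ⟨v, hv, hne⟩ := Finset.exists_ne_zero_of_sum_ne_zero h3
    have := fillHomotopy_ne_zero hx hj (right_ne_zero_of_mul hne)
    rw [Finset.card_erase_of_mem hv] at this
    have := Finset.card_pos.2 ⟨v, hv⟩
    exact ⟨by omega, by tauto⟩
  · exfalso
    apply h
    unfold fill
    push Not at h1 h2 h3
    rw [h1, h2, h3]
    simp

/-- The correction `∂H + H∂` commutes with the boundary, since both composites are `∂H∂`. So the
chain condition is automatic, and nonnegativity is the real content. -/
theorem fill_isO (hx : Cls n m p x) (hj : j < p) (hp : p ≤ m) (hd : Dep n p (j + 1) x) :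
    IsO n (m + 1) (fill n m j p x) where
  empty b := by rw [fill_of_notMem hx.toIsO (by simp), Finset.image_empty, hx.empty]
  nonneg := fill_nonneg hx hj hp hd
  supp_left a b h := by
    by_contra h'
    exact h (fill_of_not_subset h' b)
  supp_right a b h := (fill_ne_zero hx hj hp h).2
  card_eq a b h := (fill_ne_zero hx hj hp h).1
  chain a ha b := by
    have h1 : alt (fill n m j p x) a b = alt (mdeg j x) a b -
        (alt (fun a' => bd (n + 1) (fillHomotopy n j p x a')) a b +
          alt (alt (fillHomotopy n j p x)) a b) := by
      unfold alt
      rw [← Finset.sum_add_distrib, ← Finset.sum_sub_distrib]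
      refine Finset.sum_congr rfl fun v _ => ?_
      unfold fill alt
      rw [if_pos ((Finset.erase_subset v a).trans ha)]
      ring
    have h2 : bd (n + 1) (fill n m j p x a) b = bd (n + 1) (mdeg j x a) b -
        (bd (n + 1) (bd (n + 1) (fillHomotopy n j p x a)) b +
          bd (n + 1) (alt (fillHomotopy n j p x) a) b) := by
      rw [← bd_add, ← bd_sub]
      refine bd_congr fun v _ _ => ?_
      unfold fill
      rw [if_pos ha]
    rw [h1, h2, bd_bd, alt_alt, bd_alt, (hx.mdeg (i := j) (by omega)).chain a ha]
    ring

theorem fill_cls (hx : Cls n m p x) (hj : j < p) (hp : p ≤ m) (hd : Dep n p (j + 1) x) :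
    Cls n (m + 1) (p + 1) (fill n m j p x) where
  toIsO := fill_isO hx hj hp hd
  le := by omega
  vertex v hv := by
    -- The homotopy affects vertices only at `j + 1`. There the filler takes the value of `botPart`
    -- on `{p}` plus a defect, and neither contains `n`.
    by_cases hvj : v = j + 1
    · subst hvj
      have himg : ({j + 1} : Finset ℕ).image (dup j) = {j} := by
        rw [Finset.image_singleton]; simp [dup]
      rw [fill_of_miss hx hj hp (by simpa using by omega) (by simp) (by simp)
        (fun v hv => by simp at hv; omega), himg, if_neg (by omega)]
      have h1 : botPart n p x ((insert p {j} : Finset ℕ).erase j) {n} = 0 := by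
        unfold botPart
        rw [if_pos]
        refine ⟨by simp, fun v hv => ?_⟩
        simp only [Finset.mem_erase, Finset.mem_insert, Finset.mem_singleton] at hv
        omega
      have h2 : defect n p x (insert p {j}) {n} = 0 := by
        unfold defect
        rw [if_pos, if_pos (by simp)]
        intro v hv
        simp only [Finset.mem_insert, Finset.mem_singleton] at hv
        omega
      rw [h1, h2, add_zero]
    · rw [fill_of_notMem hx.toIsO (by simpa using Ne.symm hvj), Finset.image_singleton,
        hx.vertex _ (dup_le (by omega) v hv)]
      unfold dup
      split_ifs <;> first | rfl | omega

theorem mface_fill_succ (hx : IsO n m x) : mface (j + 1) (fill n m j p x) = x := by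
  funext a b
  unfold mface
  rw [fill_of_notMem hx (notMem_image_skip _ _), image_dup_image_skip _ (Or.inr rfl)]

theorem botPart_fill (hj : j ≤ p) {b c : Finset ℕ}
    (h : fill n m j p x b c = x (b.image (dup j)) c) :
    botPart n (p + 1) (fill n m j p x) b c = botPart n p x (b.image (dup j)) c := by
  unfold botPart
  simp only [low_iff hj, h]

/-- A simplex with `p + 1` does not miss the interval, so the filler is zero, or equal to `s_j x`,
or equal to a `topPart`, which contributes nothing to `botPart`. -/
theorem fill_dep_succ (hx : Cls n m p x) (hj : j < p) (hd : Dep n p (j + 1) x) :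
    Dep n (p + 1) (j + 1) (fill n m j p x) := by
  rintro b hpb ⟨v, hv, hv1, hv2⟩ c
  by_cases hb : b ⊆ Finset.range (m + 2)
  swap
  · exact botPart_eq_zero (fill_of_not_subset hb c)
  have hpa : p ∈ b.image (dup j) := mem_image_dup.2 (Or.inr ⟨hj.le, hpb⟩)
  have hm : ¬ Miss j p b := fun h => by have := h _ hpb; omega
  by_cases h1 : j + 1 ∈ b
  swap
  · rw [botPart_fill hj.le (fill_of_notMem hx.toIsO h1 c)]
    have : v ≠ j + 1 := fun e => h1 (e ▸ hv)
    exact hd _ hpa ⟨v - 1, mem_image_dup.2 (Or.inr ⟨by omega, by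
      rwa [show v - 1 + 1 = v by omega]⟩), by omega, by omega⟩ c
  by_cases h0 : j ∈ b
  · exact botPart_eq_zero (fill_of_mem_of_mem_of_not_miss h0 h1 hm c)
  rcases miss_or b j p with hm' | ⟨hv, h⟩ | ⟨v, hv, hv1, hv2, h⟩ | ⟨u, hu, v, hv, huv, hu1, hv2⟩
  · exact absurd hm' hm
  · have h3 := fill_of_top (n := n) (m := m) (x := x) hb h0 h1 hj hv h c
    unfold botPart
    rw [h3]
    unfold topPart
    simp only [low_iff hj.le]
    split_ifs <;> rfl
  · have := h _ hpb
    omega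
  · rw [botPart_fill hj.le (fill_of_two hb h0 hu hv huv.ne hu1 (by omega) (by omega) hv2 c)]
    exact hd _ hpa ⟨u - 1, mem_image_dup.2 (Or.inr ⟨by omega, by
      rwa [show u - 1 + 1 = u by omega]⟩), by omega, by omega⟩ c

/-- For an `x` that already satisfies the stronger condition, the filler satisfies it too. This
makes the value defined through the filler agree with a value defined earlier. -/
theorem fill_dep (hx : Cls n m p x) (hj : j < p) (hd : Dep n p j x) :
    Dep n (p + 1) j (fill n m j p x) := by
  rintro b hpb ⟨v, hv, hv1, hv2⟩ c
  by_cases hvj : j + 1 ≤ v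
  · exact fill_dep_succ hx hj (hd.mono (by omega)) b hpb ⟨v, hv, hvj, hv2⟩ c
  obtain rfl : v = j := by omega
  have hm : ¬ Miss v p b := fun h => by have := h _ hpb; omega
  have hpa : p ∈ b.image (dup v) := mem_image_dup.2 (Or.inr ⟨hj.le, hpb⟩)
  by_cases h1 : v + 1 ∈ b
  · exact botPart_eq_zero (fill_of_mem_of_mem_of_not_miss hv h1 hm c)
  · rw [botPart_fill hj.le (fill_of_notMem hx.toIsO h1 c)]
    exact hd _ hpa ⟨v, mem_image_dup.2 (Or.inl ⟨le_rfl, hv⟩), le_rfl, hj⟩ c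

/-- The filler is thin at `j`, and so are its iterated faces opposite `j + 2`. -/
theorem van_iterate_fill {q : ℕ} (hq : j + q + 1 ≤ p) :
    Van j ((mface (j + 2))^[q] (fill n m j p x)) := by
  intro a h0 h1 h2 b
  rw [mface_iterate]
  refine fill_of_mem_of_mem_of_not_miss (mem_image_skips.2 (Or.inl ⟨by omega, h0⟩))
    (mem_image_skips.2 (Or.inl ⟨by omega, h1⟩)) (fun h => ?_) b
  have := h (j + 2 + q) (mem_image_skips.2 (Or.inr ⟨by omega, by simpa using h2⟩))
  omega

theorem mface_fill_eq_zero (hx : Cls n m p x) (hj : j < p) (hp : p ≤ m)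
    (hd : Dep n p (j + 1) x) {a c : Finset ℕ} (hxa : x a c = 0)
    (ha : j ∉ a ∨ ∃ v ∈ a, j + 1 ≤ v ∧ v ≤ p) : mface j (fill n m j p x) a c = 0 := by
  refine le_antisymm ?_ (fill_nonneg hx hj hp hd _ _)
  have h := fill_le hx (j := j) (b := a.image (skip j)) (notMem_image_skip j a) ?_ c
  · rwa [image_dup_image_skip _ (Or.inl rfl), hxa] at h
  · rcases ha with ha | ⟨v, hv, h1, h2⟩
    · left
      rw [mem_image_skip]
      simp [ha]
    · right
      intro h
      have := h (v + 1) (mem_image_skip.2 (Or.inr ⟨by omega, by simpa using hv⟩))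
      omega

theorem fill_eq_zero_of_miss (hx : Cls n m p x) (hj : j < p) (hp : p ≤ m) {i : ℕ}
    (hv : Van i x) (hpi : p ≤ i) {b : Finset ℕ} (h1 : j + 1 ∈ b) (hm : Miss j p b)
    (hi0 : i ∈ insert p (b.image (dup j))) (hi1 : i + 1 ∈ b.image (dup j))
    (hi2 : i + 2 ∈ b.image (dup j)) (c : Finset ℕ) : fill n m j p x b c = 0 := by
  by_cases hb : b ⊆ Finset.range (m + 2)
  swap
  · exact fill_of_not_subset hb c
  by_cases h0 : j ∈ b
  · rw [fill_of_mem_of_mem hb h0 h1 hm]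
    exact botPart_eq_zero (hv _ hi0 (Finset.mem_insert_of_mem hi1) (Finset.mem_insert_of_mem hi2) c)
  · rw [fill_of_miss hx hj hp hb h0 h1 hm, defect_eq_zero_of_two (u := i + 1) (v := i + 2)
      (Finset.mem_insert_of_mem hi1) (Finset.mem_insert_of_mem hi2) (by omega) (by omega),
      botPart_eq_zero, add_zero]
    refine hv _ (Finset.mem_erase.2 ⟨by omega, hi0⟩)
      (Finset.mem_erase.2 ⟨by omega, Finset.mem_insert_of_mem hi1⟩)
      (Finset.mem_erase.2 ⟨by omega, Finset.mem_insert_of_mem hi2⟩) c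

/-- The case not covered by `mface_fill_eq_zero` is that of a simplex with `j` and without vertices
in `[j + 1, p]`; then `p ≤ i`, and two vertices beyond `p` kill the defect. -/
theorem van_mface_fill_of_lt (hx : Cls n m p x) (hj : j < p) (hp : p ≤ m)
    (hd : Dep n p (j + 1) x) {i : ℕ} (hi : j + 1 ≤ i) (hv : Van i x) :
    Van i (mface j (fill n m j p x)) := by
  intro a h0 h1 h2 c
  by_cases h : j ∉ a ∨ ∃ v ∈ a, j + 1 ≤ v ∧ v ≤ p
  · exact mface_fill_eq_zero hx hj hp hd (hv a h0 h1 h2 c) h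
  · push Not at h
    obtain ⟨hja, h⟩ := h
    have hpi : p ≤ i := by
      by_contra hpi
      have := h i h0 hi
      omega
    have himg := image_dup_image_skip (i := j) (j := j) a (Or.inl rfl)
    refine fill_eq_zero_of_miss hx hj hp hv hpi
      (mem_image_skip.2 (Or.inr ⟨by omega, by simpa using hja⟩)) (fun v hv => ?_) ?_ ?_ ?_ c
    · rcases mem_image_skip.1 hv with ⟨h3, h4⟩ | ⟨h3, h4⟩
      · omega
      · by_contra h5
        have := h _ h4 (by omega)
        omega
    · rw [himg]
      exact Finset.mem_insert_of_mem h0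
    · rwa [himg]
    · rwa [himg]

theorem van_mface_fill_self (hx : Cls n m p x) (hj : j < p) (hp : p ≤ m)
    (hd : Dep n p (j + 1) x) (hv : Van j x) : Van j (mface j (fill n m j p x)) :=
  fun a h0 h1 h2 c => mface_fill_eq_zero hx hj hp hd (hv a h0 h1 h2 c)
    (Or.inr ⟨j + 1, h1, le_rfl, hj⟩)

theorem van_mface_fill_pred {i : ℕ} (hx : Cls n m p x) (hj : i + 1 < p) (hp : p ≤ m)
    (hd : Dep n p (i + 2) x) (hv : Van i x) : Van i (mface (i + 1) (fill n m (i + 1) p x)) :=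
  fun a h0 h1 h2 c => mface_fill_eq_zero hx hj hp hd (hv a h0 h1 h2 c)
    (Or.inr ⟨i + 2, h2, le_rfl, hj⟩)

/-- The construction moves or deletes only vertices from `j` onwards, so each term still evaluates
`x` on a simplex with `i`, `i + 1`, `i + 2`. -/
theorem van_fill_of_lt (hx : Cls n m p x) (hj : j < p) (hp : p ≤ m)
    (hd : Dep n p (j + 1) x) {i : ℕ} (hi : i + 3 ≤ j) (hv : Van i x) : Van i (fill n m j p x) := by
  intro b h0 h1 h2 c
  have hA : ∀ a, i ∈ a → i + 1 ∈ a → i + 2 ∈ a → x a c = 0 := fun a h0 h1 h2 => hv a h0 h1 h2 c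
  have k0 : i ∈ b.image (dup j) := mem_image_dup.2 (Or.inl ⟨by omega, h0⟩)
  have k1 : i + 1 ∈ b.image (dup j) := mem_image_dup.2 (Or.inl ⟨by omega, h1⟩)
  have k2 : i + 2 ∈ b.image (dup j) := mem_image_dup.2 (Or.inl ⟨by omega, h2⟩)
  by_cases hb : b ⊆ Finset.range (m + 2)
  swap
  · exact fill_of_not_subset hb c
  by_cases hj1 : j + 1 ∈ b
  swap
  · rw [fill_of_notMem hx.toIsO hj1]
    exact hA _ k0 k1 k2
  have l0 := Finset.mem_insert_of_mem (b := p) k0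
  have l1 := Finset.mem_insert_of_mem (b := p) k1
  have l2 := Finset.mem_insert_of_mem (b := p) k2
  have hdef : defect n p x (insert p (b.image (dup j))) c = 0 :=
    defect_eq_zero (hv _ l0 l1 l2) (fun v _ hpv b => topPart_eq_zero (hv _
      (Finset.mem_erase.2 ⟨by omega, l0⟩) (Finset.mem_erase.2 ⟨by omega, l1⟩)
      (Finset.mem_erase.2 ⟨by omega, l2⟩) b)) c
  by_cases hj0 : j ∈ b
  · by_cases hm : Miss j p b
    · rw [fill_of_mem_of_mem hb hj0 hj1 hm]
      exact botPart_eq_zero (hA _ l0 l1 l2)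
    · exact fill_of_mem_of_mem_of_not_miss hj0 hj1 hm c
  rcases miss_or b j p with hm | ⟨hv, h⟩ | ⟨v, hv, hv1, hv2, h⟩ | ⟨u, hu, v, hv, huv, hu1, hv2⟩
  · rw [fill_of_miss hx hj hp hb hj0 hj1 hm, hdef, botPart_eq_zero, add_zero]
    exact hA _ (Finset.mem_erase.2 ⟨by omega, l0⟩) (Finset.mem_erase.2 ⟨by omega, l1⟩)
      (Finset.mem_erase.2 ⟨by omega, l2⟩)
  · rw [fill_of_top hb hj0 hj1 hj hv h]
    exact topPart_eq_zero (hA _ k0 k1 k2)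
  · rw [fill_of_between hx hp hd hb hj0 hj1 hv hv1 hv2 h, hdef]
  · rw [fill_of_two hb hj0 hu hv huv.ne hu1 (by omega) (by omega) hv2]
    exact hA _ k0 k1 k2

/-- The complementary face of the filler: the iterated face opposite `j + 2, …, p + 1`. -/
def coface (n m j p : ℕ) (x : Mat) : Mat := (mface (j + 2))^[p - j] (fill n m j p x)

theorem miss_image_skips (hj : j ≤ p) (a : Finset ℕ) :
    Miss j p (a.image (skips (j + 2) (p - j))) := by
  intro v hv
  rcases mem_image_skips.1 hv with ⟨h1, h2⟩ | ⟨h1, h2⟩ <;> omega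

/-- Place `i` of `x` is place `i + 1` of the filler, and `p - j` vertices are then deleted. When `i
= p`, the vertex `p` required for thinness is the one that the formula for the filler inserts. -/
theorem van_coface_of_le (hx : Cls n m p x) (hj : j < p) (hp : p ≤ m) {i : ℕ} (hi : p ≤ i)
    (hv : Van i x) : Van (i + 1 - (p - j)) (coface n m j p x) := by
  intro a h0 h1 h2 c
  unfold coface
  rw [mface_iterate]
  have hm := miss_image_skips hj.le a
  have k1 : i + 1 ∈ (a.image (skips (j + 2) (p - j))).image (dup j) :=
    mem_image_dup.2 (Or.inr ⟨by omega, mem_image_skips.2 (Or.inr ⟨by omega, by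
      rwa [show i + 1 + 1 - (p - j) = i + 1 - (p - j) + 1 by omega]⟩)⟩)
  have k2 : i + 2 ∈ (a.image (skips (j + 2) (p - j))).image (dup j) :=
    mem_image_dup.2 (Or.inr ⟨by omega, mem_image_skips.2 (Or.inr ⟨by omega, by
      rwa [show i + 2 + 1 - (p - j) = i + 1 - (p - j) + 2 by omega]⟩)⟩)
  by_cases hpi : p = i
  · subst hpi
    have e : p + 1 - (p - j) = j + 1 := by omega
    rw [e] at h0
    exact fill_eq_zero_of_miss hx hj hp hv le_rfl
      (mem_image_skips.2 (Or.inl ⟨by omega, h0⟩)) hm (Finset.mem_insert_self _ _) k1 k2 c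
  · have k0 : i ∈ (a.image (skips (j + 2) (p - j))).image (dup j) :=
      mem_image_dup.2 (Or.inr ⟨by omega, mem_image_skips.2 (Or.inr ⟨by omega, h0⟩)⟩)
    by_cases hj1 : j + 1 ∈ a.image (skips (j + 2) (p - j))
    · exact fill_eq_zero_of_miss hx hj hp hv hi hj1 hm (Finset.mem_insert_of_mem k0) k1 k2 c
    · rw [fill_of_notMem hx.toIsO hj1]
      exact hv _ k0 k1 k2 c

theorem van_coface_self (hv : Van j x) :
    Van j (coface n m j (j + 1) x) := by
  intro a h0 h1 h2 c
  unfold coface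
  rw [mface_iterate]
  have hm := miss_image_skips (Nat.le_succ j) a
  rw [show j + 1 - j = 1 by omega] at *
  by_cases hb : a.image (skips (j + 2) 1) ⊆ Finset.range (m + 2)
  swap
  · exact fill_of_not_subset hb c
  have hm : Miss j (j + 1) (a.image (skips (j + 2) 1)) := by
    have := miss_image_skips (Nat.le_succ j) a
    rwa [show j.succ - j = 1 by omega] at this
  have k0 : j ∈ a.image (skips (j + 2) 1) := mem_image_skips.2 (Or.inl ⟨by omega, h0⟩)
  rw [fill_of_mem_of_mem hb k0 (mem_image_skips.2 (Or.inl ⟨by omega, h1⟩)) hm]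
  refine botPart_eq_zero (hv _ (Finset.mem_insert_of_mem (mem_image_dup.2 (Or.inl ⟨le_rfl, k0⟩)))
    (Finset.mem_insert_self _ _) (Finset.mem_insert_of_mem (mem_image_dup.2 (Or.inr ⟨by omega, ?_⟩)))
    c)
  exact mem_image_skips.2 (Or.inr ⟨by omega, h2⟩)

/-- Exchange with `c = i + 2` expresses a zero value as the sum of the wanted value and a defect.
Both are nonnegative, so both vanish. -/
theorem van_coface_pred {i : ℕ} (hx : Cls n m p x) (hj : i + 1 < p) (hp : p ≤ m)
    (hd : Dep n p (i + 2) x) (hv : Van i x) : Van i (coface n m (i + 1) p x) := by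
  intro a h0 h1 h2 c
  unfold coface
  rw [mface_iterate]
  have hm := miss_image_skips hj.le a
  by_cases hb : a.image (skips (i + 1 + 2) (p - (i + 1))) ⊆ Finset.range (m + 2)
  swap
  · exact fill_of_not_subset hb c
  have k0 : i ∈ a.image (skips (i + 1 + 2) (p - (i + 1))) :=
    mem_image_skips.2 (Or.inl ⟨by omega, h0⟩)
  have k1 : i + 1 ∈ a.image (skips (i + 1 + 2) (p - (i + 1))) :=
    mem_image_skips.2 (Or.inl ⟨by omega, h1⟩)
  rw [fill_of_mem_of_mem hb k1 (mem_image_skips.2 (Or.inl ⟨by omega, h2⟩)) hm]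
  have hA := image_dup_subset (j := i + 1) (by omega) hb
  have l0 : i ∈ (a.image (skips (i + 1 + 2) (p - (i + 1)))).image (dup (i + 1)) :=
    mem_image_dup.2 (Or.inl ⟨by omega, k0⟩)
  have l1 : i + 1 ∈ (a.image (skips (i + 1 + 2) (p - (i + 1)))).image (dup (i + 1)) :=
    mem_image_dup.2 (Or.inl ⟨by omega, k1⟩)
  have lm : ∀ v ∈ (a.image (skips (i + 1 + 2) (p - (i + 1)))).image (dup (i + 1)),
      v ≤ i + 1 ∨ p < v := by
    intro v hv
    by_contra hv'
    exact hm.notMem_image (by omega) (by omega) hv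
  set a' := (a.image (skips (i + 1 + 2) (p - (i + 1)))).image (dup (i + 1)) with ha'
  clear_value a'
  by_cases hp2 : p = i + 2
  · refine botPart_eq_zero (hv _ (Finset.mem_insert_of_mem l0) (Finset.mem_insert_of_mem l1) ?_ c)
    rw [hp2]
    exact Finset.mem_insert_self _ _
  have hex := hd.exchange hx.toIsO (a := insert (i + 2) (insert p a'))
    (Finset.insert_subset (Finset.mem_range.2 (by omega))
      (Finset.insert_subset (Finset.mem_range.2 (by omega)) hA))
    (Finset.mem_insert_of_mem (Finset.mem_insert_self _ _)) (Finset.mem_insert_self _ _) le_rfl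
    (by omega) (fun v hv => ?_) c
  · have hn : i + 2 ∉ insert p a' := by
      rw [Finset.mem_insert]
      rintro (h | h)
      · omega
      · have := lm _ h
        omega
    rw [Finset.erase_insert hn] at hex
    have h3 : botPart n p x ((insert (i + 2) (insert p a')).erase p) c = 0 := by
      refine botPart_eq_zero (hv _ ?_ ?_ ?_ c)
      · exact Finset.mem_erase.2 ⟨by omega, by simp [l0]⟩
      · exact Finset.mem_erase.2 ⟨by omega, by simp [l1]⟩
      · exact Finset.mem_erase.2 ⟨by omega, by simp⟩
    have h4 := hx.botPart_nonneg p (insert p a') c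
    have h5 := hx.defect_nonneg p (insert (i + 2) (insert p a')) c
    omega
  · simp only [Finset.mem_insert] at hv
    rcases hv with rfl | rfl | hv
    · omega
    · omega
    · have := lm v hv
      omega

theorem van_coface_pred_pred {i : ℕ} (hx : Cls n m p x) (hj : i + 2 < p)
    (hv : Van i x) : Van i (coface n m (i + 2) p x) := by
  intro a h0 h1 h2 c
  unfold coface
  rw [mface_iterate]
  have hm := miss_image_skips hj.le a
  set b := a.image (skips (i + 2 + 2) (p - (i + 2))) with hb'
  have k0 : i ∈ b := mem_image_skips.2 (Or.inl ⟨by omega, h0⟩)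
  have k1 : i + 1 ∈ b := mem_image_skips.2 (Or.inl ⟨by omega, h1⟩)
  have k2 : i + 2 ∈ b := mem_image_skips.2 (Or.inl ⟨by omega, h2⟩)
  have l0 : i ∈ b.image (dup (i + 2)) := mem_image_dup.2 (Or.inl ⟨by omega, k0⟩)
  have l1 : i + 1 ∈ b.image (dup (i + 2)) := mem_image_dup.2 (Or.inl ⟨by omega, k1⟩)
  have l2 : i + 2 ∈ b.image (dup (i + 2)) := mem_image_dup.2 (Or.inl ⟨by omega, k2⟩)
  by_cases hb : b ⊆ Finset.range (m + 2)
  swap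
  · exact fill_of_not_subset hb c
  by_cases h3 : i + 2 + 1 ∈ b
  · rw [fill_of_mem_of_mem hb k2 h3 hm]
    exact botPart_eq_zero (hv _ (Finset.mem_insert_of_mem l0) (Finset.mem_insert_of_mem l1)
      (Finset.mem_insert_of_mem l2) c)
  · rw [fill_of_notMem hx.toIsO h3]
    exact hv _ l0 l1 l2 c

/-- This serves to show that the elements arising at `f = i + 2` satisfy `Whisk i`: with `z` the
face opposite `i + 2`, the filler of `z` at `i + 1` will be the required `D₀`. If a simplex has one
vertex in the critical interval, the value of `z` is exactly the `botPart` that the second filler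
subtracts; if it has more, `z` inherits a zero from `x`. -/
theorem van_mface_fill_mface_fill {i : ℕ} (hx : Cls n m p x) (hj : i + 2 < p) (hp : p ≤ m)
    (hd : Dep n p (i + 3) x) (hv : Van i x) :
    Van i (mface (i + 1) (fill n m (i + 1) p (mface (i + 2) (fill n m (i + 2) p x)))) := by
  have hz : Cls n m p (mface (i + 2) (fill n m (i + 2) p x)) :=
    (fill_cls hx hj hp hd).mface_lt hj.le
  have hzn : ∀ a c, x a c = 0 → (∃ v ∈ a, i + 3 ≤ v ∧ v ≤ p) →
      mface (i + 2) (fill n m (i + 2) p x) a c = 0 := fun a c h h' =>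
    mface_fill_eq_zero hx hj hp hd h (Or.inr h')
  have hz1 : ∀ a c, i + 2 ∉ a → mface (i + 2) (fill n m (i + 2) p x) a c = x a c := by
    intro a c ha
    unfold mface
    rw [fill_of_notMem hx.toIsO, image_dup_image_skip _ (Or.inl rfl)]
    rw [mem_image_skip]
    simp [ha]
  have hz2 : ∀ a c, i ∈ a → i + 1 ∈ a → i + 2 ∈ a → (∀ u ∈ a, u ≤ i + 2 ∨ p < u) →
      mface (i + 2) (fill n m (i + 2) p x) a c = botPart n p x ((insert p a).erase (i + 2)) c := by
    intro a c h0 h1 h2 ha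
    have l0 := Finset.mem_insert_of_mem (b := p) h0
    have l1 := Finset.mem_insert_of_mem (b := p) h1
    have l2 := Finset.mem_insert_of_mem (b := p) h2
    by_cases hb : a.image (skip (i + 2)) ⊆ Finset.range (m + 2)
    · unfold mface
      rw [fill_of_miss hx hj hp hb (notMem_image_skip _ _)
        (mem_image_skip.2 (Or.inr ⟨by omega, by simpa using h2⟩)) ?_,
        image_dup_image_skip _ (Or.inl rfl), defect_eq_zero, add_zero]
      · exact hv _ l0 l1 l2
      · exact fun v _ hpv b => topPart_eq_zero (hv _
          (Finset.mem_erase.2 ⟨by omega, l0⟩) (Finset.mem_erase.2 ⟨by omega, l1⟩)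
          (Finset.mem_erase.2 ⟨by omega, l2⟩) b)
      · intro v hv
        rcases mem_image_skip.1 hv with ⟨h3, h4⟩ | ⟨h3, h4⟩
        · omega
        · have := ha _ h4
          omega
    · have hsub : ¬ a ⊆ Finset.range (m + 1) := fun h => hb (by
        rw [subset_range_iff] at h ⊢
        intro k hk
        rcases mem_image_skip.1 hk with ⟨h3, h4⟩ | ⟨h3, h4⟩
        · have := h _ h4
          omega
        · have := h _ h4
          omega)
      unfold mface
      rw [fill_of_not_subset hb]
      symm
      apply botPart_eq_zero
      by_contra hne
      have h3 := hx.supp_left _ _ hne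
      apply hsub
      intro v hv
      by_cases e : v = i + 2
      · exact Finset.mem_range.2 (by omega)
      · exact h3 (Finset.mem_erase.2 ⟨e, Finset.mem_insert_of_mem hv⟩)
  generalize mface (i + 2) (fill n m (i + 2) p x) = z at hz hzn hz1 hz2
  intro a h0 h1 h2 c
  unfold mface
  have himg := image_dup_image_skip (i := i + 1) (j := i + 1) a (Or.inl rfl)
  have k0 : i + 1 ∉ a.image (skip (i + 1)) := notMem_image_skip _ _
  have k1 : i + 1 + 1 ∈ a.image (skip (i + 1)) :=
    mem_image_skip.2 (Or.inr ⟨by omega, by simpa using h1⟩)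
  have k2 : i + 3 ∈ a.image (skip (i + 1)) :=
    mem_image_skip.2 (Or.inr ⟨by omega, by simpa using h2⟩)
  set b := a.image (skip (i + 1)) with hb'
  by_cases hb : b ⊆ Finset.range (m + 2)
  swap
  · exact fill_of_not_subset hb c
  rcases miss_or b (i + 1) p with hm | ⟨hv, h⟩ | ⟨v, hv', hv1, hv2, h⟩ |
    ⟨u, hu, v, hv', huv, hu1, hv2⟩
  · have := hm _ k2
    omega
  · have := h _ k2
    omega
  · obtain rfl : i + 3 = v := by have := h _ k2; omega
    have ha : ∀ u ∈ a, u ≤ i + 2 ∨ p < u := by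
      intro u hu
      by_contra hu'
      have := h (u + 1) (mem_image_skip.2 (Or.inr ⟨by omega, by simpa using hu⟩))
      omega
    rw [fill_of_unique hb k0 k1 hv' hv1 (by omega) h, himg, hz2 a c h0 h1 h2 ha,
      Finset.erase_insert_of_ne (by omega)]
    have e : botPart n p z (insert p (a.erase (i + 3 - 1))) c =
        botPart n p x (insert p (a.erase (i + 2))) c := by
      unfold botPart
      rw [show i + 3 - 1 = i + 2 by omega, hz1]
      rw [Finset.mem_insert, Finset.mem_erase]
      rintro (h | ⟨h, -⟩)
      · omega
      · exact h rfl
    rw [e, sub_self]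
  · rw [fill_of_two hb k0 hu hv' huv.ne hu1 (by omega) (by omega) hv2, himg]
    refine hzn a c (hv a h0 h1 h2 c) ⟨v - 1, ?_, by omega, by omega⟩
    rcases mem_image_skip.1 hv' with ⟨h3, h4⟩ | ⟨h3, h4⟩
    · omega
    · exact h4

/-! ### Naturality of the filler -/

theorem skip_lt_iff (k u v : ℕ) : skip k u < skip k v ↔ u < v := by
  unfold skip
  split_ifs <;> omega

theorem sgn_image_skip (k : ℕ) (b : Finset ℕ) (v : ℕ) :
    sgn (b.image (skip k)) (skip k v) = sgn b v := by
  unfold sgn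
  rw [Finset.filter_image, Finset.card_image_of_injective _ (skip_injective k)]
  simp only [skip_lt_iff]

theorem alt_mface (k : ℕ) (x : Mat) (a b : Finset ℕ) :
    alt (mface k x) a b = alt x (a.image (skip k)) b := by
  unfold alt
  rw [Finset.sum_image (fun u _ v _ h => skip_injective k h)]
  refine Finset.sum_congr rfl fun v _ => ?_
  rw [sgn_image_skip]
  unfold mface
  rw [Finset.image_erase (skip_injective k)]

/-- Deleting a vertex of the missed interval commutes with the homotopy and with `s_j`, so the
filler is natural for these faces. -/
theorem mface_fill {i : ℕ} (hji : j < i) (hip : i ≤ p) (hp : p ≤ m) :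
    mface (i + 1) (fill n (m + 1) j (p + 1) x) = fill n m j p (mface i x) := by
  have hH : fillHomotopy n j p (mface i x) = mface (i + 1) (fillHomotopy n j (p + 1) x) := by
    funext b c
    unfold mface fillHomotopy
    have e1 : j + 1 ∈ b.image (skip (i + 1)) ↔ j + 1 ∈ b := by
      rw [mem_image_skip]
      constructor
      · rintro (⟨h1, h2⟩ | ⟨h1, h2⟩)
        · exact h2
        · omega
      · exact fun h => Or.inl ⟨by omega, h⟩
    have e2 : j ∈ b.image (skip (i + 1)) ↔ j ∈ b := by
      rw [mem_image_skip]
      constructor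
      · rintro (⟨h1, h2⟩ | ⟨h1, h2⟩)
        · exact h2
        · omega
      · exact fun h => Or.inl ⟨by omega, h⟩
    have e3 : Miss j (p + 1) (b.image (skip (i + 1))) ↔ Miss j p b := by
      unfold Miss
      rw [Finset.forall_mem_image]
      refine forall₂_congr fun v _ => ?_
      unfold skip
      split_ifs <;> omega
    have e4 : sgn (b.image (skip (i + 1))) j = sgn b j := by
      have := sgn_image_skip (i + 1) b j
      rwa [skip, if_pos (by omega)] at this
    have e5 : insert (p + 1) ((b.image (skip (i + 1))).image (dup j)) =
        (insert p (b.image (dup j))).image (skip i) := by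
      rw [Finset.image_insert, Finset.image_image, Finset.image_image]
      congr 1
      · unfold skip
        rw [if_neg (by omega)]
      · congr 1
        funext v
        simp only [Function.comp, skip, dup]
        split_ifs <;> omega
    have e6 := botPart_mface (n := n) (x := x) (i := i) (p := p) (by omega)
      (insert p (b.image (dup j))) c
    unfold mface at e6
    by_cases h : j + 1 ∈ b ∧ j ∉ b ∧ Miss j p b
    · rw [if_pos h, if_pos ⟨e1.2 h.1, fun h' => h.2.1 (e2.1 h'), e3.2 h.2.2⟩, e4, e5, e6]
    · rw [if_neg h, if_neg fun h' => h ⟨e1.1 h'.1, fun h'' => h'.2.1 (e2.2 h''), e3.1 h'.2.2⟩]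
  funext b c
  have hs : b.image (skip (i + 1)) ⊆ Finset.range (m + 1 + 2) ↔ b ⊆ Finset.range (m + 2) := by
    rw [subset_range_iff, subset_range_iff, Finset.forall_mem_image]
    refine forall₂_congr fun v _ => ?_
    unfold skip
    split_ifs <;> omega
  unfold fill
  rw [hH, alt_mface, ← mface_mdeg_gt hji]
  unfold mface
  simp only [hs]

end

end Oriental

end

/-! ### Faces of iterated wedges -/

noncomputable section

namespace WedgeData

variable {U : WedgeData.{u}}

theorem IsG.face_lt (hU : U.IsComplicial) {j s k : ℕ} {Y X W : U.E}
    (h : U.IsG (j + 1) s Y X W) (hk : k ≤ j) (hW : j + s + 2 ≤ W.1) :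
    U.IsG j s (U.D k Y) (U.D k X) (U.D k W) := by
  induction s generalizing X W with
  | zero =>
    obtain ⟨rfl, rfl⟩ := h
    exact ⟨rfl, (D_D hU hk (by omega) (by omega)).symm⟩
  | succ s ih =>
    obtain ⟨h1, h2, h3⟩ := h
    have hd := dim_D (U := U) (i := j + 1 + 2) (e := W) (by omega) (by omega)
    have hX := dim_D (U := U) (i := j + 1) (e := W) (by omega) (by omega)
    rw [h2] at hX
    refine ⟨h1.D_lt hU hk, ?_, ?_⟩
    · rw [← h2, D_D hU hk (by omega) (by omega)]
    · have := ih h3 (by omega)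
      rwa [D_D hU (by omega) (by omega) (by omega), D_D hU (by omega) (by omega) (by omega)] at this

/-- A face opposite a vertex of the block `j + 2, …, j + s + 2` uses up one wedge and leaves `Y`
unchanged; faces opposite smaller or larger vertices act on both ingredients. -/
theorem IsG.face_mid (hU : U.IsComplicial) {j s k : ℕ} {Y X W : U.E}
    (h : U.IsG j (s + 1) Y X W) (hk : j + 1 ≤ k) (hk' : k ≤ j + s + 1) (hW : j + s + 2 ≤ W.1) :
    U.IsG j s Y (U.D k X) (U.D (k + 1) W) := by
  induction s generalizing X W k with
  | zero =>
    obtain rfl : k = j + 1 := by omega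
    exact h.2.2
  | succ s ih =>
    obtain ⟨h1, h2, h3⟩ := h
    by_cases hkj : k = j + 1
    · subst hkj
      exact h3
    obtain ⟨k, rfl⟩ : ∃ l, k = l + 1 := ⟨k - 1, by omega⟩
    have hd := dim_D (U := U) (i := j + 2) (e := W) (by omega) (by omega)
    have hX := dim_D (U := U) (i := j) (e := W) (by omega) (by omega)
    rw [h2] at hX
    refine ⟨h1.D_gt hU (by omega) (by omega), ?_, ?_⟩
    · rw [← h2, D_D hU (by omega) (by omega) (by omega)]
    · have := ih (k := k) h3 (by omega) (by omega) (by omega)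
      rwa [← D_D hU (e := X) (by omega) (by omega) (by omega),
        ← D_D hU (e := W) (by omega) (by omega) (by omega)]
        at this

theorem IsG.face_gt (hU : U.IsComplicial) {j s k : ℕ} {Y X W : U.E}
    (h : U.IsG j s Y X W) (hk : j + s + 1 ≤ k) (hW : k + 1 ≤ W.1) :
    U.IsG j s (U.D (k + 1 - s) Y) (U.D k X) (U.D (k + 1) W) := by
  induction s generalizing X W k with
  | zero =>
    obtain ⟨rfl, rfl⟩ := h
    exact ⟨rfl, D_D hU (by omega) hW (by omega)⟩
  | succ s ih =>
    obtain ⟨h1, h2, h3⟩ := h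
    obtain ⟨k, rfl⟩ : ∃ l, k = l + 1 := ⟨k - 1, by omega⟩
    have hd := dim_D (U := U) (i := j + 2) (e := W) (by omega) (by omega)
    have hX := dim_D (U := U) (i := j) (e := W) (by omega) (by omega)
    rw [h2] at hX
    refine ⟨h1.D_gt hU (by omega) (by omega), ?_, ?_⟩
    · rw [← h2, D_D hU (by omega) (by omega) (by omega)]
    · have := ih (k := k) h3 (by omega) (by omega)
      rwa [← D_D hU (e := X) (by omega) (by omega) (by omega),
        ← D_D hU (e := W) (by omega) (by omega) (by omega),
        show k + 1 - s = k + 1 + 1 - (s + 1) by omega] at this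

theorem IsG.th_D (hU : U.IsComplicial) {i s : ℕ} {Y X W : U.E}
    (h : U.IsG (i + 1) (s + 1) Y X W) (hY : U.Th i Y) : U.Th i (U.D (i + 3) W) :=
  h.2.2.th_pred hU hY

end WedgeData

namespace Oriental

/-! ### Iterated faces -/

theorem mface_iterate_mface {i j : ℕ} (h : i ≤ j) (q : ℕ) (x : Mat) :
    mface i ((mface (j + 1))^[q] x) = (mface j)^[q] (mface i x) := by
  induction q generalizing x with
  | zero => rfl
  | succ q ih =>
    rw [Function.iterate_succ_apply, Function.iterate_succ_apply, ih, mface_mface h]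

theorem iterate_mface_mid {j k q : ℕ} (hk : j ≤ k) (hk' : k ≤ j + q) (x : Mat) :
    (mface j)^[q] (mface k x) = (mface j)^[q + 1] x := by
  induction q generalizing x k with
  | zero =>
    obtain rfl : k = j := by omega
    rfl
  | succ q ih =>
    by_cases hkj : k = j
    · subst hkj
      rw [← Function.iterate_succ_apply]
    obtain ⟨k, rfl⟩ : ∃ l, k = l + 1 := ⟨k - 1, by omega⟩
    rw [Function.iterate_succ_apply, mface_mface (by omega), ih (by omega) (by omega),
      ← Function.iterate_succ_apply]

theorem iterate_mface_gt {j k q : ℕ} (hk : j + q ≤ k) (x : Mat) :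
    (mface j)^[q] (mface k x) = mface (k - q) ((mface j)^[q] x) := by
  induction q generalizing x k with
  | zero => rfl
  | succ q ih =>
    obtain ⟨k, rfl⟩ : ∃ l, k = l + 1 := ⟨k - 1, by omega⟩
    rw [Function.iterate_succ_apply, mface_mface (by omega), ih (by omega),
      ← Function.iterate_succ_apply, show k + 1 - (q + 1) = k - q by omega]

/-- The matrices that correspond to iterated wedges. -/
def IVan (j s : ℕ) (x : Mat) : Prop := ∀ q < s, Van j ((mface (j + 2))^[q] x)

theorem IVan.face_lt {j s k : ℕ} {x : Mat} (h : IVan (j + 1) s x) (hk : k ≤ j) :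
    IVan j s (mface k x) := fun q hq => by
  rw [← mface_iterate_mface (by omega)]
  exact (h q hq).mface_lt hk

theorem IVan.face_mid {j s k : ℕ} {x : Mat} (h : IVan j (s + 1) x) (hk : j + 2 ≤ k) :
    IVan j s (mface k x) := fun q hq => by
  by_cases hkq : k ≤ j + 2 + q
  · rw [iterate_mface_mid hk hkq]
    exact h _ (by omega)
  · rw [iterate_mface_gt (by omega)]
    exact (h q (by omega)).mface_gt (by omega)

theorem IVan.face_gt {j s k : ℕ} {x : Mat} (h : IVan j s x) (hk : j + s + 2 ≤ k) :
    IVan j s (mface k x) := fun q hq => by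
  rw [iterate_mface_gt (by omega)]
  exact (h q (by omega)).mface_gt (by omega)

theorem ivan_fill {n m j p : ℕ} (x : Mat) : IVan j (p - j) (fill n m j p x) :=
  fun _ hq => van_iterate_fill (by omega)

theorem Cls.iterate {n m k s : ℕ} {x : Mat} (h : Cls n (m + s) (k + s) x) :
    Cls n m k ((mface k)^[s] x) := by
  induction s generalizing x with
  | zero => exact h
  | succ s ih => exact ih (Cls.mface_lt (m := m + s) (p := k + s) h (by omega))

/-- The rank becomes `m - p`, one less than that of `x`, so the coface belongs to an earlier stage.
-/
theorem coface_cls {n m j p : ℕ} {x : Mat} (hx : Cls n m p x) (hj : j < p) (hp : p ≤ m)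
    (hd : Dep n p (j + 1) x) : Cls n (m + 1 - (p - j)) (j + 2) (coface n m j p x) := by
  obtain ⟨s, rfl⟩ : ∃ s, p = j + 1 + s := ⟨p - j - 1, by omega⟩
  obtain ⟨l, rfl⟩ : ∃ l, m = j + 1 + s + l := ⟨m - (j + 1 + s), by omega⟩
  have h := fill_cls hx hj hp hd
  rw [show j + 1 + s + l + 1 = j + 1 + l + 1 + s by omega,
    show j + 1 + s + 1 = j + 2 + s by omega] at h
  -- All but one of the `p - j` deleted vertices precede those sent to `n` and lower the class to `j
  -- + 2`. The last deletion removes a vertex that is sent to `n`.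
  unfold coface
  rw [show j + 1 + s + l + 1 - (j + 1 + s - j) = j + 1 + l by omega,
    show j + 1 + s - j = s + 1 by omega, Function.iterate_succ_apply']
  exact h.iterate.mface_ge le_rfl (by omega)

/-! ### Matrices that are degenerate at the last place -/

section
variable {n m p : ℕ} {x : Mat}

/-- A simplex with `p`, a smaller and a larger vertex is killed by `Dep n p 0`, because `botPart` is
everything there. A simplex without `p` is treated by inserting `p`; faces without small vertices
are covered by `Cls.eq_zero_of_ge`. -/
theorem Cls.eq_zero_of_dep (hx : Cls n m p x) (hd : Dep n p 0 x) {a : Finset ℕ} {u v : ℕ}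
    (hu : u ∈ a) (hv : v ∈ a) (huv : u < v) (hpu : p ≤ u) (b : Finset ℕ) : x a b = 0 := by
  by_cases ha : a ⊆ Finset.range (m + 1)
  swap
  · by_contra hne
    exact ha (hx.supp_left _ _ hne)
  by_cases hlow : ∃ w ∈ a, w < p
  swap
  · push Not at hlow
    exact hx.eq_zero_of_ge hlow (Finset.one_lt_card.2 ⟨u, hu, v, hv, huv.ne⟩) b
  obtain ⟨w, hw, hwp⟩ := hlow
  have key : ∀ a : Finset ℕ, p ∈ a → (∃ v ∈ a, p < v) → (∃ w ∈ a, w < p) → ∀ b, x a b = 0 := by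
    rintro a hp ⟨v, hv, hpv⟩ ⟨w, hw, hwp⟩ b
    rw [← botPart_of_lt (n := n) (x := x) hv hpv]
    exact hd a hp ⟨w, hw, Nat.zero_le _, hwp⟩ b
  by_cases hpa : p ∈ a
  · exact key a hpa ⟨v, hv, by omega⟩ ⟨w, hw, hwp⟩ b
  have hpu' : p ≠ u := fun e => hpa (e ▸ hu)
  have hvm := Finset.mem_range.1 (ha hv)
  refine hx.eq_zero_of_insert (v := p) (by omega) hpa
    (key _ (Finset.mem_insert_self _ _) ⟨v, Finset.mem_insert_of_mem hv, by omega⟩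
      ⟨w, Finset.mem_insert_of_mem hw, hwp⟩) (fun t ht b => ?_) b
  have hpt : p ∈ (insert p a).erase t :=
    Finset.mem_erase.2 ⟨fun e => hpa (e ▸ ht), Finset.mem_insert_self _ _⟩
  have hbig : ∃ v ∈ (insert p a).erase t, p < v := by
    by_cases htv : t = v
    · exact ⟨u, Finset.mem_erase.2 ⟨by omega, Finset.mem_insert_of_mem hu⟩, by omega⟩
    · exact ⟨v, Finset.mem_erase.2 ⟨Ne.symm htv, Finset.mem_insert_of_mem hv⟩, by omega⟩
  by_cases hsmall : ∃ w ∈ (insert p a).erase t, w < p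
  · exact key _ hpt hbig hsmall b
  · push Not at hsmall
    obtain ⟨v', hv', hpv'⟩ := hbig
    exact hx.eq_zero_of_ge hsmall (Finset.one_lt_card.2 ⟨p, hpt, v', hv', hpv'.ne⟩) b

/-- In the boundary of `insert v (insert p a)` only the faces opposite `v` and `p` can be nonzero,
and their signs are opposite. So the vertices from `p` onwards are interchangeable. -/
theorem Cls.insert_eq_of_dep (hx : Cls n m p x) (hd : Dep n p 0 x) {a : Finset ℕ}
    (ha : ∀ w ∈ a, w < p) {v : ℕ} (hv : p ≤ v) (hvm : v ≤ m) (b : Finset ℕ) :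
    x (insert v a) b = x (insert p a) b := by
  obtain rfl | hpv := hv.eq_or_lt
  · rfl
  rcases a.eq_empty_or_nonempty with rfl | ⟨w, hw⟩
  · simp only [insert_empty_eq]
    rw [hx.vertex_eq hv hvm, hx.vertex_eq le_rfl (by omega)]
  have hpa : p ∉ a := fun h => (ha p h).ne rfl
  have hva : v ∉ a := fun h => by have := ha v h; omega
  have hvA : v ∉ insert p a := by
    rw [Finset.mem_insert]
    rintro (h | h)
    · omega
    · exact hva h
  have hA : insert v (insert p a) ⊆ Finset.range (m + 1) := by
    refine Finset.insert_subset (Finset.mem_range.2 (by omega))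
      (Finset.insert_subset (Finset.mem_range.2 (by omega)) fun u hu => ?_)
    have := ha u hu
    exact Finset.mem_range.2 (by omega)
  have h1 := hx.chain _ hA b
  have hpA : p ∈ insert v (insert p a) := Finset.mem_insert_of_mem (Finset.mem_insert_self _ _)
  rw [bd_zero (hx.eq_zero_of_dep hd hpA (Finset.mem_insert_self v _) hpv le_rfl) b] at h1
  unfold alt at h1
  have hs : sgn (insert v (insert p a)) v = - sgn (insert v (insert p a)) p := by
    refine sgn_eq_neg_of_adjacent hpA hpv fun u hu => ?_
    simp only [Finset.mem_insert] at hu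
    rcases hu with rfl | rfl | hu
    · omega
    · omega
    · have := ha u hu
      omega
  rw [Finset.sum_insert hvA, Finset.sum_insert hpa, hs, Finset.erase_insert hvA,
    Finset.insert_comm, Finset.erase_insert (by
      rw [Finset.mem_insert]
      rintro (h | h)
      · omega
      · exact hpa h), Finset.sum_eq_zero fun u hu => ?_] at h1
  · have h2 : sgn (insert p (insert v a)) p * (x (insert v a) b - x (insert p a) b) = 0 := by
      rw [mul_sub, h1]
      ring
    have := (mul_eq_zero.1 h2).resolve_left (sgn_ne_zero _ _)
    omega
  · have hup := ha u hu
    rw [hx.eq_zero_of_dep hd (u := p) (v := v) (Finset.mem_erase.2 ⟨by omega, by simp⟩)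
      (Finset.mem_erase.2 ⟨by omega, by simp⟩) hpv le_rfl, mul_zero]

theorem image_skip_of_lt {i : ℕ} {a : Finset ℕ} (h : ∀ v ∈ a, v < i) : a.image (skip i) = a := by
  conv_rhs => rw [← Finset.image_id (s := a)]
  refine Finset.image_congr fun k hk => ?_
  have := h k hk
  unfold skip
  rw [if_pos this]
  rfl

theorem Cls.mface_eq_of_dep (hx : Cls n (m + 1) p x) (hd : Dep n p 0 x) {i : ℕ} (hi : p ≤ i)
    (him : i ≤ m + 1) : mface i x = mface (m + 1) x := by
  funext a b
  have h0 : ∀ k, p ≤ k → (∃ u ∈ a, ∃ v ∈ a, u < v ∧ p ≤ u) → mface k x a b = 0 := by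
    rintro k hk ⟨u, hu, v, hv, huv, hpu⟩
    refine hx.eq_zero_of_dep hd (Finset.mem_image_of_mem _ hu) (Finset.mem_image_of_mem _ hv)
      ((skip_lt_iff k u v).2 huv) ?_ b
    unfold skip
    split_ifs <;> omega
  by_cases h : ∃ u ∈ a, ∃ v ∈ a, u < v ∧ p ≤ u
  · rw [h0 i hi h, h0 (m + 1) (by omega) h]
  by_cases hlow : ∀ v ∈ a, v < p
  · unfold mface
    rw [image_skip_of_lt fun v hv => by have := hlow v hv; omega,
      image_skip_of_lt fun v hv => by have := hlow v hv; omega]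
  push Not at hlow h
  obtain ⟨v, hv, hpv⟩ := hlow
  by_cases hvm : v ≤ m
  swap
  · have : ∀ k ≤ m + 1, mface k x a b = 0 := fun k hk => by
      by_contra hne
      exact hvm ((hx.mface hk).le_of_ne hne hv)
    rw [this i him, this (m + 1) le_rfl]
  have hlow' : ∀ w ∈ a.erase v, w < p := by
    intro w hw
    obtain ⟨h1, h2⟩ := Finset.mem_erase.1 hw
    rcases lt_or_gt_of_ne h1 with h3 | h3
    · by_contra hpw
      have := h w h2 v hv h3
      omega
    · have := h v hv w h2 h3
      omega
  have key : ∀ k, p ≤ k → mface k x a b = x (insert p (a.erase v)) b := by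
    intro k hk
    unfold mface
    rw [← Finset.insert_erase hv, Finset.image_insert,
      image_skip_of_lt fun w hw => by have := hlow' w hw; omega, Finset.erase_insert_eq_erase,
      Finset.erase_idem]
    apply hx.insert_eq_of_dep hd hlow' <;> unfold skip <;> split_ifs <;> omega
  rw [key i hi, key (m + 1) (by omega)]

/-- The last two vertices are both sent to `n`, hence interchangeable and never jointly present in a
simplex with nonzero image. -/
theorem Cls.eq_mdeg_of_dep (hx : Cls n (m + 1) p x) (hd : Dep n p 0 x) (hp : p ≤ m) :
    x = mdeg m (mface (m + 1) x) := by
  funext a b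
  by_cases h1 : m + 1 ∈ a
  swap
  · rw [mdeg_apply_of_notMem (Or.inr h1)]
    unfold mface
    rw [image_skip_image_dup h1 (Or.inr rfl)]
  by_cases h0 : m ∈ a
  · rw [mdeg_apply_of_mem h0 h1, hx.eq_zero_of_dep hd h0 h1 (by omega) hp]
  · rw [mdeg_apply_of_notMem (Or.inl h0), ← hx.mface_eq_of_dep hd hp (by omega)]
    unfold mface
    rw [image_skip_image_dup h0 (Or.inl rfl)]

theorem Dep.mface_last (hx : Cls n (m + 1) p x) {f : ℕ} (hd : Dep n p f x) :
    Dep n p f (Oriental.mface (m + 1) x) := by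
  rintro a hpa ⟨v, hv, h1, h2⟩ b
  by_cases ha : a ⊆ Finset.range (m + 1)
  · have e : Oriental.mface (m + 1) x a = x a := by
      unfold Oriental.mface
      rw [image_skip_of_lt fun v hv => Finset.mem_range.1 (ha hv)]
    have := hd a hpa ⟨v, hv, h1, h2⟩ b
    unfold botPart at this ⊢
    rwa [e]
  · apply botPart_eq_zero
    by_contra hne
    exact ha ((hx.toIsO.mface le_rfl).supp_left _ _ hne)

end

end Oriental

end

/-! ### Extension by one step of the filtration -/

noncomputable section

namespace Oriental

open WedgeData

/-- A function on a class of matrices, with values in a set with complicial identities, that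
respects faces, thinness and degeneracy at the last place. -/
structure FaceThin (n : ℕ) (U : WedgeData.{u}) (K : ℕ → Mat → Prop) (Φ : ℕ → Mat → U.E) : Prop where
  closed : ∀ {m i x}, K (m + 1) x → i ≤ m + 1 → K m (mface i x)
  dim : ∀ {m x}, K m x → (Φ m x).1 = m
  face : ∀ {m i x}, K (m + 1) x → i ≤ m + 1 → U.D i (Φ (m + 1) x) = Φ m (mface i x)
  thin : ∀ {m i x}, K m x → i + 2 ≤ m → Van i x → U.Th i (Φ m x)
  deg : ∀ {m p x}, K (m + 1) x → Cls n (m + 1) p x → p ≤ m → Dep n p 0 x →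
    Φ (m + 1) x = U.S m (Φ m (mface (m + 1) x))

section
variable {n : ℕ} {U : WedgeData.{u}} {K : ℕ → Mat → Prop} {Φ : ℕ → Mat → U.E}

theorem FaceThin.closed_iterate (h : FaceThin n U K Φ) {m k q : ℕ} {x : Mat} (hx : K (m + q) x)
    (hk : k ≤ m + 1) : K m ((mface k)^[q] x) := by
  induction q generalizing x with
  | zero => exact hx
  | succ q ih => exact ih (h.closed hx (by omega))

theorem FaceThin.face_iterate (h : FaceThin n U K Φ) {m k q : ℕ} {x : Mat} (hx : K (m + q) x)
    (hk : k ≤ m + 1) : (U.D k)^[q] (Φ (m + q) x) = Φ m ((mface k)^[q] x) := by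
  induction q generalizing x with
  | zero => rfl
  | succ q ih =>
    rw [Function.iterate_succ_apply, Function.iterate_succ_apply]
    have := h.face (i := k) (m := m + q) hx (by omega)
    rw [show m + (q + 1) = m + q + 1 by omega, this]
    exact ih (h.closed hx (by omega))

theorem FaceThin.isG (h : FaceThin n U K Φ) {m j s : ℕ} {x : Mat} (hx : K (m + 1) x)
    (hj : j + s ≤ m) (hv : IVan j s x) :
    U.IsG j s (Φ (m + 1 - s) ((mface (j + 2))^[s] x)) (Φ m (mface j x)) (Φ (m + 1) x) := by
  induction s generalizing m x with
  | zero => exact ⟨rfl, h.face hx (by omega)⟩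
  | succ s ih =>
    obtain ⟨m, rfl⟩ : ∃ l, m = l + 1 := ⟨m - 1, by omega⟩
    refine ⟨h.thin hx (by omega) (hv 0 (by omega)), h.face hx (by omega), ?_⟩
    have := ih (m := m) (x := mface (j + 2) x) (h.closed hx (by omega)) (by omega)
      (fun q hq => by
        rw [← Function.iterate_succ_apply]
        exact hv _ (by omega))
    rw [h.face hx (by omega), h.face (h.closed hx (by omega)) (by omega),
      ← mface_mface (by omega), Function.iterate_succ_apply,
      show m + 1 + 1 - (s + 1) = m + 1 - s by omega]
    exact this

end

/-- The filtration of the set of all matrices. -/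
def Cl (n r f m : ℕ) (x : Mat) : Prop :=
  ∃ p, Cls n m p x ∧ (m + 1 < r + p ∨ (m + 1 = r + p ∧ Dep n p f x))

/-- A face opposite a vertex below `p` keeps the rank and the dependence condition; a face opposite
a vertex from `p` onwards lowers the rank. -/
theorem Cl.mface {n r f m i : ℕ} {x : Mat} (h : Cl n r f (m + 1) x) (hi : i ≤ m + 1) :
    Cl n r f m (mface i x) := by
  obtain ⟨p, hx, h⟩ := h
  by_cases hip : i < p
  · obtain ⟨p, rfl⟩ : ∃ l, p = l + 1 := ⟨p - 1, by omega⟩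
    refine ⟨p, hx.mface_lt (by omega), ?_⟩
    rcases h with h | ⟨h, h'⟩
    · exact Or.inl (by omega)
    · exact Or.inr ⟨by omega, h'.mface (by omega)⟩
  · exact ⟨p, hx.mface_ge (by omega) hi, Or.inl (by omega)⟩

theorem Cl.succ {n r f m : ℕ} {x : Mat} (h : Cl n r f m x) : Cl n r (f + 1) m x := by
  obtain ⟨p, hx, h⟩ := h
  exact ⟨p, hx, h.imp id fun h => ⟨h.1, h.2.mono (by omega)⟩⟩

section
variable {n r f : ℕ} {U : WedgeData.{u}} {Φ : ℕ → Mat → U.E}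

theorem fill_cl {m p : ℕ} {x : Mat} (hx : Cls n m p x) (hm : m + 1 = r + p) (hf : f < p)
    (hp : p ≤ m) (hd : Dep n p f x) : Cl n r f (m + 1) (fill n m f p x) :=
  ⟨p + 1, fill_cls hx hf hp (hd.mono (by omega)), Or.inr ⟨by omega, fill_dep hx hf hd⟩⟩

/-- The filler satisfies the dependence condition from `f + 1` onwards; deletion of the vertex `f`
shifts this to `f`. -/
theorem mface_fill_cl {m p : ℕ} {x : Mat} (hx : Cls n m p x) (hm : m + 1 = r + p) (hf : f < p)
    (hp : p ≤ m) (hd : Dep n p (f + 1) x) : Cl n r f m (mface f (fill n m f p x)) :=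
  ⟨p, (fill_cls hx hf hp hd).mface_lt (by omega), Or.inr ⟨hm, (fill_dep_succ hx hf hd).mface_lt le_rfl⟩⟩

theorem coface_cl {m p : ℕ} {x : Mat} (hx : Cls n m p x) (hm : m + 1 = r + p) (hf : f < p)
    (hp : p ≤ m) (hd : Dep n p (f + 1) x) :
    Cl n r f (m + 1 - (p - f)) (coface n m f p x) :=
  ⟨f + 2, coface_cls hx hf hp hd, Or.inl (by omega)⟩

/-- Both ingredients of the iterated wedge lie in the earlier stage, and they are compatible because
they are faces of the one filler. -/
theorem exists_rep (hU : U.IsComplicial) (hΦ : FaceThin n U (Cl n r f) Φ) {m p : ℕ} {x : Mat}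
    (hx : Cls n m p x) (hm : m + 1 = r + p) (hf : f < p) (hp : p ≤ m) (hd : Dep n p (f + 1) x) :
    ∃ W : U.E, W.1 = m + 1 ∧ U.IsG f (p - f) (Φ (m + 1 - (p - f)) (coface n m f p x))
      (Φ m (mface f (fill n m f p x))) W := by
  have hz := mface_fill_cl hx hm hf hp hd
  have hy := coface_cl hx hm hf hp hd
  have hdz := hΦ.dim hz
  have hdy := hΦ.dim hy
  obtain ⟨W, hW, hG⟩ := exists_isG hU (j := f) (s := p - f)
    (Y := Φ (m + 1 - (p - f)) (coface n m f p x)) (X := Φ m (mface f (fill n m f p x)))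
    (by omega) (by omega) (by
      obtain ⟨k, hk⟩ : ∃ k, m = k + (p - f) := ⟨m - (p - f), by omega⟩
      have e1 := hΦ.face_iterate (m := k) (k := f + 1) (q := p - f) (by rwa [← hk]) (by omega)
      rw [← hk] at e1
      have e2 : m + 1 - (p - f) = k + 1 := by omega
      rw [e2] at hy ⊢
      rw [e1, hΦ.face hy (by omega)]
      unfold coface
      rw [mface_iterate_mface (by omega)])
  exact ⟨W, by omega, hG⟩

/-- The value at a new `x` is forced to be the face opposite `f + 1` of the iterated wedge. The
class `p` is recovered from the rank as `m + 1 - r`. -/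
theorem exists_step_fun (hΦ : FaceThin n U (Cl n r f) Φ) :
    ∃ Φ' : ℕ → Mat → U.E, (∀ m x, Cl n r f m x → Φ' m x = Φ m x) ∧
      ∀ (m p : ℕ) (x : Mat), Cls n m p x → m + 1 = r + p → f < p → p ≤ m → Dep n p (f + 1) x →
        ∀ W, U.IsG f (p - f) (Φ (m + 1 - (p - f)) (coface n m f p x))
          (Φ m (mface f (fill n m f p x))) W → Φ' m x = U.D (f + 1) W := by
  classical
  refine ⟨fun m x => if Cl n r f m x then Φ m x else
    if h : ∃ W, U.IsG f (m + 1 - r - f) (Φ (m + 1 - (m + 1 - r - f)) (coface n m f (m + 1 - r) x))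
      (Φ m (mface f (fill n m f (m + 1 - r) x))) W then U.D (f + 1) h.choose else Φ m x,
    fun m x h => if_pos h, ?_⟩
  intro m p x hx hm hf hp hd W hW
  dsimp only
  obtain rfl : m + 1 - r = p := by omega
  split_ifs with h1 h2
  -- If `x` belongs to the earlier stage, so does its filler, whose value is then the iterated wedge
  -- by uniqueness.
  · obtain ⟨p', hx', h1⟩ := h1
    have e := hx'.unique hx
    subst e
    have hw := fill_cl hx hm hf hp (h1.resolve_left (by omega)).2
    have e1 := hΦ.isG hw (j := f) (s := m + 1 - r - f) (by omega) (ivan_fill x)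
    rw [hW.unique e1, hΦ.face hw (by omega), mface_fill_succ hx.toIsO]
  · rw [hW.unique h2.choose_spec]
  · exact absurd ⟨W, hW⟩ h2

theorem Cl.cases {m : ℕ} {x : Mat} (h : Cl n r (f + 1) m x) :
    Cl n r f m x ∨ ∃ p, Cls n m p x ∧ m + 1 = r + p ∧ f < p ∧ Dep n p (f + 1) x := by
  obtain ⟨p, hx, h | ⟨h, hd⟩⟩ := h
  · exact Or.inl ⟨p, hx, Or.inl h⟩
  · by_cases hf : f < p
    · exact Or.inr ⟨p, hx, h, hf, hd⟩
    · exact Or.inl ⟨p, hx, Or.inr ⟨h, dep_of_le x (by omega)⟩⟩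

/-- The face opposite `i` of the iterated wedge, or that opposite `i + 1` when `i > f`, is
identified with a known value or with the iterated wedge for `mface i x`. For `i = f` the simplicial
identity moves the computation to the known face opposite `f`. -/
theorem step_face (hU : U.IsComplicial) (hΦ : FaceThin n U (Cl n r f) Φ) (hr : 1 ≤ r)
    {Φ' : ℕ → Mat → U.E} (hA : ∀ m x, Cl n r f m x → Φ' m x = Φ m x)
    (hB : ∀ (m p : ℕ) (x : Mat), Cls n m p x → m + 1 = r + p → f < p → p ≤ m →
      Dep n p (f + 1) x → ∀ W, U.IsG f (p - f) (Φ (m + 1 - (p - f)) (coface n m f p x))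
        (Φ m (mface f (fill n m f p x))) W → Φ' m x = U.D (f + 1) W)
    {m i p : ℕ} {x : Mat} (hx : Cls n (m + 1) p x) (hm : m + 2 = r + p) (hf : f < p)
    (hd : Dep n p (f + 1) x) (hi : i ≤ m + 1) :
    U.D i (Φ' (m + 1) x) = Φ' m (mface i x) := by
  have hp : p ≤ m + 1 := by omega
  obtain ⟨W, hWd, hG⟩ := exists_rep hU hΦ hx hm hf hp hd
  rw [hB _ _ _ hx hm hf hp hd W hG]
  have hw := fill_cls hx hf hp hd
  have hwx := mface_fill_succ (n := n) (j := f) (p := p) hx.toIsO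
  have hwd := fill_dep_succ hx hf hd
  have hz := mface_fill_cl hx hm hf hp hd
  have hy := coface_cl hx hm hf hp hd
  have hv := ivan_fill (n := n) (m := m + 1) (j := f) (p := p) x
  unfold coface at hG hy
  set w := fill n (m + 1) f p x with hw'
  rcases lt_trichotomy i f with hif | rfl | hif
  · obtain ⟨j, rfl⟩ : ∃ l, f = l + 1 := ⟨f - 1, by omega⟩
    have hw2 : Cl n r (j + 1) (m + 1) (mface i w) :=
      ⟨p, hw.mface_lt (by omega), Or.inr ⟨hm, hwd.mface_lt (by omega)⟩⟩
    have e1 := hG.face_lt hU (k := i) (by omega) (by omega)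
    have e2 := hΦ.isG hw2 (j := j) (s := p - (j + 1)) (by omega) (hv.face_lt (by omega))
    have e3 : m + 1 + 1 - (p - (j + 1)) = m + 1 - (p - (j + 1)) + 1 := by omega
    rw [e3] at hy e1
    rw [hΦ.face hz hi, hΦ.face hy (by omega), mface_iterate_mface (by omega),
      mface_mface (by omega)] at e1
    rw [D_D hU (by omega) (by omega) (by omega), e1.unique e2, hΦ.face hw2 (by omega),
      ← mface_mface (by omega), hwx, hA]
    have := hw2.mface (i := j + 1) (by omega)
    rwa [← mface_mface (by omega), hwx] at this
  · rw [D_D hU le_rfl (by omega) (by omega), hG.D_eq, hΦ.face hz hi, ← mface_mface le_rfl, hwx, hA]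
    have := hz.mface hi
    rwa [← mface_mface le_rfl, hwx] at this
  · obtain ⟨s, hs⟩ : ∃ s, p - f = s + 1 := ⟨p - f - 1, by omega⟩
    rw [← D_D hU (by omega : f + 1 ≤ i) (by omega) (by omega)]
    have hmx : mface i x = mface (f + 1) (mface (i + 1) w) := by
      rw [mface_mface (by omega), hwx]
    have hzi : U.D i (Φ (m + 1) (mface f w)) = Φ m (mface f (mface (i + 1) w)) := by
      rw [hΦ.face hz hi, mface_mface (by omega)]
    -- For `f < i < p` the face of `x` is again new, and naturality of the filler applies. For `i ≥
    -- p` the face of the filler has smaller rank, so its value is already known.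
    by_cases hip : i < p
    · obtain ⟨p, rfl⟩ : ∃ l, p = l + 1 := ⟨p - 1, by omega⟩
      have hxi := hx.mface_lt (i := i) (by omega)
      have hdi := hd.mface (i := i) (by omega)
      have hps : p - f = s := by omega
      rw [hs] at hG
      have e1 := hG.face_mid hU (k := i) (by omega) (by omega) (by omega)
      rw [hB m p _ hxi (by omega) (by omega) (by omega) hdi (U.D (i + 1) W)]
      unfold coface
      rw [← mface_fill (by omega) (by omega) (by omega), ← hw', hps,
        iterate_mface_mid (by omega) (by omega), ← hzi]
      rwa [show m + 1 + 1 - (s + 1) = m + 1 - s by omega] at e1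
    · have hw2 : Cl n r f (m + 1) (mface (i + 1) w) :=
        ⟨p + 1, hw.mface_ge (by omega) (by omega), Or.inl (by omega)⟩
      have hcl : Cl n r f m (mface i x) := by
        rw [hmx]
        exact hw2.mface (by omega)
      suffices h : U.D (i + 1) W = Φ (m + 1) (mface (i + 1) w) by
        rw [h, hΦ.face hw2 (by omega), hA _ _ hcl, hmx]
      by_cases hip' : i = p
      · subst hip'
        rw [hs] at hG hv
        have e1 := hG.face_mid hU (k := i) (by omega) (by omega) (by omega)
        have e2 := hΦ.isG hw2 (j := f) (s := s) (by omega) (hv.face_mid (by omega))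
        rw [iterate_mface_mid (by omega) (by omega), ← hzi,
          show m + 1 - s = m + 1 + 1 - (s + 1) by omega] at e2
        exact e1.unique e2
      · have e1 := hG.face_gt hU (k := i) (by omega) (by omega)
        have e2 := hΦ.isG hw2 (j := f) (s := p - f) (by omega) (hv.face_gt (by omega))
        have e3 : m + 1 + 1 - (p - f) = m + 1 - (p - f) + 1 := by omega
        rw [e3] at hy e1
        rw [iterate_mface_gt (by omega), ← hzi, ← hΦ.face hy (by omega)] at e2
        exact e1.unique e2

/-- For `f < i` the iterated wedge is thin at `i + 1`, for `i + 2 ≤ f` it is thin at `i`; a face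
then has the wanted thinness. In the cases `f = i + 1` and `f = i` the associativity axiom gives
thinness of the middle face directly. -/
theorem step_thin (hU : U.IsComplicial) (hΦ : FaceThin n U (Cl n r f) Φ)
    {m i p : ℕ} {x : Mat} (hx : Cls n m p x) (hm : m + 1 = r + p) (hf : f < p) (hp : p ≤ m)
    (hd : Dep n p (f + 1) x) (hi : i + 2 ≤ m) (hv : Van i x) {W : U.E} (hWd : W.1 = m + 1)
    (hG : U.IsG f (p - f) (Φ (m + 1 - (p - f)) (coface n m f p x))
        (Φ m (mface f (fill n m f p x))) W) : U.Th i (U.D (f + 1) W) := by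
  have hz := mface_fill_cl hx hm hf hp hd
  have hy := coface_cl hx hm hf hp hd
  rcases lt_or_ge f i with hfi | hfi
  · have := hG.th_succ hU hfi (hΦ.thin hz hi (van_mface_fill_of_lt hx hf hp hd hfi hv))
      (fun h => hΦ.thin hy (by omega) (van_coface_of_le hx hf hp (by omega) hv))
    exact this.D_lt hU hfi
  obtain ⟨s, hs⟩ : ∃ s, p - f = s + 1 := ⟨p - f - 1, by omega⟩
  obtain h3 | rfl | rfl | rfl : i + 3 ≤ f ∨ f = i + 2 ∨ f = i + 1 ∨ f = i := by omega
  · have hvw := van_fill_of_lt hx hf hp hd h3 hv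
    have := hG.th_lt hU h3 (hΦ.thin hy (by omega) (hvw.mface_iterate (by omega) _))
      (hΦ.thin hz hi (hvw.mface_gt h3))
    exact this.D_gt hU (by omega) (by omega)
  · have hzc : Cls n m p (mface (i + 2) (fill n m (i + 2) p x)) :=
      (fill_cls hx hf hp hd).mface_lt (by omega)
    have hzd : Dep n p (i + 1 + 1) (mface (i + 2) (fill n m (i + 2) p x)) :=
      (fill_dep_succ hx hf hd).mface_lt le_rfl
    have hVan := van_mface_fill_mface_fill hx hf hp hd hv
    have := hG.th_whisk hU (hΦ.thin hy (by omega) (van_coface_pred_pred hx hf hv)) ?_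
    · exact this.D_gt hU (by omega) (by omega)
    intro q hq
    set z := mface (i + 2) (fill n m (i + 2) p x) with hz'
    obtain ⟨k, hk⟩ : ∃ k, m = k + q := ⟨m - q, by omega⟩
    -- The filler of `z` at `i + 1` lies in the stage already treated, because `z` has gained one
    -- step in the dependence condition.
    have hV : Cl n r (i + 2) (k + 1 + q) (fill n m (i + 1) p z) := by
      rw [show k + 1 + q = m + 1 by omega]
      exact ⟨p + 1, fill_cls hzc (by omega) hp hzd,
        Or.inr ⟨by omega, fill_dep_succ hzc (by omega) hzd⟩⟩
    have hVq := hΦ.closed_iterate (k := i + 4) hV (by omega)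
    -- This is the witness for `Whisk`: its face opposite `i + 2` is the required iterated face of
    -- the value at `z`.
    refine ⟨Φ (k + 1) ((mface (i + 4))^[q] (fill n m (i + 1) p z)), ?_, ?_, ?_, ?_⟩
    · exact hΦ.thin hVq (by omega)
        ((van_iterate_fill (q := 0) (by omega)).mface_iterate (by omega) q)
    · rw [hΦ.face hVq (by omega), mface_iterate_mface (by omega), ← Function.iterate_succ_apply]
      refine hΦ.thin ?_ (by omega) (van_iterate_fill (by omega))
      rw [Function.iterate_succ_apply, ← mface_iterate_mface (by omega)]
      exact hΦ.closed hVq (by omega)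
    · rw [hΦ.face hVq (by omega)]
      refine hΦ.thin (hΦ.closed hVq (by omega)) (by omega) ?_
      rw [mface_iterate_mface (by omega)]
      exact hVan.mface_iterate (by omega) q
    · have e := hΦ.face_iterate (m := k) (k := i + 3) (q := q) (x := z) (by rwa [← hk]) (by omega)
      rw [hΦ.face hVq (by omega), mface_iterate_mface (by omega), mface_fill_succ hzc.toIsO, hk, e]
  · have hty := hΦ.thin hy (by omega) (van_coface_pred hx hf hp hd hv)
    have htz := hΦ.thin hz hi (van_mface_fill_pred hx hf hp hd hv)
    rw [hs] at hG
    refine Th.D_add_two hU hG.1 (hG.th_D hU ?_) ?_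
    · rwa [← hs]
    · rwa [hG.2.1]
  · have htz := hΦ.thin hz hi (van_mface_fill_self hx hf hp hd hv)
    rw [hs] at hG
    refine Th.D_succ hU hG.1 (by rwa [hG.2.1]) ?_
    cases s with
    | zero =>
      obtain rfl : p = f + 1 := by omega
      rw [hG.2.2.1, ← hs]
      exact hΦ.thin hy (by omega) (van_coface_self hv)
    | succ s => exact hG.2.2.1

theorem exists_step (hU : U.IsComplicial) (hr : 1 ≤ r) (hΦ : FaceThin n U (Cl n r f) Φ) :
    ∃ Φ' : ℕ → Mat → U.E, FaceThin n U (Cl n r (f + 1)) Φ' ∧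
      ∀ m x, Cl n r f m x → Φ' m x = Φ m x := by
  obtain ⟨Φ', hA, hB⟩ := exists_step_fun hΦ
  refine ⟨Φ', ⟨fun hx hi => hx.mface hi, fun {m x} hx => ?_, fun {m i x} hx hi => ?_,
    fun {m i x} hx hi hv => ?_, fun {m p x} hx hc hp hd => ?_⟩, hA⟩
  · rcases hx.cases with hx | ⟨p, hx, hm, hf, hd⟩
    · rw [hA _ _ hx, hΦ.dim hx]
    · have hp : p ≤ m := by omega
      obtain ⟨W, hWd, hG⟩ := exists_rep hU hΦ hx hm hf hp hd
      rw [hB _ _ _ hx hm hf hp hd W hG]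
      have := dim_D (U := U) (i := f + 1) (e := W) (by omega) (by omega)
      omega
  · rcases hx.cases with hx | ⟨p, hx, hm, hf, hd⟩
    · rw [hA _ _ hx, hA _ _ (hx.mface hi), hΦ.face hx hi]
    · exact step_face hU hΦ hr hA hB hx hm hf hd hi
  · rcases hx.cases with hx | ⟨p, hx, hm, hf, hd⟩
    · rw [hA _ _ hx]
      exact hΦ.thin hx hi hv
    · have hp : p ≤ m := by omega
      obtain ⟨W, hWd, hG⟩ := exists_rep hU hΦ hx hm hf hp hd
      rw [hB _ _ _ hx hm hf hp hd W hG]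
      exact step_thin hU hΦ hx hm hf hp hd hi hv hWd hG
  -- Matrices subject to `deg` satisfy `Dep n p 0`, so they never are new at this step.
  · have hx' : Cl n r f (m + 1) x := by
      obtain ⟨p', hx', h⟩ := hx
      obtain rfl := hx'.unique hc
      exact ⟨p', hx', h.imp id fun h => ⟨h.1, hd.mono (by omega)⟩⟩
    rw [hA _ _ hx', hA _ _ (hx'.mface le_rfl), hΦ.deg hx' hc hp hd]

end

end Oriental

end

/-! ### Extension to all matrices, and its uniqueness -/

noncomputable section

namespace Oriental

open WedgeData

section
variable {n : ℕ} {U : WedgeData.{u}}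

theorem exists_limit {K : ℕ → ℕ → Mat → Prop} (mono : ∀ f m x, K f m x → K (f + 1) m x)
    {Φ₀ : ℕ → Mat → U.E} (h₀ : FaceThin n U (K 0) Φ₀)
    (step : ∀ f Φ, FaceThin n U (K f) Φ → ∃ Φ', FaceThin n U (K (f + 1)) Φ' ∧
      ∀ m x, K f m x → Φ' m x = Φ m x) :
    ∃ Φ, FaceThin n U (fun m x => ∃ f, K f m x) Φ ∧ ∀ m x, K 0 m x → Φ m x = Φ₀ m x := by
  classical
  let seq : ∀ f, {Φ // FaceThin n U (K f) Φ} := fun f => Nat.rec ⟨Φ₀, h₀⟩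
    (fun f Φ => ⟨(step f Φ.1 Φ.2).choose, (step f Φ.1 Φ.2).choose_spec.1⟩) f
  have hseq : ∀ f m x, K f m x → (seq (f + 1)).1 m x = (seq f).1 m x := fun f =>
    (step f (seq f).1 (seq f).2).choose_spec.2
  have hmono : ∀ f k m x, K f m x → K (f + k) m x := fun f k m x h => by
    induction k with
    | zero => exact h
    | succ k ih => exact mono _ _ _ ih
  have hadd : ∀ f k m x, K f m x → (seq (f + k)).1 m x = (seq f).1 m x := fun f k m x h => by
    induction k with
    | zero => rfl
    | succ k ih => exact (hseq (f + k) m x (hmono f k m x h)).trans ih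
  have heq : ∀ f g m x, K f m x → K g m x → (seq f).1 m x = (seq g).1 m x :=
    fun f g m x hf hg => by
      rw [← hadd f g m x hf, ← hadd g f m x hg, Nat.add_comm]
  let Φ : ℕ → Mat → U.E := fun m x => if h : ∃ f, K f m x then (seq h.choose).1 m x else Φ₀ m x
  have hΦ : ∀ f m x, K f m x → Φ m x = (seq f).1 m x := fun f m x h => by
    have h' : ∃ f, K f m x := ⟨f, h⟩
    exact (dif_pos h').trans (heq _ _ _ _ h'.choose_spec h)
  refine ⟨Φ, ⟨?_, ?_, ?_, ?_, ?_⟩, fun m x h => hΦ 0 m x h⟩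
  · rintro m i x ⟨f, h⟩ hi
    exact ⟨f, (seq f).2.closed h hi⟩
  · rintro m x ⟨f, h⟩
    rw [hΦ f m x h, (seq f).2.dim h]
  · rintro m i x ⟨f, h⟩ hi
    rw [hΦ f _ x h, hΦ f _ _ ((seq f).2.closed h hi), (seq f).2.face h hi]
  · rintro m i x ⟨f, h⟩ hi hv
    rw [hΦ f m x h]
    exact (seq f).2.thin h hi hv
  · rintro m p x ⟨f, h⟩ hc hp hd
    rw [hΦ f _ x h, hΦ f _ _ ((seq f).2.closed h le_rfl), (seq f).2.deg h hc hp hd]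

/-- Since `Dep n p p` is empty, the stages of rank `r` exhaust all matrices of rank at most `r`. -/
theorem exists_cl_iff {r m : ℕ} {x : Mat} :
    (∃ f, Cl n r f m x) ↔ ∃ p, Cls n m p x ∧ m + 1 ≤ r + p := by
  constructor
  · rintro ⟨f, p, hx, h⟩
    exact ⟨p, hx, by omega⟩
  · rintro ⟨p, hx, h⟩
    rcases h.lt_or_eq with h | h
    · exact ⟨0, p, hx, Or.inl h⟩
    · exact ⟨p, p, hx, Or.inr ⟨h, dep_of_le x le_rfl⟩⟩

/-- The new matrices have rank `r + 1 ≥ 2` and satisfy `Dep n p 0`. They are degenerate at the last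
place, so the value must be a degeneracy of a value of rank `r`. -/
theorem exists_deg_step (hU : U.IsComplicial) {r : ℕ} (hr : 1 ≤ r) {Φ : ℕ → Mat → U.E}
    (hΦ : FaceThin n U (fun m x => ∃ f, Cl n r f m x) Φ) :
    ∃ Φ', FaceThin n U (Cl n (r + 1) 0) Φ' ∧
      ∀ m x, (∃ f, Cl n r f m x) → Φ' m x = Φ m x := by
  classical
  let Φ' : ℕ → Mat → U.E := fun m x => if ∃ f, Cl n r f m x then Φ m x else
    U.S (m - 1) (Φ (m - 1) (mface m x))
  have hA : ∀ m x, (∃ f, Cl n r f m x) → Φ' m x = Φ m x := fun m x h => if_pos h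
  have hlast : ∀ {m p x}, Cls n (m + 1) p x → m + 2 = r + 1 + p →
      ∃ f, Cl n r f m (mface (m + 1) x) := fun hx h =>
    exists_cl_iff.2 ⟨_, hx.mface_ge (by omega) le_rfl, by omega⟩
  have hB : ∀ {m p x}, Cls n (m + 1) p x → m + 2 = r + 1 + p →
      Φ' (m + 1) x = U.S m (Φ m (mface (m + 1) x)) := fun hx h => if_neg fun h' => by
    obtain ⟨p', hx', h'⟩ := exists_cl_iff.1 h'
    obtain rfl := hx.unique hx'
    omega
  have hcases : ∀ {m x}, Cl n (r + 1) 0 m x → (∃ f, Cl n r f m x) ∨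
      ∃ k p, m = k + 1 ∧ Cls n (k + 1) p x ∧ k + 2 = r + 1 + p ∧ Dep n p 0 x := by
    rintro m x ⟨p, hx, h | ⟨h, hd⟩⟩
    · exact Or.inl (exists_cl_iff.2 ⟨p, hx, by omega⟩)
    · obtain ⟨k, rfl⟩ : ∃ k, m = k + 1 := ⟨m - 1, by omega⟩
      exact Or.inr ⟨k, p, rfl, hx, h, hd⟩
  refine ⟨Φ', ⟨fun hx hi => hx.mface hi, fun {m x} hx => ?_, fun {m i x} hx hi => ?_,
    fun {m i x} hx hi hv => ?_, fun {m p x} hx hc hp hd => ?_⟩, hA⟩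
  · rcases hcases hx with h | ⟨m, p, rfl, hx, hm, hd⟩
    · rw [hA _ _ h, hΦ.dim h]
    · have := hΦ.dim (hlast hx hm)
      rw [hB hx hm, dim_S (by omega), this]
  · rcases hcases hx with h | ⟨m, p, e, hx, hm, hd⟩
    · rw [hA _ _ h, hA _ _ (hΦ.closed h hi), hΦ.face h hi]
    · obtain rfl := Nat.succ_injective e
      have hl := hlast hx hm
      have hdim := hΦ.dim hl
      rw [hB hx hm]
      by_cases him : i < m
      · obtain ⟨m, rfl⟩ : ∃ k, m = k + 1 := ⟨m - 1, by omega⟩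
        rw [D_S_lt hU (by omega) (by omega), hΦ.face hl (by omega)]
        by_cases hip : i < p
        · obtain ⟨p, rfl⟩ : ∃ l, p = l + 1 := ⟨p - 1, by omega⟩
          rw [hB (hx.mface_lt (by omega)) (by omega), mface_mface (by omega)]
        -- All faces opposite vertices from `p` onwards coincide with the last one, which is itself
        -- degenerate at its last place, so the rule for degenerate matrices at the earlier stage
        -- applies.
        · have hlc := hx.mface_ge (i := m + 1 + 1) (by omega) le_rfl
          rw [hx.mface_eq_of_dep hd (by omega) hi, hA _ _ hl,
            hΦ.deg hl hlc (by omega) (hd.mface_last hx),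
            hlc.mface_eq_of_dep (hd.mface_last hx) (by omega) (by omega)]
      · rw [hx.mface_eq_of_dep hd (by omega) hi, hA _ _ hl]
        obtain rfl | rfl : i = m ∨ i = m + 1 := by omega
        · exact D_S_self hU (by omega)
        · exact D_S_succ hU (by omega)
  · rcases hcases hx with h | ⟨m, p, rfl, hx, hm, hd⟩
    · rw [hA _ _ h]
      exact hΦ.thin h hi hv
    · have hl := hlast hx hm
      have hdim := hΦ.dim hl
      rw [hB hx hm]
      obtain h | rfl : i + 2 ≤ m ∨ m = i + 1 := by omega
      · have := (hΦ.thin hl h (hv.mface_gt (by omega))).S_last hU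
        rwa [hdim] at this
      · exact th_S_succ hU (by omega)
  · rcases hcases hx with h | ⟨m, p', e, hx, hm, hd⟩
    · rw [hA _ _ h, hA _ _ (hΦ.closed h le_rfl), hΦ.deg h hc hp hd]
    · obtain rfl := Nat.succ_injective e
      rw [hB hx hm, hA _ _ (hlast hx hm)]

/-- A function that respects faces and thinness extends from the matrices for which at most the
last vertex is sent to `n`, and which are then joins with `n`, to all matrices. -/
theorem exists_extension (hU : U.IsComplicial) {Φ₀ : ℕ → Mat → U.E}
    (h₀ : FaceThin n U (Cl n 1 0) Φ₀) :
    ∃ Φ, FaceThin n U (IsO n) Φ ∧ ∀ m x, Cl n 1 0 m x → Φ m x = Φ₀ m x := by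
  have hfinal : (fun m x => ∃ r, Cl n (r + 1) 0 m x) = IsO n := by
    funext m x
    refine propext ⟨?_, fun h => ?_⟩
    · rintro ⟨r, p, hx, -⟩
      exact hx.toIsO
    · obtain ⟨p, hx⟩ := exists_cls h
      exact ⟨m + 1, p, hx, Or.inl (by omega)⟩
  have := exists_limit (K := fun r => Cl n (r + 1) 0) ?_ h₀ ?_
  · rwa [hfinal] at this
  · rintro r m x ⟨p, hx, h⟩
    exact ⟨p, hx, Or.inl (by omega)⟩
  · intro r Φ hΦ
    obtain ⟨Φ', hΦ', hA⟩ := exists_limit (K := Cl n (r + 1)) (fun f m x h => h.succ) hΦ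
      (fun f Φ hΦ => exists_step hU (by omega) hΦ)
    obtain ⟨Φ'', hΦ'', hB⟩ := exists_deg_step hU (by omega) hΦ'
    exact ⟨Φ'', hΦ'', fun m x h => (hB m x ⟨0, h⟩).trans (hA m x h)⟩

/-- The same induction as for existence: both functions send the filler to the iterated wedge of
values on which they already agree, and degenerate matrices to the same degeneracy. -/
theorem FaceThin.eq_of_eq {Φ Ψ : ℕ → Mat → U.E} (hΦ : FaceThin n U (IsO n) Φ)
    (hΨ : FaceThin n U (IsO n) Ψ) (h : ∀ m x, Cl n 1 0 m x → Φ m x = Ψ m x) {m : ℕ} {x : Mat}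
    (hx : IsO n m x) : Φ m x = Ψ m x := by
  have step : ∀ r f, (∀ m x, Cl n (r + 1) f m x → Φ m x = Ψ m x) →
      ∀ m x, Cl n (r + 1) (f + 1) m x → Φ m x = Ψ m x := by
    intro r f ih m x hx
    rcases hx.cases with hx | ⟨p, hx, hm, hf, hd⟩
    · exact ih m x hx
    · have hp : p ≤ m := by omega
      have hw := (fill_cls hx hf hp hd).toIsO
      have e1 := hΦ.isG hw (j := f) (s := p - f) (by omega) (ivan_fill x)
      have e2 := hΨ.isG hw (j := f) (s := p - f) (by omega) (ivan_fill x)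
      have e3 := ih _ _ (coface_cl hx hm hf hp hd)
      unfold coface at e3
      rw [ih _ _ (mface_fill_cl hx hm hf hp hd), e3] at e1
      rw [← mface_fill_succ (n := n) (j := f) (p := p) hx.toIsO, ← hΦ.face hw (by omega),
        ← hΨ.face hw (by omega), e1.unique e2]
  have hall : ∀ r f m x, Cl n (r + 1) f m x → Φ m x = Ψ m x := by
    intro r
    induction r with
    | zero =>
      intro f
      induction f with
      | zero => exact h
      | succ f ih => exact step 0 f ih
    | succ r ihr =>
      intro f
      induction f with
      | zero =>
        rintro m x ⟨p, hx, h | ⟨h, hd⟩⟩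
        · exact ihr p m x ⟨p, hx, by
            rcases (show m + 1 ≤ r + 1 + p by omega).lt_or_eq with h | h
            · exact Or.inl h
            · exact Or.inr ⟨h, dep_of_le x le_rfl⟩⟩
        · obtain ⟨m, rfl⟩ : ∃ k, m = k + 1 := ⟨m - 1, by omega⟩
          rw [hΦ.deg hx.toIsO hx (by omega) hd, hΨ.deg hx.toIsO hx (by omega) hd]
          congr 1
          exact ihr p m _ ⟨p, hx.mface_ge (by omega) le_rfl, Or.inr ⟨by omega, dep_of_le _ le_rfl⟩⟩
      | succ f ih => exact step (r + 1) f ih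
  obtain ⟨p, hc⟩ := exists_cls hx
  exact hall (m + 1) 0 m x ⟨p, hc, Or.inl (by omega)⟩

end

end Oriental

end

/-! ### Décalage, morphisms as functions on matrices, and cones -/

noncomputable section

namespace WedgeData

theorem IsWedge.unique {U : WedgeData.{u}} {m i : ℕ} {hi : i ≤ m} {x y : U.X (m + 1)}
    {w w' : U.X (m + 2)} (h : U.IsWedge i x y w hi) (h' : U.IsWedge i x y w' hi) : w = w' := by
  obtain ⟨_, rfl⟩ := h
  obtain ⟨_, rfl⟩ := h'
  rfl

/-- The composite of two morphisms. -/
def Hom.comp {U V W : WedgeData} (g : Hom V W) (f : Hom U V) : Hom U W where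
  toFun m x := g.toFun m (f.toFun m x)
  map_d m i hi x := by rw [f.map_d m i hi, g.map_d m i hi]
  map_s m i hi x := by rw [f.map_s m i hi, g.map_s m i hi]
  map_wedge m i hi x y w h := g.map_wedge m i hi _ _ _ (f.map_wedge m i hi _ _ _ h)

/-- The décalage: the elements of positive degree, without the last faces. -/
def Dec (U : WedgeData.{u}) : WedgeData.{u} where
  X m := U.X (m + 1)
  d i x _ := U.d i x
  s i x _ := U.s i x
  wedge i hi x y h := U.wedge i (by omega) x y h

theorem Dec.isComplicial {U : WedgeData.{u}} (hU : U.IsComplicial) : U.Dec.IsComplicial where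
  d_d m i j hij _ x := hU.d_d (m + 1) i j hij (by omega) x
  d_s_lt m i j hij _ x := hU.d_s_lt (m + 1) i j hij (by omega) x
  d_s_self m i _ x := hU.d_s_self (m + 1) i (by omega) x
  d_s_succ m i _ x := hU.d_s_succ (m + 1) i (by omega) x
  d_s_gt m i j hij _ x := hU.d_s_gt (m + 1) i j hij (by omega) x
  s_s m i j hij _ x := hU.s_s (m + 1) i j hij (by omega) x
  d_wedge_lt m i j hj _ x y w h := hU.d_wedge_lt (m + 1) i j hj (by omega) x y w h
  d_wedge_right m i _ x y w h := hU.d_wedge_right (m + 1) i (by omega) x y w h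
  d_wedge_left m i _ x y w h := hU.d_wedge_left (m + 1) i (by omega) x y w h
  d_wedge_gt m i j hij _ x y w h := hU.d_wedge_gt (m + 1) i j hij (by omega) x y w h
  s_eq_left m i _ x := hU.s_eq_left (m + 1) i (by omega) x
  s_eq_right m i _ x := hU.s_eq_right (m + 1) i (by omega) x
  wedge_form_left m i _ y z b c A h h' :=
    hU.wedge_form_left (m + 1) i (by omega) y z b c A h h'
  wedge_form_right m i _ x y b c A h h' :=
    hU.wedge_form_right (m + 1) i (by omega) x y b c A h h'
  wedge_assoc m i _ x y z w := hU.wedge_assoc (m + 1) i (by omega) x y z w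
  wedge_whisker m i _ x y z b c D h1 h2 h3 A hA w B :=
    hU.wedge_whisker (m + 1) i (by omega) x y z b c D h1 h2 h3 A hA w B
  wedge_interchange m i j hij _ x y z w B :=
    hU.wedge_interchange (m + 1) i j hij (by omega) x y z w B

/-- The décalage of a morphism. -/
def Hom.dec {U : WedgeData.{u}} {V : WedgeData.{v}} (f : Hom U V) : Hom U.Dec V.Dec where
  toFun m x := f.toFun (m + 1) x
  map_d m i _ x := f.map_d (m + 1) i (by omega) x
  map_s m i _ x := f.map_s (m + 1) i (by omega) x
  map_wedge m i _ x y w h := f.map_wedge (m + 1) i (by omega) x y w h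

/-- The last faces form a morphism from the décalage. -/
def Dec.last {U : WedgeData.{u}} (hU : U.IsComplicial) : Hom U.Dec U where
  toFun m x := U.d (m + 1) x
  map_d m i hi x := (hU.d_d m i (m + 1) hi le_rfl x).symm
  map_s m i hi x := hU.d_s_gt m (m + 1) i (by omega) le_rfl x
  map_wedge m i hi x y w h := hU.d_wedge_gt m i (m + 2) (by omega) le_rfl x y w h

/-- The elements of the décalage as elements of positive degree. -/
def Dec.shift {U : WedgeData.{u}} (e : U.Dec.E) : U.E := ⟨e.1 + 1, e.2⟩

theorem Dec.D_shift {U : WedgeData.{u}} {m i : ℕ} (hi : i ≤ m + 1) (x : U.Dec.X (m + 1)) :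
    U.D i (Dec.shift ⟨m + 1, x⟩) = Dec.shift (U.Dec.D i ⟨m + 1, x⟩) :=
  (D_mk (U := U) (m := m + 1) (by omega) x).trans (congrArg Dec.shift (D_mk (U := U.Dec) hi x).symm)

theorem Dec.S_shift {U : WedgeData.{u}} {m i : ℕ} (hi : i ≤ m) (x : U.Dec.X m) :
    U.S i (Dec.shift ⟨m, x⟩) = Dec.shift (U.Dec.S i ⟨m, x⟩) :=
  (S_mk (U := U) (m := m + 1) (by omega) x).trans (congrArg Dec.shift (S_mk (U := U.Dec) hi x).symm)

theorem Dec.th_shift {U : WedgeData.{u}} {i : ℕ} {e : U.Dec.E} (h : U.Dec.Th i e) :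
    U.Th i (Dec.shift e) := by
  obtain ⟨m, hi, w, rfl, h⟩ := h
  exact (th_mk (U := U) (m := m + 1) (by omega) w).2 h

end WedgeData

namespace Oriental

open WedgeData

/-! ### Morphisms and functions on matrices -/

/-- The element of the nerve that corresponds to a matrix. -/
def elem {n m : ℕ} {x : Mat} (h : IsO n m x) : (nerve n).X m := ofIsO h

theorem val_elem {n m : ℕ} {x : Mat} (h : IsO n m x) : val (elem h).1 = x := val_ofIsO h

theorem nerve_ext {n m : ℕ} {x y : (nerve n).X m} (h : val x.1 = val y.1) : x = y := or_ext h


section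
variable {n : ℕ} {U : WedgeData.{u}}

open Classical in
/-- The function on matrices that corresponds to a morphism. -/
def matFun (f : Hom (nerve n) U) (m : ℕ) (x : Mat) : U.E :=
  if h : IsO n m x then ⟨m, f.toFun m (elem h)⟩ else ⟨n, f.toFun n (iota n)⟩

theorem matFun_of_isO (f : Hom (nerve n) U) {m : ℕ} {x : Mat} (h : IsO n m x) :
    matFun f m x = ⟨m, f.toFun m (elem h)⟩ := dif_pos h

theorem elem_val {m : ℕ} (x : (nerve n).X m) : elem (val_isO x.2) = x :=
  nerve_ext (val_elem _)

theorem matFun_val (f : Hom (nerve n) U) {m : ℕ} (x : (nerve n).X m) :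
    matFun f m (val x.1) = ⟨m, f.toFun m x⟩ := by
  rw [matFun_of_isO f (val_isO x.2), elem_val]

theorem d_elem {m i : ℕ} {x : Mat} (h : IsO n (m + 1) x) (hi : i ≤ m + 1) :
    (nerve n).d i (elem h) hi = elem (h.mface hi) :=
  nerve_ext (by rw [val_d, val_elem, val_elem])

theorem s_elem {m i : ℕ} {x : Mat} (h : IsO n m x) (hi : i ≤ m) :
    (nerve n).s i (elem h) hi = elem (h.mdeg hi) :=
  nerve_ext (by rw [val_s, val_elem, val_elem])

theorem matFun_mdeg (f : Hom (nerve n) U) {m i : ℕ} {x : Mat} (h : IsO n m x) (hi : i ≤ m) :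
    matFun f (m + 1) (mdeg i x) = U.S i (matFun f m x) := by
  rw [matFun_of_isO f h, matFun_of_isO f (h.mdeg hi), S_mk hi, ← s_elem h hi, f.map_s m i hi]

theorem faceThin_matFun (f : Hom (nerve n) U) (hU : U.IsComplicial) :
    FaceThin n U (IsO n) (matFun f) where
  closed h hi := h.mface hi
  dim h := by rw [matFun_of_isO f h]
  face {m i x} h hi := by
    rw [matFun_of_isO f h, matFun_of_isO f (h.mface hi), D_mk hi, ← d_elem h hi, f.map_d m i hi]
  thin {m i x} h hi hv := by
    obtain ⟨m, rfl⟩ : ∃ k, m = k + 2 := ⟨m - 2, by omega⟩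
    rw [matFun_of_isO f h]
    refine (f.map_wedge m i (by omega) ((nerve n).d (i + 2) (elem h))
      ((nerve n).d i (elem h)) (elem h) ?_).th hU (by omega)
    rw [isWedge_iff (by omega), val_d, val_d, val_elem]
    exact ⟨rfl, rfl, hv⟩
  deg {m p x} h hc hp hd := by
    conv_lhs => rw [hc.eq_mdeg_of_dep hd hp]
    exact matFun_mdeg f (h.mface le_rfl) le_rfl

theorem hom_ext {f g : Hom (nerve n) U} (h : ∀ m x, IsO n m x → matFun f m x = matFun g m x) :
    f = g := by
  ext m x
  have := h m _ (val_isO x.2)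
  rw [matFun_val, matFun_val] at this
  simpa using this

/-- A thin matrix goes to a thin element with the right faces, that is, to the wedge. In positive
degree each degeneracy is a wedge whose operands involve degeneracies of smaller elements, so
`map_s` follows by induction. Only the degeneracy of vertices must be given separately. -/
theorem exists_hom (hU : U.IsComplicial) {Φ : ℕ → Mat → U.E} (hΦ : FaceThin n U (IsO n) Φ)
    (h0 : ∀ x, Cls n 0 1 x → Φ 1 (mdeg 0 x) = U.S 0 (Φ 0 x)) :
    ∃ f : Hom (nerve n) U, ∀ m (x : (nerve n).X m), Φ m (val x.1) = ⟨m, f.toFun m x⟩ := by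
  have hex : ∀ m (x : (nerve n).X m), ∃ y : U.X m, Φ m (val x.1) = ⟨m, y⟩ := fun m x =>
    exists_mk (hΦ.dim (val_isO x.2))
  choose F hF using hex
  have hd : ∀ (m i : ℕ) (_ : i ≤ m + 1) (x : (nerve n).X (m + 1)),
      F m ((nerve n).d i x) = U.d i (F (m + 1) x) := by
    intro m i hi x
    have h := hΦ.face (val_isO x.2) hi
    rw [hF, D_mk hi, ← val_d hi, hF] at h
    simpa using h.symm
  have hw : ∀ (m i : ℕ) (_ : i ≤ m) (x y : (nerve n).X (m + 1)) (w : (nerve n).X (m + 2)),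
      (nerve n).IsWedge i x y w → U.IsWedge i (F (m + 1) x) (F (m + 1) y) (F (m + 2) w) := by
    intro m i hi x y w h
    have h1 := (nerve_isComplicial n).d_wedge_left m i hi x y w h
    have h2 := (nerve_isComplicial n).d_wedge_right m i hi x y w h
    have h3 := hΦ.thin (val_isO w.2) (by omega) ((isWedge_iff hi x y w).1 h).2.2
    rw [hF, th_mk hi, ← hd _ _ (by omega), ← hd _ _ (by omega), h1, h2] at h3
    exact h3
  have hs : ∀ (m i : ℕ) (_ : i ≤ m) (x : (nerve n).X m),
      F (m + 1) ((nerve n).s i x) = U.s i (F m x) := by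
    intro m
    induction m with
    | zero =>
      intro i hi x
      obtain rfl : i = 0 := by omega
      have h : Φ 1 (mdeg 0 (val x.1)) = U.S 0 (Φ 0 (val x.1)) := by
        obtain ⟨p, hp⟩ := exists_cls (val_isO x.2)
        obtain rfl | rfl : p = 1 ∨ p = 0 := by have := hp.le; omega
        · exact h0 _ hp
        -- For the vertex `n` all vertices of the degenerate edge are sent to `n`, so `Dep` is empty
        -- and the rule `deg` applies.
        · have h1 : IsO n 1 (mdeg 0 (val x.1)) := (val_isO x.2).mdeg le_rfl
          have h2 : Cls n 1 0 (mdeg 0 (val x.1)) := by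
            refine ⟨h1, by omega, fun v hv => ?_⟩
            rw [mdeg_apply_of_notMem (by
              simp only [Finset.mem_singleton]
              omega), Finset.image_singleton, hp.vertex _ (dup_le le_rfl v hv)]
            simp
          rw [hΦ.deg h1 h2 le_rfl (dep_of_le _ le_rfl), mface_mdeg_succ]
      rw [← val_s hi, hF, hF, S_mk hi] at h
      simpa using h
    | succ m ih =>
      intro i hi x
      by_cases him : i ≤ m
      · have h1 := hw m i him _ _ _ ((nerve_isComplicial n).s_eq_left m i him x)
        rw [ih i him, hd m _ (by omega)] at h1
        exact h1.unique (hU.s_eq_left m i him _)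
      · obtain rfl : i = m + 1 := by omega
        have h1 := hw m m le_rfl _ _ _ ((nerve_isComplicial n).s_eq_right m m le_rfl x)
        rw [ih m le_rfl, hd m _ (by omega)] at h1
        exact h1.unique (hU.s_eq_right m m le_rfl _)
  exact ⟨⟨F, hd, hs, hw⟩, hF⟩

end

/-! ### The identity matrix -/

theorem val_iota (n : ℕ) (a b : Finset ℕ) :
    val (iota n).1 a b = if a = b ∧ a ⊆ Finset.range (n + 1) then 1 else 0 := by
  by_cases ha : a = ∅
  · subst ha
    simp [val, eq_comm]
  · rw [val_of_ne ha]
    change coef n b (elt n a) = _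
    rw [coef_elt]
    simp only [Finset.nonempty_iff_ne_empty.2 ha, true_and, subset_range_iff]

theorem mface_val_iota (n : ℕ) :
    mface (n + 1) (val (iota (n + 1)).1) = val (iota n).1 := by
  funext a b
  unfold mface
  rw [val_iota, val_iota]
  by_cases ha : a ⊆ Finset.range (n + 1)
  · rw [image_skip_of_lt fun v hv => Finset.mem_range.1 (ha hv)]
    have : a ⊆ Finset.range (n + 1 + 1) := ha.trans (Finset.range_subset_range.2 (by omega))
    simp [ha, this]
  · rw [if_neg, if_neg (fun h => ha h.2)]
    rintro ⟨-, h⟩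
    apply ha
    intro v hv
    have := Finset.mem_range.1 (h (Finset.mem_image_of_mem _ hv))
    unfold skip at this
    split_ifs at this
    · exact Finset.mem_range.2 (by omega)
    · omega

theorem val_iota_cls (n : ℕ) : Cls n n n (val (iota n).1) where
  toIsO := val_isO (iota n).2
  le := by omega
  vertex v hv := by
    rw [val_iota]
    simp only [Finset.singleton_inj, Finset.singleton_subset_iff, Finset.mem_range]
    split_ifs <;> omega

/-- The identity has rank one, and a simplex with the vertex `n` goes to itself, so its image lies
wholly in `topPart`. Thus the identity belongs to the base of the filtration. -/
theorem val_iota_dep (n : ℕ) : Dep n n 0 (val (iota n).1) := by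
  rintro a hna - b
  unfold botPart
  split_ifs with h
  · rfl
  · rw [val_iota, if_neg]
    rintro ⟨rfl, h'⟩
    exact h ⟨hna, subset_range_iff.1 h'⟩

/-! ### The inclusion of one oriental in the next -/

theorem bd_succ {N : ℕ} {c : Finset ℕ → ℤ} (h : ∀ b, N ∈ b → c b = 0) (b : Finset ℕ) :
    bd (N + 1) c b = bd N c b := by
  symm
  refine Finset.sum_subset (Finset.sdiff_subset_sdiff
    (Finset.range_subset_range.2 (by omega)) subset_rfl) fun v hv hv' => ?_
  simp only [Finset.mem_sdiff, Finset.mem_range] at hv hv'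
  have : v = N := by
    by_contra hne
    exact hv' ⟨by omega, hv.2⟩
  rw [h _ (by rw [this]; exact Finset.mem_insert_self N b), mul_zero]

theorem IsO.eq_zero_of_top {k m : ℕ} {x : Mat} (h : IsO k m x) (a : Finset ℕ) {b : Finset ℕ}
    (hb : k + 1 ∈ b) : x a b = 0 := by
  by_contra hne
  have := (h.subset_of_ne hne).2 _ hb
  omega

/-- If no vertex is sent to `k + 1`, then `Cls.eq_zero_of_lt` excludes `k + 1` from all images. So
rank zero over `k + 1` means defined over `k`. -/
theorem isO_succ_iff {k m : ℕ} {x : Mat} : IsO k m x ↔ Cls (k + 1) m (m + 1) x := by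
  constructor
  · intro h
    refine ⟨⟨h.empty, h.nonneg, h.supp_left, fun a b hne =>
      (h.supp_right a b hne).trans (Finset.range_subset_range.2 (by omega)), h.card_eq,
      fun a ha b => ?_⟩, le_rfl, fun v hv => ?_⟩
    · rw [bd_succ (fun b hb => h.eq_zero_of_top a hb), h.chain a ha]
    · rw [h.eq_zero_of_top _ (by simp), if_neg (by omega)]
  · intro h
    have h0 : ∀ a b, k + 1 ∈ b → x a b = 0 := fun a b hb => by
      by_contra hne
      refine hne (h.eq_zero_of_lt (fun v hv => ?_) hb)
      have := (h.subset_of_ne hne).1 v hv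
      omega
    refine ⟨h.empty, h.nonneg, h.supp_left, fun a b hne v hv => ?_, h.card_eq,
      fun a ha b => ?_⟩
    · have := (h.subset_of_ne hne).2 v hv
      have : v ≠ k + 1 := fun e => hne (h0 a b (e ▸ hv))
      exact Finset.mem_range.2 (by omega)
    · rw [← bd_succ (fun b hb => h0 a b hb), h.chain a ha]

theorem IsO.succ {k m : ℕ} {x : Mat} (h : IsO k m x) : IsO (k + 1) m x :=
  (isO_succ_iff.1 h).toIsO

/-- The morphism induced by the inclusion of one simplex in the next. -/
def incl (k : ℕ) : Hom (nerve k) (nerve (k + 1)) where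
  toFun m x := elem (val_isO x.2).succ
  map_d m i hi x := nerve_ext (by rw [val_elem, val_d, val_d, val_elem])
  map_s m i hi x := nerve_ext (by rw [val_elem, val_s, val_s, val_elem])
  map_wedge m i hi x y w h := by
    rw [isWedge_iff hi] at h ⊢
    rwa [val_elem, val_elem, val_elem]

theorem matFun_incl {k : ℕ} {U : WedgeData.{u}} (f : Hom (nerve (k + 1)) U) {m : ℕ} {x : Mat}
    (h : IsO k m x) : matFun (f.comp (incl k)) m x = matFun f m x := by
  rw [matFun_of_isO _ h, matFun_of_isO _ h.succ]
  change (⟨m, f.toFun m _⟩ : U.E) = _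
  congr 2
  refine nerve_ext ((val_elem (val_isO (elem h).2).succ).trans ?_)
  rw [val_elem, val_elem]

/-! ### Joins with the last vertex -/

/-- The join of a matrix with `m + 1 ↦ k + 1`. -/
def cone (k m : ℕ) (t : Mat) : Mat := fun a b =>
  if m + 1 ∈ a then (if k + 1 ∈ b then t (a.erase (m + 1)) (b.erase (k + 1)) else 0) else t a b

section
variable {k m : ℕ} {t : Mat}

theorem cone_of_notMem {a : Finset ℕ} (h : m + 1 ∉ a) (b : Finset ℕ) :
    cone k m t a b = t a b := if_neg h

theorem cone_of_mem {a b : Finset ℕ} (h : m + 1 ∈ a) (h' : k + 1 ∈ b) :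
    cone k m t a b = t (a.erase (m + 1)) (b.erase (k + 1)) := by
  unfold cone
  rw [if_pos h, if_pos h']

theorem cone_of_mem_of_notMem {a b : Finset ℕ} (h : m + 1 ∈ a) (h' : k + 1 ∉ b) :
    cone k m t a b = 0 := by
  unfold cone
  rw [if_pos h, if_neg h']

theorem subset_range_of_erase {N : ℕ} {a : Finset ℕ} (h : a.erase N ⊆ Finset.range N) :
    a ⊆ Finset.range (N + 1) := by
  intro v hv
  by_cases e : v = N
  · exact Finset.mem_range.2 (by omega)
  · have := Finset.mem_range.1 (h (Finset.mem_erase.2 ⟨e, hv⟩))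
    exact Finset.mem_range.2 (by omega)

theorem IsO.cone_isO (h : IsO k m t) : IsO (k + 1) (m + 1) (cone k m t) where
  empty b := by rw [cone_of_notMem (by simp), h.empty]
  nonneg a b := by
    unfold cone
    split_ifs
    · exact h.nonneg _ _
    · exact le_rfl
    · exact h.nonneg _ _
  supp_left a b hne := by
    unfold cone at hne
    split_ifs at hne with h1 h2
    · exact subset_range_of_erase (h.supp_left _ _ hne)
    · exact absurd rfl hne
    · exact (h.supp_left _ _ hne).trans (Finset.range_subset_range.2 (by omega))
  supp_right a b hne := by
    unfold cone at hne
    split_ifs at hne with h1 h2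
    · exact subset_range_of_erase (h.supp_right _ _ hne)
    · exact absurd rfl hne
    · exact (h.supp_right _ _ hne).trans (Finset.range_subset_range.2 (by omega))
  card_eq a b hne := by
    unfold cone at hne
    split_ifs at hne with h1 h2
    · have := h.card_eq _ _ hne
      rw [Finset.card_erase_of_mem h1, Finset.card_erase_of_mem h2] at this
      have := Finset.card_pos.2 ⟨_, h1⟩
      have := Finset.card_pos.2 ⟨_, h2⟩
      omega
    · exact absurd rfl hne
    · exact h.card_eq _ _ hne
  chain a ha b := by
    by_cases hma : m + 1 ∈ a
    swap
    · have ha' : a ⊆ Finset.range (m + 1) := fun v hv => by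
        have := Finset.mem_range.1 (ha hv)
        have : v ≠ m + 1 := fun e => hma (e ▸ hv)
        exact Finset.mem_range.2 (by omega)
      have h1 : alt (cone k m t) a b = alt t a b := Finset.sum_congr rfl fun v _ => by
        rw [cone_of_notMem fun h' => hma (Finset.mem_of_mem_erase h')]
      have h2 : bd (k + 1 + 1) (cone k m t a) b = bd (k + 1 + 1) (t a) b := bd_congr fun v _ _ => by
        rw [cone_of_notMem hma]
      rw [h1, h2, bd_succ (fun b hb => h.eq_zero_of_top a hb), h.chain a ha']
    obtain ⟨α, hmα, rfl⟩ : ∃ α, m + 1 ∉ α ∧ a = insert (m + 1) α :=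
      ⟨a.erase (m + 1), Finset.notMem_erase _ _, (Finset.insert_erase hma).symm⟩
    have hα : α ⊆ Finset.range (m + 1) := fun v hv => by
      have := Finset.mem_range.1 (ha (Finset.mem_insert_of_mem hv))
      have : v ≠ m + 1 := fun e => hmα (e ▸ hv)
      exact Finset.mem_range.2 (by omega)
    unfold alt
    rw [Finset.sum_insert hmα, Finset.erase_insert hmα, cone_of_notMem hmα]
    have hterm : ∀ v ∈ α, m + 1 ∈ (insert (m + 1) α).erase v := fun v hv =>
      Finset.mem_erase.2 ⟨fun e => hmα (e ▸ hv), Finset.mem_insert_self _ _⟩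
    by_cases hkb : k + 1 ∈ b
    · obtain ⟨β, hkβ, rfl⟩ : ∃ β, k + 1 ∉ β ∧ b = insert (k + 1) β :=
        ⟨b.erase (k + 1), Finset.notMem_erase _ _, (Finset.insert_erase hkb).symm⟩
      rw [bd_insert_top, h.eq_zero_of_top _ hkb, mul_zero, zero_add]
      have h1 : bd (k + 1) (fun b => cone k m t (insert (m + 1) α) (insert (k + 1) b)) β =
          bd (k + 1) (t α) β := bd_congr fun v hv _ => by
        rw [cone_of_mem (Finset.mem_insert_self _ _) (Finset.mem_insert_self _ _),
          Finset.erase_insert hmα, Finset.erase_insert]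
        rw [Finset.mem_insert]
        rintro (e | e)
        · omega
        · exact hkβ e
      rw [h1, h.chain α hα]
      refine Finset.sum_congr rfl fun v hv => ?_
      have hv' := Finset.mem_range.1 (hα hv)
      rw [cone_of_mem (hterm v hv) hkb, Finset.erase_insert hkβ, sgn_insert_gt hv'.le,
        Finset.erase_right_comm, Finset.erase_insert hmα]
    · rw [Finset.sum_eq_zero fun v hv => by
        rw [cone_of_mem_of_notMem (hterm v hv) hkb, mul_zero], add_zero, sgn_insert_self]
      unfold bd
      rw [Finset.sum_eq_single (k + 1)]
      · rw [cone_of_mem (Finset.mem_insert_self _ _) (Finset.mem_insert_self _ _),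
          Finset.erase_insert hmα, Finset.erase_insert hkb]
        -- The join vertices come last in source and target, and `α` and `b` have the same number of
        -- elements, so the two signs agree.
        by_cases h0 : t α b = 0
        · rw [h0, mul_zero, mul_zero]
        · rw [sgn_eq_of_forall_lt fun u hu => Finset.mem_range.1 (h.supp_right _ _ h0 hu),
            sgn_eq_of_forall_lt fun u hu => Finset.mem_range.1 (hα hu), h.card_eq _ _ h0]
      · intro v _ hv
        rw [cone_of_mem_of_notMem (Finset.mem_insert_self _ _), mul_zero]
        rw [Finset.mem_insert]
        rintro (e | e)
        · exact hv e.symm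
        · exact hkb e
      · intro h'
        exact absurd (Finset.mem_sdiff.2 ⟨Finset.self_mem_range_succ _, hkb⟩) h'

theorem mface_cone {i : ℕ} (hi : i ≤ m + 1) :
    mface i (cone k (m + 1) t) = cone k m (mface i t) := by
  funext a b
  have h1 : m + 1 + 1 ∈ a.image (skip i) ↔ m + 1 ∈ a := by
    rw [mem_image_skip]
    constructor
    · rintro (⟨h, -⟩ | ⟨-, h⟩)
      · omega
      · exact h
    · exact fun h => Or.inr ⟨by omega, h⟩
  have h2 : skip i (m + 1) = m + 1 + 1 := by unfold skip; rw [if_neg (by omega)]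
  unfold mface cone
  simp only [h1]
  rw [Finset.image_erase (skip_injective i), h2]

theorem mface_cone_last (h : IsO k m t) : mface (m + 1) (cone k m t) = t := by
  funext a b
  unfold mface
  rw [cone_of_notMem (notMem_image_skip _ _)]
  by_cases ha : a ⊆ Finset.range (m + 1)
  · rw [image_skip_of_lt fun v hv => Finset.mem_range.1 (ha hv)]
  · have h1 : t a b = 0 := by
      by_contra hne
      exact ha (h.supp_left _ _ hne)
    rw [h1]
    by_contra hne
    apply ha
    intro v hv
    have := Finset.mem_range.1 (h.supp_left _ _ hne (Finset.mem_image_of_mem _ hv))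
    unfold skip at this
    split_ifs at this
    · exact Finset.mem_range.2 (by omega)
    · omega

theorem mdeg_cone {i : ℕ} (hi : i ≤ m) : mdeg i (cone k m t) = cone k (m + 1) (mdeg i t) := by
  funext a b
  by_cases h : i ∈ a ∧ i + 1 ∈ a
  · rw [mdeg_apply_of_mem h.1 h.2]
    unfold cone
    rw [mdeg_apply_of_mem (Finset.mem_erase.2 ⟨by omega, h.1⟩) (Finset.mem_erase.2 ⟨by omega, h.2⟩),
      mdeg_apply_of_mem h.1 h.2]
    simp
  · have h' : i ∉ a ∨ i + 1 ∉ a := by tauto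
    have h'' : i ∉ a.erase (m + 1 + 1) ∨ i + 1 ∉ a.erase (m + 1 + 1) :=
      h'.imp (fun h e => h (Finset.mem_of_mem_erase e)) (fun h e => h (Finset.mem_of_mem_erase e))
    have h1 : m + 1 ∈ a.image (dup i) ↔ m + 1 + 1 ∈ a := by
      rw [mem_image_dup]
      constructor
      · rintro (⟨h, -⟩ | ⟨-, h⟩)
        · omega
        · exact h
      · exact fun h => Or.inr ⟨by omega, h⟩
    have h2 : dup i (m + 1 + 1) = m + 1 := by unfold dup; rw [if_neg (by omega)]; omega
    rw [mdeg_apply_of_notMem h']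
    unfold cone
    rw [mdeg_apply_of_notMem h', mdeg_apply_of_notMem h'']
    by_cases hm : m + 1 + 1 ∈ a
    · rw [image_dup_erase h' hm, h2, if_pos hm, if_pos (h1.2 hm)]
    · rw [if_neg hm, if_neg (fun h => hm (h1.1 h))]

theorem Van.cone {i : ℕ} (h : Van i t) (hi : i + 2 ≤ m) : Van i (cone k m t) := by
  intro a h0 h1 h2 b
  unfold Oriental.cone
  split_ifs
  · exact h _ (Finset.mem_erase.2 ⟨by omega, h0⟩) (Finset.mem_erase.2 ⟨by omega, h1⟩)
      (Finset.mem_erase.2 ⟨by omega, h2⟩) _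
  · rfl
  · exact h a h0 h1 h2 b

/-- By `Dep` the values on simplexes with the last vertex consist only of terms with `k + 1`.
`IsO.alt_botPart_sub` then equates these terms, with `k + 1` removed, with the value on the opposite
face. -/
theorem Cls.eq_cone {x : Mat} (hx : Cls (k + 1) (m + 1) (m + 1) x)
    (hd : Dep (k + 1) (m + 1) 0 x) : x = Oriental.cone k m (mface (m + 1) x) := by
  have hlow : ∀ a : Finset ℕ, a ⊆ Finset.range (m + 1) → mface (m + 1) x a = x a := fun a ha => by
    unfold mface
    rw [image_skip_of_lt fun v hv => Finset.mem_range.1 (ha hv)]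
  have hface := hx.toIsO.mface (i := m + 1) le_rfl
  funext a b
  by_cases ha : a ⊆ Finset.range (m + 1 + 1)
  swap
  · have h1 : x a b = 0 := by
      by_contra hne
      exact ha (hx.supp_left _ _ hne)
    rw [h1]
    symm
    unfold Oriental.cone
    split_ifs
    · by_contra hne
      exact ha (subset_range_of_erase (hface.supp_left _ _ hne))
    · rfl
    · by_contra hne
      exact ha ((hface.supp_left _ _ hne).trans (Finset.range_subset_range.2 (by omega)))
  by_cases hma : m + 1 ∈ a
  swap
  · have ha' : a ⊆ Finset.range (m + 1) := fun v hv => by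
      have := Finset.mem_range.1 (ha hv)
      have : v ≠ m + 1 := fun e => hma (e ▸ hv)
      exact Finset.mem_range.2 (by omega)
    rw [cone_of_notMem hma, hlow a ha']
  obtain ⟨α, hmα, rfl⟩ : ∃ α, m + 1 ∉ α ∧ a = insert (m + 1) α :=
    ⟨a.erase (m + 1), Finset.notMem_erase _ _, (Finset.insert_erase hma).symm⟩
  have hα : α ⊆ Finset.range (m + 1) := fun v hv => by
    have := Finset.mem_range.1 (ha (Finset.mem_insert_of_mem hv))
    have : v ≠ m + 1 := fun e => hmα (e ▸ hv)
    exact Finset.mem_range.2 (by omega)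
  have hle : ∀ v ∈ insert (m + 1) α, v ≤ m + 1 := subset_range_iff.1 ha
  have hbot0 : ∀ b, botPart (k + 1) (m + 1) x {m + 1} b = 0 := fun b => by
    unfold botPart
    split_ifs with h
    · rfl
    · rw [hx.vertex_eq le_rfl le_rfl, if_neg]
      rintro rfl
      exact h ⟨by simp, fun v hv => by simp at hv; omega⟩
  have hbot : ∀ α' ⊆ α, ∀ b, botPart (k + 1) (m + 1) x (insert (m + 1) α') b = 0 := by
    intro α' hα' b
    rcases α'.eq_empty_or_nonempty with rfl | ⟨v, hv⟩
    · exact hbot0 b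
    · exact hd _ (Finset.mem_insert_self _ _) ⟨v, Finset.mem_insert_of_mem hv, Nat.zero_le _,
        Finset.mem_range.1 (hα (hα' hv))⟩ b
  by_cases hkb : k + 1 ∈ b
  · rw [cone_of_mem hma hkb, Finset.erase_insert hmα, hlow α hα]
    obtain ⟨β, hkβ, rfl⟩ : ∃ β, k + 1 ∉ β ∧ b = insert (k + 1) β :=
      ⟨b.erase (k + 1), Finset.notMem_erase _ _, (Finset.insert_erase hkb).symm⟩
    rw [Finset.erase_insert hkβ]
    have h1 := hx.alt_botPart_sub ha hma β
    rw [bd_zero (hbot α subset_rfl) β, sub_zero] at h1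
    unfold alt at h1
    rw [Finset.sum_insert hmα, Finset.erase_insert hmα, hx.botPart_eq hmα,
      Finset.sum_eq_zero fun v hv => ?_, add_zero] at h1
    · have h2 := mul_left_cancel₀ (sgn_ne_zero _ _) h1
      rw [h2]
      unfold defect
      rw [if_pos hle, if_neg hkβ]
    · rw [Finset.erase_insert_of_ne (by rintro rfl; exact hmα hv), hbot _ (Finset.erase_subset _ _),
        mul_zero]
  · rw [cone_of_mem_of_notMem hma hkb]
    have h1 := hbot α subset_rfl b
    unfold botPart at h1
    rwa [if_neg (fun h => hkb h.1)] at h1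

end

/-- The joins with the last vertex form a morphism to the décalage. -/
def coneHom (k : ℕ) : Hom (nerve k) (nerve (k + 1)).Dec where
  toFun m x := elem (val_isO x.2).cone_isO
  map_d m i hi x := nerve_ext ((val_elem _).trans (.symm (
    (val_d (n := k + 1) (m := m + 1) (i := i) (by omega) _).trans (by
      rw [val_elem, mface_cone hi, val_d hi]))))
  map_s m i hi x := nerve_ext ((val_elem _).trans (.symm (
    (val_s (n := k + 1) (m := m + 1) (i := i) (by omega) _).trans (by
      rw [val_elem, mdeg_cone hi, val_s hi]))))
  map_wedge m i hi x y w h := by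
    rw [isWedge_iff hi] at h
    refine (isWedge_iff (n := k + 1) (m := m + 1) (by omega) _ _ _).2 ?_
    rw [val_elem, val_elem, val_elem, mface_cone (by omega), mface_cone (by omega), h.1, h.2.1]
    exact ⟨rfl, rfl, h.2.2.cone (by omega)⟩

end Oriental

end

noncomputable section

namespace Oriental

open WedgeData

/-! ### Vertices -/

theorem Cls.eq_of_vertex {n : ℕ} {x y : Mat} (hx : Cls n 0 0 x) (hy : Cls n 0 0 y) : x = y := by
  funext a b
  by_cases ha : a ⊆ Finset.range (0 + 1)
  · rw [zero_add, Finset.range_one, Finset.subset_singleton_iff] at ha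
    rcases ha with rfl | rfl
    · rw [hx.empty, hy.empty]
    · rw [hx.vertex_eq le_rfl le_rfl, hy.vertex_eq le_rfl le_rfl]
  · have h0 : ∀ {z}, Cls n 0 0 z → z a b = 0 := fun hz => by
      by_contra hne
      exact ha (hz.supp_left _ _ hne)
    rw [h0 hx, h0 hy]

theorem Cls.eq_zero {m p : ℕ} {x : Mat} (hx : Cls 0 m p x) : p = 0 := by
  have h1 := hx.toIsO.sum_vertex (v := 0) (by omega)
  rw [zero_add, Finset.sum_range_one, hx.vertex 0 (by omega)] at h1
  by_contra hne
  rw [if_neg (by omega)] at h1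
  omega

theorem IsO.exists_vertex {n m : ℕ} {x : Mat} (h : IsO n m x) : ∃ y, IsO n 0 y := by
  induction m generalizing x with
  | zero => exact ⟨x, h⟩
  | succ m ih => exact ih (h.mface (i := 0) (by omega))

theorem IsO.cone_cls {k m : ℕ} {t : Mat} (h : IsO k m t) :
    Cls (k + 1) (m + 1) (m + 1) (cone k m t) where
  toIsO := h.cone_isO
  le := by omega
  vertex v hv := by
    by_cases hvm : v = m + 1
    · subst hvm
      rw [cone_of_mem (by simp) (by simp), if_pos le_rfl]
      simp [h.empty]
    · rw [cone_of_notMem (by simp only [Finset.mem_singleton]; omega),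
        h.eq_zero_of_top _ (by simp), if_neg (by omega)]

theorem IsO.mface_cone_zero {k : ℕ} {t : Mat} (h : IsO k 0 t) :
    Cls (k + 1) 0 0 (Oriental.mface 0 (cone k 0 t)) where
  toIsO := h.cone_isO.mface (by omega)
  le := by omega
  vertex v hv := by
    obtain rfl : v = 0 := by omega
    have e : ({0} : Finset ℕ).image (skip 0) = {0 + 1} := by simp [skip]
    unfold Oriental.mface
    rw [e, cone_of_mem (by simp) (by simp), if_pos le_rfl]
    simp [h.empty]

/-- Every vertex is joined by an edge to the vertex `k`. The values assigned to the cone vertex by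
different `t` can therefore all be compared with the one for `k`. -/
theorem exists_edge {k : ℕ} {t : Mat} (h : IsO k 0 t) :
    ∃ e, IsO k 1 e ∧ mface 1 e = t ∧ Cls k 0 0 (mface 0 e) := by
  obtain ⟨p, hp⟩ := exists_cls h
  obtain rfl | rfl : p = 0 ∨ p = 1 := by have := hp.le; omega
  · exact ⟨mdeg 0 t, h.mdeg le_rfl, mface_mdeg_succ 0 t, by rwa [mface_mdeg_self]⟩
  · obtain _ | k := k
    · exact absurd hp.eq_zero one_ne_zero
    · have h' := isO_succ_iff.2 hp
      exact ⟨cone k 0 t, h'.cone_isO, mface_cone_last h', h'.mface_cone_zero⟩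

/-! ### Matrices of rank at most one -/

theorem IsO.cl {k m : ℕ} {x : Mat} (h : IsO k m x) : Cl (k + 1) 1 0 m x :=
  ⟨m + 1, isO_succ_iff.1 h, Or.inl (by omega)⟩

theorem Cl.cases_cone {k m : ℕ} {x : Mat} (h : Cl (k + 1) 1 0 m x) :
    IsO k m x ∨ (m = 0 ∧ Cls (k + 1) 0 0 x) ∨
      ∃ m' t, m = m' + 1 ∧ IsO k m' t ∧ x = cone k m' t := by
  obtain ⟨p, hp, h | ⟨h, hd⟩⟩ := h
  · obtain rfl : p = m + 1 := by have := hp.le; omega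
    exact Or.inl (isO_succ_iff.2 hp)
  · obtain rfl : m = p := by omega
    obtain _ | m := m
    · exact Or.inr (Or.inl ⟨rfl, hp⟩)
    · exact Or.inr (Or.inr ⟨m, _, rfl, isO_succ_iff.2 (hp.mface_ge le_rfl le_rfl), hp.eq_cone hd⟩)

theorem Cl.cases_zero {m : ℕ} {x : Mat} (h : Cl 0 1 0 m x) : m = 0 ∧ Cls 0 0 0 x := by
  obtain ⟨p, hp, h⟩ := h
  obtain rfl := hp.eq_zero
  obtain rfl : m = 0 := by omega
  exact ⟨rfl, hp⟩

theorem Cl.le {n m p : ℕ} {x : Mat} (h : Cl n 1 0 m x) (hp : Cls n m p x) : m ≤ p := by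
  obtain ⟨q, hq, h⟩ := h
  obtain rfl := hp.unique hq
  omega

theorem van_of_van_cone {k m i : ℕ} {t : Mat} (ht : IsO k m t) (h : Van i (cone k m t)) :
    Van i t := by
  intro a h0 h1 h2 b
  by_cases hma : m + 1 ∈ a
  · by_contra hne
    have := Finset.mem_range.1 (ht.supp_left _ _ hne hma)
    omega
  · rw [← cone_of_notMem (k := k) (t := t) hma]
    exact h a h0 h1 h2 b

theorem eq_zero_of_van_cone {k i : ℕ} {t : Mat} (ht : IsO k (i + 1) t)
    (h : Van i (cone k (i + 1) t)) {a : Finset ℕ} (h0 : i ∈ a) (h1 : i + 1 ∈ a) (b : Finset ℕ) :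
    t a b = 0 := by
  by_contra hne
  have ha : i + 1 + 1 ∉ a := fun h' => by
    have := Finset.mem_range.1 (ht.supp_left _ _ hne h')
    omega
  have hb : k + 1 ∉ b := fun h' => by
    have := Finset.mem_range.1 (ht.supp_right _ _ hne h')
    omega
  have := h (insert (i + 1 + 1) a) (Finset.mem_insert_of_mem h0) (Finset.mem_insert_of_mem h1)
    (Finset.mem_insert_self _ _) (insert (k + 1) b)
  rw [cone_of_mem (Finset.mem_insert_self _ _) (Finset.mem_insert_self _ _),
    Finset.erase_insert ha, Finset.erase_insert hb] at this
  exact hne this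

/-- In the boundary of a simplex with both last vertices, only the faces opposite these two survive,
with opposite signs. So the last two faces agree, and `t` is degenerate. This is what thinness of a
cone at the place that involves its apex amounts to. -/
theorem IsO.eq_mdeg_last {k m : ℕ} {t : Mat} (ht : IsO k (m + 1) t)
    (h : ∀ a : Finset ℕ, m ∈ a → m + 1 ∈ a → ∀ b, t a b = 0) : t = Oriental.mdeg m (Oriental.mface (m + 1) t) := by
  have hface : Oriental.mface m t = Oriental.mface (m + 1) t := by
    funext a b
    by_cases ha : a ⊆ Finset.range (m + 1)
    swap
    · have h0 : ∀ i ≤ m + 1, Oriental.mface i t a b = 0 := fun i hi => by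
        by_contra hne
        exact ha ((ht.mface hi).supp_left _ _ hne)
      rw [h0 m (by omega), h0 (m + 1) le_rfl]
    unfold Oriental.mface
    rw [image_skip_of_lt fun v hv => Finset.mem_range.1 (ha hv)]
    by_cases hm : m ∈ a
    swap
    · rw [image_skip_of_lt fun v hv => ?_]
      have := Finset.mem_range.1 (ha hv)
      have : v ≠ m := fun e => hm (e ▸ hv)
      omega
    obtain ⟨c, hmc, rfl⟩ : ∃ c, m ∉ c ∧ a = insert m c :=
      ⟨a.erase m, Finset.notMem_erase _ _, (Finset.insert_erase hm).symm⟩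
    have hc : ∀ v ∈ c, v < m := fun v hv => by
      have := Finset.mem_range.1 (ha (Finset.mem_insert_of_mem hv))
      have : v ≠ m := fun e => hmc (e ▸ hv)
      omega
    have hm1 : m + 1 ∉ insert m c := fun h' => by
      have := Finset.mem_range.1 (ha h')
      omega
    rw [Finset.image_insert, image_skip_of_lt hc]
    have e : skip m m = m + 1 := by simp [skip]
    rw [e]
    have hsub : insert (m + 1) (insert m c) ⊆ Finset.range (m + 1 + 1) := by
      intro v hv
      rcases Finset.mem_insert.1 hv with rfl | hv
      · exact Finset.self_mem_range_succ _
      · exact Finset.mem_range.2 (by have := Finset.mem_range.1 (ha hv); omega)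
    have h1 := ht.chain _ hsub b
    rw [bd_zero (h _ (by simp) (by simp))] at h1
    unfold alt at h1
    rw [Finset.sum_insert hm1, Finset.sum_insert hmc, Finset.erase_insert hm1,
      Finset.sum_eq_zero fun v hv => ?_, add_zero] at h1
    · have h2 : sgn (insert (m + 1) (insert m c)) (m + 1) =
          - sgn (insert (m + 1) (insert m c)) m :=
        sgn_eq_neg_of_adjacent (by simp) (by omega) (by omega)
      have h3 : (insert (m + 1) (insert m c)).erase m = insert (m + 1) c := by
        rw [Finset.erase_insert_of_ne (by omega), Finset.erase_insert hmc]
      rw [h2, h3] at h1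
      have h4 := sgn_ne_zero (insert (m + 1) (insert m c)) m
      have h5 : sgn (insert (m + 1) (insert m c)) m *
          (t (insert (m + 1) c) b - t (insert m c) b) = 0 := by
        rw [mul_sub]
        linarith
      rcases mul_eq_zero.1 h5 with h6 | h6
      · exact absurd h6 h4
      · omega
    · have := hc v hv
      rw [h _ (Finset.mem_erase.2 ⟨by omega, by simp⟩) (Finset.mem_erase.2 ⟨by omega, by simp⟩),
        mul_zero]
  funext a b
  by_cases h1 : m + 1 ∈ a
  swap
  · rw [mdeg_apply_of_notMem (Or.inr h1)]
    unfold Oriental.mface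
    rw [image_skip_image_dup h1 (Or.inr rfl)]
  by_cases h0 : m ∈ a
  · rw [mdeg_apply_of_mem h0 h1, h a h0 h1]
  · rw [mdeg_apply_of_notMem (Or.inl h0), ← hface]
    unfold Oriental.mface
    rw [image_skip_image_dup h0 (Or.inl rfl)]

/-! ### The last face and the join of the identity -/

theorem incl_iota (k : ℕ) :
    (incl k).toFun k (iota k) = (nerve (k + 1)).d (k + 1) (iota (k + 1)) :=
  nerve_ext ((val_elem (val_isO (iota k).2).succ).trans (((val_d le_rfl _).trans (mface_val_iota k)).symm))

theorem coneHom_iota (k : ℕ) : (coneHom k).toFun k (iota k) = iota (k + 1) := by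
  refine nerve_ext (n := k + 1) (m := k + 1) ((val_elem (val_isO (iota k).2).cone_isO).trans ?_)
  have := (val_iota_cls (k + 1)).eq_cone (val_iota_dep (k + 1))
  rw [mface_val_iota] at this
  exact this.symm

theorem matFun_cone {k : ℕ} {U : WedgeData.{u}} (f : Hom (nerve (k + 1)) U) {m : ℕ} {t : Mat}
    (h : IsO k m t) :
    matFun f (m + 1) (cone k m t) = Dec.shift (matFun (f.dec.comp (coneHom k)) m t) := by
  rw [matFun_of_isO _ h, matFun_of_isO _ h.cone_isO]
  change _ = (⟨m + 1, f.toFun (m + 1) _⟩ : U.E)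
  congr 2
  refine nerve_ext ((val_elem _).trans ?_)
  refine Eq.trans ?_ (val_elem (val_isO (elem h).2).cone_isO).symm
  rw [val_elem]

/-! ### Uniqueness -/

/-- The value at the identity determines the morphism on rank zero through its last face, and on
cones through the décalage, both by induction. The vertex `k + 1` is a face of a cone, so the base
of the filtration is covered. -/
theorem hom_eq_of_iota (n : ℕ) {U : WedgeData.{u}} (hU : U.IsComplicial) {f g : Hom (nerve n) U}
    (h : f.toFun n (iota n) = g.toFun n (iota n)) : f = g := by
  induction n generalizing U with
  | zero =>
    refine hom_ext fun m x hx => (faceThin_matFun f hU).eq_of_eq (faceThin_matFun g hU)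
      (fun m x hx => ?_) hx
    obtain ⟨rfl, hx'⟩ := hx.cases_zero
    rw [hx'.eq_of_vertex (val_iota_cls 0), matFun_val, matFun_val, h]
  | succ k ih =>
    have hA : f.comp (incl k) = g.comp (incl k) := ih hU (by
      change f.toFun k _ = g.toFun k _
      rw [incl_iota, f.map_d _ _ le_rfl, g.map_d _ _ le_rfl, h])
    have hB : f.dec.comp (coneHom k) = g.dec.comp (coneHom k) := ih (Dec.isComplicial hU) (by
      change f.toFun (k + 1) _ = g.toFun (k + 1) _
      rw [coneHom_iota, h])
    have hf := faceThin_matFun f hU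
    have hg := faceThin_matFun g hU
    refine hom_ext fun m x hx => hf.eq_of_eq hg (fun m x hx => ?_) hx
    rcases hx.cases_cone with hx | ⟨rfl, hx'⟩ | ⟨m, t, rfl, ht, rfl⟩
    · rw [← matFun_incl f hx, ← matFun_incl g hx, hA]
    · obtain ⟨t, ht⟩ := (val_isO (iota k).2).exists_vertex
      rw [hx'.eq_of_vertex ht.mface_cone_zero, ← hf.face ht.cone_isO (by omega),
        ← hg.face ht.cone_isO (by omega), matFun_cone f ht, matFun_cone g ht, hB]
    · rw [matFun_cone f ht, matFun_cone g ht, hB]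

/-! ### Existence -/

-- The morphism `fA` into `U` gives the values on rank zero, and `fB` into the décalage gives the
-- values on cones. They are glued on the base of the filtration and extended by `exists_extension`.
open Classical in
theorem exists_hom_iota (n : ℕ) {U : WedgeData.{u}} (hU : U.IsComplicial) (u : U.X n) :
    ∃ f : Hom (nerve n) U, f.toFun n (iota n) = u := by
  induction n generalizing U with
  | zero =>
    have h₀ : FaceThin 0 U (Cl 0 1 0) (fun _ _ => ⟨0, u⟩) := by
      constructor
      · exact fun h hi => h.mface hi
      · exact fun h => h.cases_zero.1.symm
      · intro m i x h
        exact absurd h.cases_zero.1 (by omega)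
      · intro m i x h hi
        have := h.cases_zero.1
        omega
      · intro m p x h
        exact absurd h.cases_zero.1 (by omega)
    obtain ⟨Φ, hΦ, he⟩ := exists_extension hU h₀
    obtain ⟨f, hf⟩ := exists_hom hU hΦ (fun x hx => absurd hx.eq_zero one_ne_zero)
    refine ⟨f, ?_⟩
    have h1 := hf 0 (iota 0)
    rw [he _ _ ⟨0, val_iota_cls 0, Or.inr ⟨rfl, val_iota_dep 0⟩⟩] at h1
    simpa using h1.symm
  | succ k ih =>
    obtain ⟨fA, hfA⟩ := ih hU (U.d (k + 1) u)
    obtain ⟨fB, hfB⟩ := ih (U := U.Dec) (Dec.isComplicial hU) u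
    -- The last face of a cone is its base, so gluing requires this equation; both sides send the
    -- identity to the last face of `u`.
    have hlast : (Dec.last hU).comp fB = fA := hom_eq_of_iota k hU (by
      change U.d (k + 1) (fB.toFun k (iota k)) = _
      rw [hfA, hfB])
    have hA := faceThin_matFun fA hU
    have hB' := faceThin_matFun fB (Dec.isComplicial hU)
    let B : ℕ → Mat → U.E := fun m t => Dec.shift (matFun fB m t)
    have hBdim : ∀ {m t}, IsO k m t → (B m t).1 = m + 1 := fun {m t} h =>
      congrArg (· + 1) (hB'.dim h)
    have hBface : ∀ {m i t}, IsO k (m + 1) t → i ≤ m + 1 →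
        U.D i (B (m + 1) t) = B m (mface i t) := by
      intro m i t h hi
      refine Eq.trans ?_ (congrArg Dec.shift (hB'.face h hi))
      obtain ⟨x, hx⟩ := exists_mk (hB'.dim h)
      change U.D i (Dec.shift (matFun fB (m + 1) t)) = _
      rw [hx]
      exact Dec.D_shift hi x
    have hBdeg : ∀ {m i t}, IsO k m t → i ≤ m → B (m + 1) (mdeg i t) = U.S i (B m t) := by
      intro m i t h hi
      refine (congrArg Dec.shift (matFun_mdeg fB h hi)).trans ?_
      obtain ⟨x, hx⟩ := exists_mk (hB'.dim h)
      change _ = U.S i (Dec.shift (matFun fB m t))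
      rw [hx]
      exact (Dec.S_shift hi x).symm
    have hBthin : ∀ {m i t}, IsO k m t → i + 2 ≤ m → Van i t → U.Th i (B m t) :=
      fun h hi hv => Dec.th_shift (hB'.thin h hi hv)
    have hBlast : ∀ {m t}, IsO k m t → U.D (m + 1) (B m t) = matFun fA m t := by
      intro m t h
      rw [← hlast, matFun_of_isO _ h]
      change U.D (m + 1) (Dec.shift (matFun fB m t)) = _
      rw [matFun_of_isO _ h]
      exact D_mk le_rfl _
    -- The value of the vertex `k + 1`: the end point of the edge assigned to the cone on a vertex
    -- `t`, which does not depend on `t`.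
    obtain ⟨v, hv⟩ : ∃ v : U.E, ∀ t, IsO k 0 t → U.D 0 (B 0 t) = v := by
      by_cases hne : ∃ t, Cls k 0 0 t
      · obtain ⟨s, hs⟩ := hne
        refine ⟨U.D 0 (B 0 s), fun t ht => ?_⟩
        obtain ⟨e, he, h1, h0⟩ := exists_edge ht
        rw [hs.eq_of_vertex h0, ← h1, ← hBface he le_rfl, ← hBface he (by omega)]
        exact D_D hU le_rfl (by rw [hBdim he]; omega) (by rw [hBdim he])
      -- By `exists_edge` this case is vacuous, so the value chosen is arbitrary.
      · refine ⟨⟨k + 1, u⟩, fun t ht => ?_⟩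
        obtain ⟨e, -, -, h0⟩ := exists_edge ht
        exact absurd ⟨_, h0⟩ hne
    have hvdim : v.1 = 0 := by
      obtain ⟨t, ht⟩ := (val_isO (iota k).2).exists_vertex
      rw [← hv t ht]
      have := dim_D (U := U) (i := 0) (e := B 0 t) (by omega) (by rw [hBdim ht])
      rw [hBdim ht] at this
      omega
    -- The base of a cone is recovered as its last face, which explains the argument `mface m x`.
    let Φ₀ : ℕ → Mat → U.E := fun m x =>
      if IsO k m x then matFun fA m x else if m = 0 then v else B (m - 1) (mface m x)
    have hΦA : ∀ {m x}, IsO k m x → Φ₀ m x = matFun fA m x := fun h => if_pos h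
    have hΦv : ∀ {x}, Cls (k + 1) 0 0 x → Φ₀ 0 x = v := by
      intro x hx
      have : ¬ IsO k 0 x := fun h => absurd (hx.unique (isO_succ_iff.1 h)) (by omega)
      exact (if_neg this).trans (if_pos rfl)
    have hΦB : ∀ {m t}, IsO k m t → Φ₀ (m + 1) (cone k m t) = B m t := by
      intro m t ht
      have : ¬ IsO k (m + 1) (cone k m t) := fun h =>
        absurd (ht.cone_cls.unique (isO_succ_iff.1 h)) (by omega)
      refine ((if_neg this).trans (if_neg (by omega))).trans ?_
      rw [mface_cone_last ht, Nat.add_sub_cancel]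
    have h₀ : FaceThin (k + 1) U (Cl (k + 1) 1 0) Φ₀ := by
      constructor
      · exact fun h hi => h.mface hi
      · intro m x h
        rcases h.cases_cone with hx | ⟨rfl, hx⟩ | ⟨m, t, rfl, ht, rfl⟩
        · rw [hΦA hx, hA.dim hx]
        · rw [hΦv hx, hvdim]
        · rw [hΦB ht, hBdim ht]
      · intro m i x h hi
        rcases h.cases_cone with hx | ⟨hm, -⟩ | ⟨m', t, hm, ht, rfl⟩
        · rw [hΦA hx, hΦA (hx.mface hi), hA.face hx hi]
        · omega
        · obtain rfl : m = m' := by omega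
          rw [hΦB ht]
          obtain rfl | hi : i = m + 1 ∨ i ≤ m := by omega
          · rw [mface_cone_last ht, hΦA ht, hBlast ht]
          · obtain _ | m := m
            · obtain rfl : i = 0 := by omega
              rw [hv t ht, hΦv ht.mface_cone_zero]
            · rw [mface_cone hi, hΦB (ht.mface hi), hBface ht hi]
      · intro m i x h hi hvan
        rcases h.cases_cone with hx | ⟨hm, -⟩ | ⟨m, t, rfl, ht, rfl⟩
        · rw [hΦA hx]
          exact hA.thin hx hi hvan
        · omega
        · rw [hΦB ht]
          obtain rfl | hi : m = i + 1 ∨ i + 2 ≤ m := by omega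
          -- Thinness involves the apex, so `t` is degenerate at its last place and its value is a
          -- degeneracy.
          · have ht' := ht.mface (i := i + 1) le_rfl
            rw [ht.eq_mdeg_last fun a h0 h1 b => eq_zero_of_van_cone ht hvan h0 h1 b,
              hBdeg ht' le_rfl]
            exact th_S hU (by rw [hBdim ht'])
          · exact hBthin ht hi (van_of_van_cone ht hvan)
      -- In the base the rank is at most one, whereas the rule concerns rank at least two.
      · intro m p x h hp hpm
        have := h.le hp
        omega
    obtain ⟨Φ, hΦ, he⟩ := exists_extension hU h₀
    obtain ⟨f, hf⟩ := exists_hom hU hΦ (fun x hx => by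
      have hx' := isO_succ_iff.2 hx
      have hx'' := hx'.mdeg (i := 0) le_rfl
      rw [he _ _ hx'.cl, he _ _ hx''.cl, hΦA hx', hΦA hx'', matFun_mdeg fA hx' le_rfl])
    refine ⟨f, ?_⟩
    have h1 := hf (k + 1) (iota (k + 1))
    have h2 := (val_iota_cls (k + 1)).eq_cone (val_iota_dep (k + 1))
    rw [mface_val_iota] at h2
    rw [he _ _ ⟨k + 1, val_iota_cls (k + 1), Or.inr ⟨by omega, val_iota_dep (k + 1)⟩⟩, h2,
      hΦB (val_isO (iota k).2)] at h1
    have h3 : B k (val (iota k).1) = ⟨k + 1, u⟩ := by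
      change Dec.shift (matFun fB k (val (iota k).1)) = _
      rw [matFun_val, hfB]
      rfl
    rw [h3] at h1
    simpa using h1.symm

end Oriental

end


theorem theorem8p7 (n : ℕ) :
    (Oriental.nerve n).IsComplicial ∧
      ∀ U : WedgeData.{u}, U.IsComplicial → ∀ x : U.X n,
        ∃! f : (Oriental.nerve n).Hom U, f.toFun n (Oriental.iota n) = x := by
  refine ⟨Oriental.nerve_isComplicial n, fun U hU x => ?_⟩
  obtain ⟨f, hf⟩ := Oriental.exists_hom_iota n hU x
  exact ⟨f, hf, fun g hg => Oriental.hom_eq_of_iota n hU (hg.trans hf.symm)⟩
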